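/- Notation. Let $k,n\ge 1$ and fix $\kappa\in\mathbb C$, $\kappa\ne0$. For $N\ge1$ and $l\in\mathbb Z_{\ge0}$ let $V_l^{(N)}$ be the irreducible $\mathfrak{gl}_N$-module of highest weight $(l,0,\dots,0)$, i.e. the space of homogeneous polynomials of degree $l$ in $x_1,\dots,x_N$, on which the matrix unit $e_{ab}$ acts as $x_a\partial/\partial x_b$. On $V^{(k)}_{l_1}\otimes\dots\otimes V^{(k)}_{l_n}$ write $g^{(i)}$ for $g$ acting on the $i$-th factor, $e_{ab}=\sum_i e_{ab}^{(i)}$, and $[m_1,\dots,m_k]$ for the subspace on which each $e_{aa}$ acts as $m_a$. Put $\Omega=\sum_{a,b}e_{ab}\otimes e_{ba}$, $\Omega_+=\frac12\sum_a e_{aa}\otimes e_{aa}+\sum_{a<b}e_{ab}\otimes e_{ba}$, $r(x)=\frac{\Omega}{x-1}+\Omega_+$, $z_{ij}=z_i-z_j$, $\lambda_{ab}=\lambda_a-\lambda_b$. On functions of $(z;\lambda)=(z_1,\dots,z_n;\lambda_1,\dots,\lambda_k)$ with values in this tensor product consider the operators (superscripts $(k)$ omitted) $$\nabla_{z_i}(z;\lambda)=\kappa\frac{\partial}{\partial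 z_i}-\sum_{a=1}^k\lambda_a e_{aa}^{(i)}-\sum_{j\ne i}\frac{\Omega^{(ij)}}{z_i-z_j},\qquad \widehat\nabla_{z_i}(z;\lambda)=\kappa z_i\frac{\partial}{\partial z_i}-\sum_{a=1}^k\Bigl(\lambda_a-\frac{e_{aa}}2\Bigr)e_{aa}^{(i)}-\sum_{j\ne i}r^{(ij)}(z_i/z_j),$$ $$D_{\lambda_a}(z;\lambda)=\kappa\frac{\partial}{\partial\lambda_a}-\sum_{i=1}^n z_ie_{aa}^{(i)}-\sum_{b\ne a}\frac{e_{ab}e_{ba}-e_{aa}}{\lambda_a-\lambda_b},$$ $$\widehat D_{\lambda_a}(z;\lambda)=\kappa\lambda_a\frac{\partial}{\partial\lambda_a}+\frac{e_{aa}^2}2-\sum_{i=1}^n z_ie_{aa}^{(i)}-\sum_{b=1}^k\sum_{1\le i<j\le n}e_{ab}^{(i)}e_{ba}^{(j)}-\sum_{b\ne a}\frac{\lambda_b}{\lambda_a-\lambda_b}(e_{ab}e_{ba}-e_{aa}),$$ $$Q_{\lambda_a}(z;\lambda)=\bigl(B_{ak}(\lambda_{ak})\cdots B_{a,a+1}(\lambda_{a,a+1})\bigr)^{-1}\prod_{i=1}^n\bigl(z_i^{-e_{aa}}\bigr)^{(i)}\,B_{1a}(\lambda_{1a}-\kappa)\cdots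 B_{a-1,a}(\lambda_{a-1,a}-\kappa)\,T_{\lambda_a},$$ $$Z_{z_i}(z;\lambda)=\bigl(R_{in}(z_{in})\cdots R_{i,i+1}(z_{i,i+1})\bigr)^{-1}\prod_{a=1}^k\bigl(\lambda_a^{-e_{aa}}\bigr)^{(i)}\,R_{1i}(z_{1i}-\kappa)\cdots R_{i-1,i}(z_{i-1,i}-\kappa)\,T_{z_i},$$ where $T_u$ is the shift $u\mapsto u+\kappa$, $$B_{ab}(t)=1+\sum_{s\ge1}e_{ba}^se_{ab}^s\prod_{j=1}^s\frac1{j(t-e_{aa}+e_{bb}-j)},$$ and $R_{ij}(t)=\bigl(R_{V_{l_i}V_{l_j}}(t)\bigr)^{(ij)}$ with $R_{VW}(t)\in\mathrm{End}(V\otimes W)$ the rational $R$-matrix: for $t\notin\mathbb Z$ it is the unique operator that commutes with $\mathfrak{gl}_k$, satisfies $$R_{VW}(t)\Bigl(t\,e_{ab}\otimes1+\sum_c e_{ac}\otimes e_{cb}\Bigr)=\Bigl(t\,e_{ab}\otimes1+\sum_c e_{cb}\otimes e_{ac}\Bigr)R_{VW}(t)\qquad\text{for all }a,b,$$ and fixes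 the tensor product of the highest weight vectors. Further let $$C_{ab}(t)=\frac{\Gamma(t+1)\,\Gamma(t-e_{aa}+e_{bb})}{\Gamma(t-e_{aa})\,\Gamma(t+e_{bb}+1)},\qquad N_a(\lambda)=\prod_{1\le b<a}C_{ba}(\lambda_{ba}-\kappa)\prod_{a<b\le k}C_{ab}(\lambda_{ab})^{-1}.$$ The operators with superscript $(n)$ are defined by the same formulas for $\mathfrak{gl}_n$ and the $k$-fold tensor product $V^{(n)}_{m_1}\otimes\dots\otimes V^{(n)}_{m_k}$, with the roles of $k$ and $n$ exchanged; their arguments $(\lambda;z)$ indicate that the $\lambda_a$ play the role of the first group of variables and the $z_i$ that of the second. Theorem. Let $l\in\mathbb Z_{\ge0}^n$, $m\in\mathbb Z_{\ge0}^k$ with $\sum_il_i=\sum_am_a$, and let $v_i^{(k)}\in V^{(k)}_{l_i}$, $v_a^{(n)}\in V^{(n)}_{m_a}$ be highest weight vectors. For a nonnegative integer $k\times n$ matrix $\mathbf d=(d_{ai})$ with $\sum_ad_{ai}=l_i$ and $\sum_id_{ai}=m_a$ put, with $y^{[s]}=y^s/s!$, $$v^{(k)}_{\mathbf d}=\bigotimes_{i=1}^n\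 \prod_{a=2}^k\bigl(e_{a1}^{(k)}\bigr)^{[d_{ai}]}v_i^{(k)},\qquad v^{(n)}_{\mathbf d}=\bigotimes_{a=1}^k\ \prod_{i=2}^n\bigl(e_{i1}^{(n)}\bigr)^{[d_{ai}]}v_a^{(n)}$$ (here $e_{a1}^{(k)}$, $e_{i1}^{(n)}$ are matrix units of $\mathfrak{gl}_k$ and $\mathfrak{gl}_n$). There is a unique linear isomorphism $$\varphi:(V^{(k)}_{l_1}\otimes\dots\otimes V^{(k)}_{l_n})[m_1,\dots,m_k]\to(V^{(n)}_{m_1}\otimes\dots\otimes V^{(n)}_{m_k})[l_1,\dots,l_n]$$ with $\varphi(v^{(k)}_{\mathbf d})=v^{(n)}_{\mathbf d}$ for all such $\mathbf d$. For all $i=1,\dots,n$ and $a=1,\dots,k$, all the operators below preserve the functions with values in these weight subspaces, and on such functions $$\nabla^{(k)}_{z_i}(z;\lambda)=\varphi^{-1}D^{(n)}_{z_i}(\lambda;z)\,\varphi,\qquad D^{(k)}_{\lambda_a}(z;\lambda)=\varphi^{-1}\nabla^{(n)}_{\lambda_a}(\lambda;z)\,\varphi,$$ $$\widehat\nabla^{(k)}_{z_i}(z;\lambda)=\varphi^{-1}\widehat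 D^{(n)}_{z_i}(\lambda;z)\,\varphi,\qquad \widehat D^{(k)}_{\lambda_a}(z;\lambda)=\varphi^{-1}\widehat\nabla^{(n)}_{\lambda_a}(\lambda;z)\,\varphi,$$ $$Z^{(k)}_{z_i}(z;\lambda)=\varphi^{-1}N^{(n)}_i(z)\,Q^{(n)}_{z_i}(\lambda;z)\,\varphi,\qquad N^{(k)}_a(\lambda)\,Q^{(k)}_{\lambda_a}(z;\lambda)=\varphi^{-1}Z^{(n)}_{\lambda_a}(\lambda;z)\,\varphi.$$ The first four identities hold at every point where the function is complex differentiable and the denominators occurring in the formulas (including those in $z_i/z_j$, respectively $\lambda_a/\lambda_b$) do not vanish. The fifth holds at every point with all $\lambda_b\ne0$, $z_i-z_j\notin\mathbb Z$ for $j>i$ and $z_j-z_i-\kappa\notin\mathbb Z$ for $j<i$; the sixth holds at every point with all $z_j\ne0$, $\lambda_a-\lambda_b\notin\mathbb Z$ for $b>a$ and $\lambda_b-\lambda_a-\kappa\notin\mathbb Z$ for $b<a$. -/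

import Mathlib

open scoped TensorProduct

noncomputable section

namespace GLDuality

/-! ### The `gl_k`-modules `V_l` and their tensor products -/

/-- The action `x_a ∂_b` of the matrix unit `e_{ab}` on `ℂ[x_1, …, x_k]`. -/
def polyE (k : ℕ) (a b : Fin k) : Module.End ℂ (MvPolynomial (Fin k) ℂ) :=
  LinearMap.mulLeft ℂ (MvPolynomial.X a) ∘ₗ
    (MvPolynomial.pderiv (R := ℂ) b : Derivation ℂ _ _).toLinearMap

theorem polyE_mem (k l : ℕ) (a b : Fin k) :
    ∀ p ∈ MvPolynomial.homogeneousSubmodule (Fin k) ℂ l,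
      polyE k a b p ∈ MvPolynomial.homogeneousSubmodule (Fin k) ℂ l := by
  intro p hp
  rw [MvPolynomial.mem_homogeneousSubmodule] at hp ⊢
  rcases Nat.eq_zero_or_pos l with rfl | hl
  · have h0 : MvPolynomial.pderiv b p = 0 := by
      rw [MvPolynomial.totalDegree_eq_zero_iff_eq_C.mp
        (((MvPolynomial.totalDegree_zero_iff_isHomogeneous (Fin k)).mpr hp)), MvPolynomial.pderiv_C]
    have h1 : polyE k a b p = 0 := by simp [polyE, h0]
    rw [h1]
    exact MvPolynomial.isHomogeneous_zero _ _ _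
  · have h1 := (MvPolynomial.isHomogeneous_X ℂ a).mul (hp.pderiv (i := b))
    rw [Nat.add_sub_cancel' hl] at h1
    exact h1

/-- `V_l`, the irreducible `gl_k`-module of highest weight `(l, 0, …, 0)`, that is, the `l`-th
symmetric power of `ℂ^k`, realized by the homogeneous polynomials of degree `l` in
`x_1, …, x_k`. -/
def V (k l : ℕ) : Type := ↥(MvPolynomial.homogeneousSubmodule (Fin k) ℂ l)

instance instAddCommGroupV (k l : ℕ) : AddCommGroup (V k l) :=
  inferInstanceAs (AddCommGroup ↥(MvPolynomial.homogeneousSubmodule (Fin k) ℂ l))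

instance instModuleV (k l : ℕ) : Module ℂ (V k l) :=
  inferInstanceAs (Module ℂ ↥(MvPolynomial.homogeneousSubmodule (Fin k) ℂ l))

instance instFiniteV (k l : ℕ) : Module.Finite ℂ (V k l) :=
  Module.Finite.of_fg (MvPolynomial.homogeneousSubmodule_fg (Fin k) ℂ l)

/-- The action of `e_{ab}` on `V_l`. -/
def e {k l : ℕ} (a b : Fin k) : Module.End ℂ (V k l) :=
  LinearMap.restrict (p := MvPolynomial.homogeneousSubmodule (Fin k) ℂ l)
    (q := MvPolynomial.homogeneousSubmodule (Fin k) ℂ l) (polyE k a b) (polyE_mem k l a b)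

/-- Highest weight vectors of `V_l` (nonzero, killed by `e_{ab}` for `a < b`, of weight
`(l, 0, …, 0)`). -/
def IsHighestWeightVector {k l : ℕ} (v : V k l) : Prop :=
  v ≠ 0 ∧ (∀ a b : Fin k, a < b → e a b v = 0) ∧
    ∀ a : Fin k, e a a v = (if a.val = 0 then (l : ℂ) else 0) • v

/-- The tensor product `V_{l_1} ⊗ … ⊗ V_{l_n}` of `gl_k`-modules. -/
abbrev T (k : ℕ) {n : ℕ} (l : Fin n → ℕ) : Type := ⨂[ℂ] i, V k (l i)

variable {k n : ℕ} {l : Fin n → ℕ}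

/-- `A^{(i)}`: the operator `A` acting on the `i`-th tensor factor, as a linear function
of `A`. -/
def slot (i : Fin n) : Module.End ℂ (V k (l i)) →ₗ[ℂ] Module.End ℂ (T k l) :=
  (PiTensorProduct.mapMultilinear ℂ (fun j => V k (l j)) (fun j => V k (l j))).toLinearMap
    (fun _ => LinearMap.id) i

/-- `A^{(ij)}` for `i ≠ j`: the operator `A` acting on the `i`-th and `j`-th tensor factors
(first leg in the `i`-th one); on `A = f ⊗ g` it is `f^{(i)} g^{(j)}`. -/
def twoSlot (i j : Fin n) (A : Module.End ℂ (V k (l i) ⊗[ℂ] V k (l j))) :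
    Module.End ℂ (T k l) :=
  TensorProduct.lift ((LinearMap.mul ℂ (Module.End ℂ (T k l))).compl₁₂ (slot i) (slot j))
    ((homTensorHomEquiv ℂ (V k (l i)) (V k (l j)) (V k (l i)) (V k (l j))).symm A)

/-- `(e_{ab})^{(i)}`. -/
def eAt (i : Fin n) (a b : Fin k) : Module.End ℂ (T k l) := slot i (e a b)

/-- The action of `e_{ab}` on the tensor product, `∑_i (e_{ab})^{(i)}`. -/
def eTot (a b : Fin k) : Module.End ℂ (T k l) := ∑ i, eAt i a b

/-- The weight subspace `(V_{l_1} ⊗ … ⊗ V_{l_n})[m_1, …, m_k]`. -/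
def weightSpace (k : ℕ) {n : ℕ} (l : Fin n → ℕ) (m : Fin k → ℕ) : Submodule ℂ (T k l) :=
  ⨅ a, LinearMap.ker (eTot a a - (m a : ℂ) • (1 : Module.End ℂ (T k l)))

/-- The nonnegative integer `k × n` matrices with column sums `l_i` and row sums `m_a`. -/
def indexSet (l : Fin n → ℕ) (m : Fin k → ℕ) : Set (Fin k → Fin n → ℕ) :=
  {d | (∀ i, ∑ a, d a i = l i) ∧ ∀ a, ∑ i, d a i = m a}

/-- `∏_{a ≥ 2} (e_{a1})^{[d_{a1}]} v_1 ⊗ … ⊗ ∏_{a ≥ 2} (e_{a1})^{[d_{an}]} v_n`, where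
`y^{[s]} = y^s / s!`. -/
def vVec [NeZero k] (v : ∀ i, V k (l i)) (d : Fin k → Fin n → ℕ) : T k l :=
  PiTensorProduct.tprod ℂ fun i =>
    (((List.finRange k).filter (fun a => a ≠ 0)).map fun a =>
      ((d a i).factorial : ℂ)⁻¹ • (e a 0 : Module.End ℂ (V k (l i))) ^ d a i).prod (v i)

/-! ### Functions of commuting diagonalizable operators -/

/-- `f(A)` for a family `A` of commuting, simultaneously diagonalizable operators: the operator
acting by `f(μ)` on the joint eigenvectors with eigenvalues `μ`. -/
def diagFun {ι W : Type*} [AddCommMonoid W] [Module ℂ W] (A : ι → Module.End ℂ W)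
    (f : (ι → ℂ) → ℂ) : Module.End ℂ W :=
  open Classical in
  if h : ∃! B : Module.End ℂ W, ∀ (μ : ι → ℂ) (w : W), (∀ j, A j w = μ j • w) → B w = f μ • w
  then h.choose else 0

/-- `c^{-e_{aa}}` on `V_l` (the eigenvalues of `e_{aa}` are integers). -/
def powNegE {l : ℕ} (a : Fin k) (c : ℂ) : Module.End ℂ (V k l) :=
  diagFun (fun _ : Unit => e a a) fun μ => c ^ (-μ ())

/-! ### Partial derivatives of vector-valued functions -/

/-- `f : ℂ → W` has derivative `w` at `t`, for `W` a (finite-dimensional) complex vector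
space. -/
def HasVecDerivAt {W : Type*} [AddCommMonoid W] [Module ℂ W] (f : ℂ → W) (w : W) (t : ℂ) : Prop :=
  ∀ ξ : Module.Dual ℂ W, HasDerivAt (fun s => ξ (f s)) (ξ w) t

/-- The derivative of `f : ℂ → W` at `t` (zero if it does not exist). -/
def vecDeriv {W : Type*} [AddCommMonoid W] [Module ℂ W] (f : ℂ → W) (t : ℂ) : W :=
  open Classical in if h : ∃ w, HasVecDerivAt f w t then h.choose else 0

/-- Complex differentiability of `u(z; λ)` at a point, for values in a (finite-dimensional)
complex vector space. -/
def VecDifferentiableAt {W : Type*} [AddCommMonoid W] [Module ℂ W]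
    (u : (Fin n → ℂ) → (Fin k → ℂ) → W) (z : Fin n → ℂ) (lam : Fin k → ℂ) : Prop :=
  ∀ ξ : Module.Dual ℂ W,
    DifferentiableAt ℂ (fun q : (Fin n → ℂ) × (Fin k → ℂ) => ξ (u q.1 q.2)) (z, lam)

/-! ### The differential operators

All operators act on functions `u(z_1, …, z_n; λ_1, …, λ_k)` with values in
`V_{l_1} ⊗ … ⊗ V_{l_n}`. -/

/-- Functions of `(z; λ)` with values in the tensor product of `gl_k`-modules. -/
abbrev Fn (k : ℕ) {n : ℕ} (l : Fin n → ℕ) : Type := (Fin n → ℂ) → (Fin k → ℂ) → T k l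

/-- `∂/∂z_i`. -/
def dz (i : Fin n) (u : Fn k l) : Fn k l := fun z lam =>
  vecDeriv (fun s => u (Function.update z i s) lam) (z i)

/-- `∂/∂λ_a`. -/
def dlam (a : Fin k) (u : Fn k l) : Fn k l := fun z lam =>
  vecDeriv (fun s => u z (Function.update lam a s)) (lam a)

/-- `Ω^{(ij)}`. -/
def Omega (i j : Fin n) : Module.End ℂ (T k l) := ∑ a, ∑ b, eAt i a b * eAt j b a

/-- `Ω_+^{(ij)}`. -/
def OmegaPlus (i j : Fin n) : Module.End ℂ (T k l) :=
  (1 / 2 : ℂ) • ∑ a, eAt i a a * eAt j a a + ∑ a, ∑ b with a < b, eAt i a b * eAt j b a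

/-- The trigonometric `r`-matrix `r^{(ij)}(x)`. -/
def rTrig (i j : Fin n) (x : ℂ) : Module.End ℂ (T k l) :=
  (1 / (x - 1)) • Omega i j + OmegaPlus i j

/-- The rational KZ operator `∇_{z_i}`. -/
def ratKZ (κ : ℂ) (i : Fin n) (u : Fn k l) : Fn k l := fun z lam =>
  κ • dz i u z lam - ∑ a, lam a • eAt i a a (u z lam)
    - ∑ j with j ≠ i, (1 / (z i - z j)) • Omega i j (u z lam)

/-- The trigonometric KZ operator `∇̂_{z_i}`. -/
def trigKZ (κ : ℂ) (i : Fin n) (u : Fn k l) : Fn k l := fun z lam =>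
  (κ * z i) • dz i u z lam
    - ∑ a, ((lam a • 1 - (1 / 2 : ℂ) • eTot a a) * eAt i a a : Module.End ℂ (T k l)) (u z lam)
    - ∑ j with j ≠ i, rTrig i j (z i / z j) (u z lam)

/-- The rational differential dynamical operator `D_{λ_a}`. -/
def ratDD (κ : ℂ) (a : Fin k) (u : Fn k l) : Fn k l := fun z lam =>
  κ • dlam a u z lam - ∑ i, z i • eAt i a a (u z lam)
    - ∑ b with b ≠ a, (1 / (lam a - lam b)) •
        (eTot a b * eTot b a - eTot a a : Module.End ℂ (T k l)) (u z lam)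

/-- The trigonometric differential dynamical operator `D̂_{λ_a}`. -/
def trigDD (κ : ℂ) (a : Fin k) (u : Fn k l) : Fn k l := fun z lam =>
  (κ * lam a) • dlam a u z lam + (1 / 2 : ℂ) • (eTot a a ^ 2) (u z lam)
    - ∑ i, z i • eAt i a a (u z lam)
    - ∑ b, ∑ i, ∑ j with i < j, (eAt i a b * eAt j b a : Module.End ℂ (T k l)) (u z lam)
    - ∑ b with b ≠ a,
        (lam b / (lam a - lam b)) •
          (eTot a b * eTot b a - eTot a a : Module.End ℂ (T k l)) (u z lam)

/-! ### The rational difference dynamical operators -/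

/-- The series `B_{ab}(t) = 1 + ∑_{s ≥ 1} e_{ba}^s e_{ab}^s ∏_{j=1}^s 1/(j(t - e_{aa} + e_{bb} - j))`
(a finite sum, since `e_{ab}` is nilpotent). -/
def Bop (a b : Fin k) (t : ℂ) : Module.End ℂ (T k l) :=
  1 + ∑ᶠ s : ℕ, eTot b a ^ (s + 1) * eTot a b ^ (s + 1) *
    ((List.range (s + 1)).map fun j => Ring.inverse
      (((j + 1 : ℕ) : ℂ) •
        ((t - ((j + 1 : ℕ) : ℂ)) • 1 - eTot a a + eTot b b : Module.End ℂ (T k l)))).prod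

/-- `X_a(z; λ) = (B_{ak}(λ_{ak}) ⋯ B_{a,a+1}(λ_{a,a+1}))⁻¹ ∏_i (z_i^{-e_{aa}})^{(i)}
B_{1a}(λ_{1a} - κ) ⋯ B_{a-1,a}(λ_{a-1,a} - κ)`. -/
def Xop (κ : ℂ) (a : Fin k) (z : Fin n → ℂ) (lam : Fin k → ℂ) : Module.End ℂ (T k l) :=
  Ring.inverse ((((List.finRange k).filter (fun b => a < b)).reverse.map fun b =>
      Bop a b (lam a - lam b)).prod)
    * ((List.finRange n).map fun i => slot i (powNegE a (z i))).prod
    * (((List.finRange k).filter (fun b => b < a)).map fun b =>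
        Bop b a (lam b - lam a - κ)).prod

/-- The qDD operator `Q_{λ_a} = X_a T_{λ_a}`, where `T_{λ_a}` shifts `λ_a` by `κ`. -/
def qDD (κ : ℂ) (a : Fin k) (u : Fn k l) : Fn k l := fun z lam =>
  Xop κ a z lam (u z (Function.update lam a (lam a + κ)))

/-- `C_{ab}(t) = Γ(t + 1) Γ(t - e_{aa} + e_{bb}) / (Γ(t - e_{aa}) Γ(t + e_{bb} + 1))`. -/
def Cop (a b : Fin k) (t : ℂ) : Module.End ℂ (T k l) :=
  diagFun (fun c : Fin k => eTot c c) fun μ =>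
    Complex.Gamma (t + 1) * Complex.Gamma (t - μ a + μ b) /
      (Complex.Gamma (t - μ a) * Complex.Gamma (t + μ b + 1))

/-- `N_a(λ) = ∏_{b < a} C_{ba}(λ_{ba} - κ) ∏_{a < b} C_{ab}(λ_{ab})⁻¹`. -/
def Nop (κ : ℂ) (a : Fin k) (lam : Fin k → ℂ) : Module.End ℂ (T k l) :=
  (((List.finRange k).filter (fun b => b < a)).map fun b => Cop b a (lam b - lam a - κ)).prod
    * (((List.finRange k).filter (fun b => a < b)).map fun b =>
        Ring.inverse (Cop a b (lam a - lam b))).prod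

/-- The normalized qDD operator `N_a(λ) Q_{λ_a}`. -/
def normQDD (κ : ℂ) (a : Fin k) (u : Fn k l) : Fn k l := fun z lam =>
  Nop κ a lam (qDD κ a u z lam)

/-! ### The rational quantized KZ operators -/

/-- The properties which determine the rational `R`-matrix `R_{V_p V_q}(t)` for `t ∉ ℤ`:
`gl_k`-invariance, the commutation relations coming from the Yangian, and the normalization on
highest weight vectors. -/
def IsRMatrix {k p q : ℕ} (t : ℂ) (R : Module.End ℂ (V k p ⊗[ℂ] V k q)) : Prop :=
  (∀ a b : Fin k,
    R * (TensorProduct.map (e a b) LinearMap.id + TensorProduct.map LinearMap.id (e a b)) =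
      (TensorProduct.map (e a b) LinearMap.id + TensorProduct.map LinearMap.id (e a b)) * R) ∧
  (∀ a b : Fin k,
    R * (t • TensorProduct.map (e a b) LinearMap.id + ∑ c, TensorProduct.map (e a c) (e c b)) =
      (t • TensorProduct.map (e a b) LinearMap.id + ∑ c, TensorProduct.map (e c b) (e a c)) * R) ∧
  ∀ (v : V k p) (w : V k q), IsHighestWeightVector v → IsHighestWeightVector w →
    R (v ⊗ₜ[ℂ] w) = v ⊗ₜ[ℂ] w

/-- The rational `R`-matrix `R_{V_p V_q}(t)`. -/
def rMatrix (k p q : ℕ) (t : ℂ) : Module.End ℂ (V k p ⊗[ℂ] V k q) :=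
  open Classical in
  if h : ∃! R : Module.End ℂ (V k p ⊗[ℂ] V k q), IsRMatrix t R then h.choose else 0

/-- `R_{ij}(t) = (R_{V_{l_i} V_{l_j}}(t))^{(ij)}`. -/
def Rop (i j : Fin n) (t : ℂ) : Module.End ℂ (T k l) :=
  twoSlot i j (rMatrix k (l i) (l j) t)

/-- `K_i(z; λ) = (R_{in}(z_{in}) ⋯ R_{i,i+1}(z_{i,i+1}))⁻¹ ∏_a (λ_a^{-e_{aa}})^{(i)}
R_{1i}(z_{1i} - κ) ⋯ R_{i-1,i}(z_{i-1,i} - κ)`. -/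
def Kop (κ : ℂ) (i : Fin n) (z : Fin n → ℂ) (lam : Fin k → ℂ) : Module.End ℂ (T k l) :=
  Ring.inverse ((((List.finRange n).filter (fun j => i < j)).reverse.map fun j =>
      Rop i j (z i - z j)).prod)
    * ((List.finRange k).map fun a => slot i (powNegE a (lam a))).prod
    * (((List.finRange n).filter (fun j => j < i)).map fun j =>
        Rop j i (z j - z i - κ)).prod

/-- The qKZ operator `Z_{z_i} = K_i T_{z_i}`, where `T_{z_i}` shifts `z_i` by `κ`. -/
def qKZ (κ : ℂ) (i : Fin n) (u : Fn k l) : Fn k l := fun z lam =>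
  Kop κ i z lam (u (Function.update z i (z i + κ)) lam)

/-! ### The duality isomorphism and conjugation by it -/

/-- `φ` sends `v_d^{(k)}` to `v_d^{(n)}` for all `d`; in particular these vectors lie in the
weight subspaces. -/
def SendsBasis [NeZero k] [NeZero n] {m : Fin k → ℕ} (v : ∀ i, V k (l i)) (v' : ∀ a, V n (m a))
    (φ : weightSpace k l m ≃ₗ[ℂ] weightSpace n m l) : Prop :=
  ∀ d ∈ indexSet l m, ∃ h : vVec v d ∈ weightSpace k l m,
    (φ ⟨vVec v d, h⟩ : T n m) = vVec v' fun i a => d a i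

/-- At the point `(z; λ)` and on the function `u` with values in the weight subspace,
`F(z; λ) = φ⁻¹ G(λ; z) φ`: the value of `F u` lies in the weight subspace, and so does that of
`G (φ u)`, and `φ` maps the former to the latter. -/
def ConjAt {m : Fin k → ℕ} (φ : weightSpace k l m ≃ₗ[ℂ] weightSpace n m l)
    (F : Fn k l → Fn k l) (G : Fn n m → Fn n m)
    (u : (Fin n → ℂ) → (Fin k → ℂ) → weightSpace k l m)
    (z : Fin n → ℂ) (lam : Fin k → ℂ) : Prop :=
  ∃ w : weightSpace k l m,
    F (fun z lam => (u z lam : T k l)) z lam = (w : T k l) ∧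
      G (fun lam z => (φ (u z lam) : T n m)) lam z = (φ w : T n m)

end GLDuality

end

open GLDuality

/-! The theorem is an instance of (gl_k, gl_n) duality on the polynomial ring in the variables
x_{ai}, a = 1, …, k, i = 1, …, n, where gl_k acts by ∑_i x_{ai} ∂_{bi} and gl_n by ∑_a x_{ai}
∂_{aj}. Giving the i-th gl_k-factor the variables of column i realizes the first tensor product as
the polynomials of degree l_i in column i; giving the a-th gl_n-factor the variables of row a
realizes the second as those of degree m_a in row a. The weight condition on one side is the degree
condition built into the other, so the two weight subspaces have the same image (`exists_isScalar`).
On both sides v_d becomes x^d ∏ 1/d_{ai}! times a constant independent of d (`vVec_eq`). Hence φ is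
a nonzero multiple of the identity of polynomials, and conjugation by φ reduces to the equality of
operators on common polynomials, expressed by `Rel`.

For the differential operators this equality is a reordering in the Weyl algebra: with E_{ij} = ∑_a
x_{ai} ∂_{aj}, the operator Ω^{(ij)} is E_{ij} E_{ji} - E_{ii} (`Rel.omega`).

For the difference operators the key fact is that R_{ij}(t) and C_{ij}(t) B_{ij}(t) agree on common
polynomials (`Rel.Rop_Bop` and `Rel.Cop`). The series B_{ij}(t) has the form ∑ c_s F^s E^s with E =
E_{ij}, F = E_{ji}. It commutes with the diagonal gl_k because E and F do, and a telescoping sum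
shows that it intertwines the two Yangian actions (`sum_pow_intertwines`, `Bpoly_Mop`). On x_{1i}^p
x_{1j}^q it acts by a scalar which the Chu–Vandermonde identity evaluates to the inverse of the
Gamma quotient in C (`Bpoly_topPoly`). This vector is cyclic for t ∉ ℤ (`eq_top_of_topVec_mem`), so
the defining properties determine R. Cyclicity also yields unitarity R_{ji}(-t) R_{ij}(t) = 1, hence
the invertibility of all factors; the scalars relating R and B are collected by N (`Rel.Kop`).

The remaining three identities are the same ones with rows and columns exchanged, applied to φ⁻¹. -/

open scoped TensorProduct

noncomputable section

namespace GLDuality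

open MvPolynomial

/-! ### The operators `X_s ∂_t` on polynomials -/

/-- The operator `X_s ∂_t`. -/
def xd {τ : Type*} (s t : τ) : Module.End ℂ (MvPolynomial τ ℂ) :=
  LinearMap.mulLeft ℂ (X s) ∘ₗ (pderiv (R := ℂ) t : Derivation ℂ _ _).toLinearMap

theorem xd_apply {τ : Type*} (s t : τ) (f : MvPolynomial τ ℂ) : xd s t f = X s * pderiv t f := rfl

theorem xd_mul {τ : Type*} (s t : τ) (f g : MvPolynomial τ ℂ) :
    xd s t (f * g) = xd s t f * g + f * xd s t g := by
  simp only [xd_apply, pderiv_mul]; ring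

theorem xd_monomial {τ : Type*} (s t : τ) (d : τ →₀ ℕ) (c : ℂ) :
    xd s t (monomial d c) =
      monomial (d - Finsupp.single t 1 + Finsupp.single s 1) (c * d t) := by
  rw [xd_apply, pderiv_monomial, X, monomial_mul, one_mul, add_comm]

/-- Euler operators are diagonal on monomials. Read off coefficientwise, this turns every weight or
degree condition below into a condition on exponents. -/
theorem coeff_xd_self {τ : Type*} (s : τ) (f : MvPolynomial τ ℂ) (d : τ →₀ ℕ) :
    coeff d (xd s s f) = d s * coeff d f := by
  classical
  rw [xd_apply, coeff_X_mul']
  split_ifs with h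
  · rw [coeff_pderiv]
    have h1 : 1 ≤ d s := Nat.one_le_iff_ne_zero.mpr (Finsupp.mem_support_iff.mp h)
    have h2 : d - Finsupp.single s 1 + Finsupp.single s 1 = d := by
      ext t
      by_cases hts : t = s
      · subst hts; simp [h1]
      · simp [Ne.symm hts]
    rw [h2]
    simp only [Finsupp.coe_tsub, Pi.sub_apply, Finsupp.single_eq_same]
    rw [Nat.cast_sub h1]
    push_cast
    ring
  · rw [Finsupp.notMem_support_iff.mp h]; simp

theorem pderiv_comm {τ : Type*} (s t : τ) (f : MvPolynomial τ ℂ) :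
    pderiv s (pderiv t f) = pderiv t (pderiv s f) := by
  classical
  -- A commutator of derivations is a derivation, so it suffices to test it on the variables.
  have h : ⁅pderiv (R := ℂ) s, pderiv (R := ℂ) t⁆ = 0 := by
    apply MvPolynomial.derivation_ext
    intro i
    simp only [Derivation.commutator_apply, pderiv_X, Derivation.coe_zero, Pi.zero_apply]
    by_cases h1 : i = s <;> by_cases h2 : i = t <;> simp [h1, h2, Pi.single_apply] <;> aesop
  have := congrArg (fun D => D f) h
  simp only [Derivation.commutator_apply, Derivation.coe_zero, Pi.zero_apply] at this
  exact sub_eq_zero.mp this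

theorem xd_mul_xd {τ : Type*} [DecidableEq τ] (s t u v : τ) :
    xd s t * xd u v = xd u v * xd s t + (if t = u then xd s v else 0)
      - (if v = s then xd u t else 0) := by
  ext1 d
  refine LinearMap.ext fun c => ?_
  simp only [LinearMap.comp_apply, Module.End.mul_apply, LinearMap.add_apply, LinearMap.sub_apply]
  generalize monomial d c = f
  rw [xd_apply s t, xd_apply u v, xd_apply u v, xd_apply s t, pderiv_mul, pderiv_mul, pderiv_comm,
    pderiv_X, pderiv_X]
  by_cases h1 : t = u <;> by_cases h2 : v = s
  · subst h1; subst h2; simp [xd_apply]; ring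
  · subst h1; simp [xd_apply, h2, Ne.symm h2]; ring
  · subst h2; simp [xd_apply, h1, Ne.symm h1]; ring
  · simp [h1, h2, Ne.symm h1, Ne.symm h2]; ring

/-- Sending the monomial x^{ν x} back to `b x`, and the monomials outside the range of ν to zero,
gives a left inverse. -/
theorem injective_of_basis_monomial {ι τ W : Type*} [AddCommGroup W] [Module ℂ W]
    (b : Module.Basis ι ℂ W) (L : W →ₗ[ℂ] MvPolynomial τ ℂ) (ν : ι → τ →₀ ℕ)
    (hν : Function.Injective ν) (h : ∀ x, L (b x) = monomial (ν x) 1) : Function.Injective L := by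
  have h1 : (basisMonomials τ ℂ).constr ℂ (Function.extend ν b 0) ∘ₗ L = LinearMap.id := by
    apply b.ext
    intro x
    have h2 : L (b x) = basisMonomials τ ℂ (ν x) := by rw [h, coe_basisMonomials]
    rw [LinearMap.comp_apply, h2, Module.Basis.constr_basis, hν.extend_apply, LinearMap.id_apply]
  intro x y hxy
  have hx := LinearMap.congr_fun h1 x
  rw [LinearMap.comp_apply, hxy] at hx
  exact hx.symm.trans (LinearMap.congr_fun h1 y)

/-! ### The monomial basis of `V_l` -/

namespace V

/-- An element of `V_l` as a polynomial. -/
def toPoly {k l : ℕ} : V k l →ₗ[ℂ] MvPolynomial (Fin k) ℂ :=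
  (homogeneousSubmodule (Fin k) ℂ l).subtype

theorem toPoly_injective {k l : ℕ} : Function.Injective (toPoly (k := k) (l := l)) :=
  Subtype.val_injective

theorem toPoly_isHomogeneous {k l : ℕ} (v : V k l) : (toPoly v).IsHomogeneous l := v.2

theorem toPoly_e {k l : ℕ} (a b : Fin k) (v : V k l) : toPoly (e a b v) = xd a b (toPoly v) := rfl

/-- The monomial `x^α` in `V_l`. -/
def mon {k l : ℕ} (α : {α : Fin k →₀ ℕ // α.degree = l}) : V k l :=
  ⟨monomial α.1 1, isHomogeneous_monomial 1 α.2⟩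

theorem toPoly_mon {k l : ℕ} (α : {α : Fin k →₀ ℕ // α.degree = l}) :
    toPoly (mon α) = monomial α.1 1 := rfl

theorem linearIndependent_mon {k l : ℕ} : LinearIndependent ℂ (mon (k := k) (l := l)) := by
  apply LinearIndependent.of_comp toPoly
  have h : toPoly ∘ mon (k := k) (l := l) = basisMonomials (Fin k) ℂ ∘ Subtype.val := by
    funext α
    exact (congrFun (coe_basisMonomials (Fin k) ℂ) α.1).symm
  rw [h]
  exact (basisMonomials (Fin k) ℂ).linearIndependent.comp _ Subtype.val_injective

theorem span_mon {k l : ℕ} : ⊤ ≤ Submodule.span ℂ (Set.range (mon (k := k) (l := l))) := by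
  intro v _
  have h1 : ∀ α : (toPoly v).support, α.1.degree = l := fun α =>
    ((toPoly_isHomogeneous v).degree_eq_sum_deg_support α.2).symm
  have h2 : v = ∑ α : (toPoly v).support, coeff α.1 (toPoly v) • mon ⟨α.1, h1 α⟩ := by
    apply toPoly_injective
    conv_lhs => rw [← support_sum_monomial_coeff (toPoly v)]
    rw [← Finset.sum_coe_sort, map_sum]
    refine Finset.sum_congr rfl fun α _ => ?_
    rw [map_smul, toPoly_mon, smul_monomial, smul_eq_mul, mul_one]
  rw [h2]
  exact Submodule.sum_mem _ fun α _ => Submodule.smul_mem _ _ (Submodule.subset_span ⟨_, rfl⟩)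

/-- The monomial basis of `V_l`. -/
def basis (k l : ℕ) : Module.Basis {α : Fin k →₀ ℕ // α.degree = l} ℂ (V k l) :=
  Module.Basis.mk linearIndependent_mon span_mon

theorem basis_apply {k l : ℕ} (α : {α : Fin k →₀ ℕ // α.degree = l}) : basis k l α = mon α :=
  Module.Basis.mk_apply _ _ _

theorem e_self_mon {k l : ℕ} (a : Fin k) (α : {α : Fin k →₀ ℕ // α.degree = l}) :
    e a a (mon α) = (α.1 a : ℂ) • mon α := by
  apply toPoly_injective
  ext d
  rw [toPoly_e, coeff_xd_self, map_smul, toPoly_mon, coeff_smul, coeff_monomial]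
  split_ifs with h <;> simp [h]

end V

/-! ### Realization of the tensor products by polynomials -/

section Emb

variable {τ : Type*} {k n : ℕ} {l : Fin n → ℕ}

/-- The map `V_l → ℂ[τ]` renaming the variables by `s`. -/
def embV {l : ℕ} (s : Fin k → τ) : V k l →ₗ[ℂ] MvPolynomial τ ℂ :=
  (rename s).toLinearMap ∘ₗ V.toPoly

theorem embV_apply {l : ℕ} (s : Fin k → τ) (v : V k l) : embV s v = rename s (V.toPoly v) := rfl

theorem embV_mon {l : ℕ} (s : Fin k → τ) (α : {α : Fin k →₀ ℕ // α.degree = l}) :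
    embV s (V.mon α) = monomial (α.1.mapDomain s) 1 := by
  rw [embV_apply, V.toPoly_mon, rename_monomial]

theorem embV_e {l : ℕ} {s : Fin k → τ} (hs : Function.Injective s) (a b : Fin k) (v : V k l) :
    embV s (e a b v) = xd (s a) (s b) (embV s v) := by
  rw [embV_apply, embV_apply, V.toPoly_e, xd_apply, xd_apply, map_mul, rename_X, pderiv_rename hs]

theorem pderiv_embV_eq_zero {l : ℕ} {s : Fin k → τ} {t : τ} (ht : ∀ a, s a ≠ t) (v : V k l) :
    pderiv t (embV s v) = 0 := by
  apply pderiv_eq_zero_of_notMem_vars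
  intro h
  classical
  obtain ⟨a, -, ha⟩ := Finset.mem_image.mp (vars_rename s _ h)
  exact ht a ha

/-- The realization of `V_{l_1} ⊗ … ⊗ V_{l_n}` by polynomials, the variable `x_a` of the `i`-th
factor becoming `σ i a`. -/
def emb (l : Fin n → ℕ) (σ : Fin n → Fin k → τ) : T k l →ₗ[ℂ] MvPolynomial τ ℂ :=
  PiTensorProduct.lift ((MultilinearMap.mkPiAlgebra ℂ (Fin n) (MvPolynomial τ ℂ)).compLinearMap
    fun i => embV (σ i))

theorem emb_tprod (σ : Fin n → Fin k → τ) (w : ∀ i, V k (l i)) :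
    emb l σ (PiTensorProduct.tprod ℂ w) = ∏ i, embV (σ i) (w i) := by
  simp [emb, PiTensorProduct.lift.tprod]

theorem slot_tprod (i : Fin n) (A : Module.End ℂ (V k (l i))) (w : ∀ i, V k (l i)) :
    slot i A (PiTensorProduct.tprod ℂ w) =
      PiTensorProduct.tprod ℂ (Function.update w i (A (w i))) := by
  rw [slot, MultilinearMap.toLinearMap_apply, PiTensorProduct.mapMultilinear_apply,
    PiTensorProduct.map_tprod]
  congr 1
  funext j
  by_cases h : j = i
  · subst h; simp
  · simp [h]

theorem emb_tprod_update (σ : Fin n → Fin k → τ) (w : ∀ i, V k (l i)) (i : Fin n)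
    (x : V k (l i)) :
    emb l σ (PiTensorProduct.tprod ℂ (Function.update w i x)) =
      embV (σ i) x * ∏ j ∈ Finset.univ.erase i, embV (σ j) (w j) := by
  rw [emb_tprod, ← Finset.mul_prod_erase _ _ (Finset.mem_univ i), Function.update_self]
  congr 1
  refine Finset.prod_congr rfl fun j hj => ?_
  rw [Function.update_of_ne (Finset.ne_of_mem_erase hj)]

theorem pderiv_prod_eq_zero {ι : Type*} {t : τ} (s : Finset ι) (f : ι → MvPolynomial τ ℂ)
    (h : ∀ i ∈ s, pderiv t (f i) = 0) : pderiv t (∏ i ∈ s, f i) = 0 := by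
  classical
  induction s using Finset.induction_on with
  | empty => simp
  | insert i s hi ih =>
    rw [Finset.prod_insert hi, pderiv_mul, h i (Finset.mem_insert_self _ _),
      ih fun j hj => h j (Finset.mem_insert_of_mem hj)]
    simp

theorem T.ext_tprod {M : Type*} [AddCommMonoid M] [Module ℂ M] {A B : T k l →ₗ[ℂ] M}
    (h : ∀ w, A (PiTensorProduct.tprod ℂ w) = B (PiTensorProduct.tprod ℂ w)) : A = B :=
  PiTensorProduct.ext (MultilinearMap.ext h)

theorem emb_eAt {σ : Fin n → Fin k → τ} (hσ : Function.Injective2 σ) (i : Fin n) (a b : Fin k)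
    (w : T k l) : emb l σ (eAt i a b w) = xd (σ i a) (σ i b) (emb l σ w) := by
  suffices h : emb l σ ∘ₗ eAt i a b = xd (σ i a) (σ i b) ∘ₗ emb l σ from LinearMap.congr_fun h w
  apply T.ext_tprod
  intro w
  rw [LinearMap.comp_apply, LinearMap.comp_apply, eAt, slot_tprod, emb_tprod_update,
    embV_e (hσ.right i), ← Function.update_eq_self i w, emb_tprod_update, Function.update_self,
    xd_mul, xd_apply _ _ (∏ j ∈ _, _), pderiv_prod_eq_zero, mul_zero, mul_zero, add_zero,
    Function.update_eq_self]
  intro j hj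
  exact pderiv_embV_eq_zero (fun c h => Finset.ne_of_mem_erase hj (hσ h).1) _

theorem emb_eTot {σ : Fin n → Fin k → τ} (hσ : Function.Injective2 σ) (a b : Fin k)
    (w : T k l) : emb l σ (eTot a b w) = (∑ i, xd (σ i a) (σ i b)) (emb l σ w) := by
  simp only [eTot, LinearMap.sum_apply, map_sum, emb_eAt hσ]

/-- The index set of the monomial basis of `V_{l_1} ⊗ … ⊗ V_{l_n}`. -/
abbrev Idx (k : ℕ) {n : ℕ} (l : Fin n → ℕ) : Type := ∀ i, {α : Fin k →₀ ℕ // α.degree = l i}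

/-- The monomial basis of `V_{l_1} ⊗ … ⊗ V_{l_n}`. -/
def basisT (k : ℕ) {n : ℕ} (l : Fin n → ℕ) : Module.Basis (Idx k l) ℂ (T k l) :=
  Basis.piTensorProduct fun i => V.basis k (l i)

theorem basisT_apply (α : Idx k l) :
    basisT k l α = PiTensorProduct.tprod ℂ fun i => V.mon (α i) := by
  rw [basisT, Basis.piTensorProduct_apply]
  simp only [V.basis_apply]

/-- The exponent of the image of a basis tensor. -/
def expo (σ : Fin n → Fin k → τ) (α : Idx k l) : τ →₀ ℕ := ∑ i, (α i).1.mapDomain (σ i)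

theorem emb_basisT (σ : Fin n → Fin k → τ) (α : Idx k l) :
    emb l σ (basisT k l α) = monomial (expo σ α) 1 := by
  rw [basisT_apply, emb_tprod, expo]
  simp only [embV_mon]
  rw [← monomial_sum_one]

theorem expo_apply {σ : Fin n → Fin k → τ} (hσ : Function.Injective2 σ) (α : Idx k l) (i : Fin n)
    (a : Fin k) : expo σ α (σ i a) = (α i).1 a := by
  rw [expo, Finsupp.finsetSum_apply, Finset.sum_eq_single i]
  · exact Finsupp.mapDomain_apply (hσ.right i) _ _
  · intro j _ hj
    apply Finsupp.mapDomain_of_notMem_range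
    rintro ⟨b, hb⟩
    exact hj (hσ hb).1
  · simp

theorem expo_injective {σ : Fin n → Fin k → τ} (hσ : Function.Injective2 σ) :
    Function.Injective (expo (l := l) σ) := by
  intro α β h
  funext i
  ext a
  rw [← expo_apply hσ, ← expo_apply hσ, h]

theorem emb_injective {σ : Fin n → Fin k → τ} (hσ : Function.Injective2 σ) :
    Function.Injective (emb l σ) :=
  injective_of_basis_monomial (basisT k l) _ (expo σ) (expo_injective hσ) (emb_basisT σ)

theorem emb_rename {υ : Type*} (ρ : τ → υ) (σ : Fin n → Fin k → τ) (w : T k l) :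
    rename ρ (emb l σ w) = emb l (fun i a => ρ (σ i a)) w := by
  suffices h : (rename ρ).toLinearMap ∘ₗ emb l σ = emb l (fun i a => ρ (σ i a)) from
    LinearMap.congr_fun h w
  apply T.ext_tprod
  intro w
  rw [LinearMap.comp_apply, emb_tprod, emb_tprod, AlgHom.toLinearMap_apply, map_prod]
  refine Finset.prod_congr rfl fun i _ => ?_
  rw [embV_apply, embV_apply, rename_rename]
  rfl

/-- The sum is the Euler operator of the variables of one factor. In the other realization the same
operator is the Cartan element of the dual Lie algebra, which is how degrees and weights trade
places. -/
theorem sum_xd_emb {σ : Fin n → Fin k → τ} (hσ : Function.Injective2 σ) (i : Fin n) (w : T k l) :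
    (∑ a, xd (σ i a) (σ i a)) (emb l σ w) = (l i : ℂ) • emb l σ w := by
  suffices h : (∑ a, xd (σ i a) (σ i a)) ∘ₗ emb l σ = (l i : ℂ) • emb l σ from
    LinearMap.congr_fun h w
  classical
  apply (basisT k l).ext
  intro α
  rw [LinearMap.comp_apply, LinearMap.smul_apply, emb_basisT]
  ext d
  rw [LinearMap.sum_apply, coeff_sum, coeff_smul, smul_eq_mul]
  simp only [coeff_xd_self]
  rw [← Finset.sum_mul, coeff_monomial]
  split_ifs with h
  · rw [← h]
    simp only [expo_apply hσ]
    have h2 : (l i : ℂ) = ∑ a, ((α i).1 a : ℂ) := by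
      exact_mod_cast (α i).2.symm.trans (Finsupp.degree_eq_sum _)
    rw [h2]
  · simp

/-- The Euler eigenvalues force every monomial in the support of `f` to have degree `l i` in the
i-th group of variables. When the groups exhaust all variables, such a monomial is the image of a
basis tensor. -/
theorem mem_range_emb {σ : Fin n → Fin k → τ} (hσ : Function.Injective2 σ)
    (hs : ∀ t, ∃ i a, σ i a = t) {f : MvPolynomial τ ℂ}
    (hf : ∀ i, (∑ a, xd (σ i a) (σ i a)) f = (l i : ℂ) • f) : ∃ w : T k l, emb l σ w = f := by
  suffices h : f ∈ LinearMap.range (emb l σ) from h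
  rw [← support_sum_monomial_coeff f]
  refine Submodule.sum_mem _ fun d hd => ?_
  have hd1 : ∀ i, ∑ a, d (σ i a) = l i := by
    intro i
    have h := congrArg (coeff d) (hf i)
    rw [LinearMap.sum_apply, coeff_sum, coeff_smul, smul_eq_mul] at h
    simp only [coeff_xd_self] at h
    rw [← Finset.sum_mul] at h
    have := mul_right_cancel₀ (mem_support_iff.mp hd) h
    exact_mod_cast this
  let α : Idx k l := fun i => ⟨d.comapDomain (σ i) (hσ.right i).injOn, by
    rw [Finsupp.degree_eq_sum]
    simpa using hd1 i⟩
  have h1 : expo σ α = d := by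
    ext t
    obtain ⟨i, a, rfl⟩ := hs t
    rw [expo_apply hσ]
    rfl
  have h2 : monomial d (coeff d f) = coeff d f • emb l σ (basisT k l α) := by
    rw [emb_basisT, h1, smul_monomial, smul_eq_mul, mul_one]
  rw [h2]
  exact Submodule.smul_mem _ _ ⟨_, rfl⟩

theorem mem_weightSpace {m : Fin k → ℕ} {w : T k l} :
    w ∈ weightSpace k l m ↔ ∀ a, eTot a a w = (m a : ℂ) • w := by
  simp [weightSpace, Submodule.mem_iInf, sub_eq_zero]

end Emb

/-! ### Pairs of operators which agree on polynomials -/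

section Rel

variable {k n : ℕ} {l : Fin n → ℕ} {m : Fin k → ℕ}

/-- The variables of the `i`-th factor of a tensor product of `gl_k`-modules. -/
def colVar (i : Fin n) (a : Fin k) : Fin k × Fin n := (a, i)

/-- The variables of the `a`-th factor of a tensor product of `gl_n`-modules. -/
def rowVar (a : Fin k) (i : Fin n) : Fin k × Fin n := (a, i)

theorem colVar_injective2 : Function.Injective2 (colVar : Fin n → Fin k → Fin k × Fin n) :=
  fun _ _ _ _ h => ⟨(Prod.ext_iff.mp h).2, (Prod.ext_iff.mp h).1⟩

theorem rowVar_injective2 : Function.Injective2 (rowVar : Fin k → Fin n → Fin k × Fin n) :=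
  fun _ _ _ _ h => Prod.ext_iff.mp h

/-- The operators `A` and `A'` agree on the polynomials which belong to both tensor products. -/
def Rel (A : Module.End ℂ (T k l)) (A' : Module.End ℂ (T n m)) : Prop :=
  ∀ (w : T k l) (w' : T n m), emb l colVar w = emb m rowVar w' →
    emb l colVar (A w) = emb m rowVar (A' w')

theorem emb_col_eAt (i : Fin n) (a b : Fin k) (w : T k l) :
    emb l colVar (eAt i a b w) = xd (a, i) (b, i) (emb l colVar w) :=
  emb_eAt colVar_injective2 i a b w

theorem emb_row_eAt (a : Fin k) (i j : Fin n) (w : T n m) :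
    emb m rowVar (eAt a i j w) = xd (a, i) (a, j) (emb m rowVar w) :=
  emb_eAt rowVar_injective2 a i j w

theorem emb_col_eTot (a b : Fin k) (w : T k l) :
    emb l colVar (eTot a b w) = (∑ i : Fin n, xd (a, i) (b, i)) (emb l colVar w) :=
  emb_eTot colVar_injective2 a b w

theorem emb_row_eTot (i j : Fin n) (w : T n m) :
    emb m rowVar (eTot i j w) = (∑ a : Fin k, xd (a, i) (a, j)) (emb m rowVar w) :=
  emb_eTot rowVar_injective2 i j w

/-- The total `e_aa` of gl_k is the Euler operator of row a, and a polynomial coming from the gl_n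
side has degree `m a` in that row. -/
theorem mem_weightSpace_of_emb_eq {w : T k l} {w' : T n m}
    (h : emb l colVar w = emb m rowVar w') : w ∈ weightSpace k l m := by
  rw [mem_weightSpace]
  intro a
  apply emb_injective (l := l) colVar_injective2
  rw [emb_col_eTot, map_smul, h]
  exact sum_xd_emb rowVar_injective2 a w'

theorem mem_weightSpace_of_emb_eq' {w : T k l} {w' : T n m}
    (h : emb l colVar w = emb m rowVar w') : w' ∈ weightSpace n m l := by
  rw [mem_weightSpace]
  intro i
  apply emb_injective (l := m) rowVar_injective2
  rw [emb_row_eTot, map_smul, ← h]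
  exact sum_xd_emb colVar_injective2 i w

theorem exists_emb_eq_of_mem_weightSpace {w : T k l} (hw : w ∈ weightSpace k l m) :
    ∃ w' : T n m, emb m rowVar w' = emb l colVar w := by
  apply mem_range_emb rowVar_injective2 (fun t => ⟨t.1, t.2, rfl⟩)
  intro a
  rw [← map_smul, ← mem_weightSpace.mp hw a]
  exact (emb_col_eTot a a w).symm

theorem exists_emb_eq_of_mem_weightSpace' {w' : T n m} (hw : w' ∈ weightSpace n m l) :
    ∃ w : T k l, emb l colVar w = emb m rowVar w' := by
  apply mem_range_emb colVar_injective2 (fun t => ⟨t.2, t.1, rfl⟩)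
  intro i
  rw [← map_smul, ← mem_weightSpace.mp hw i]
  exact (emb_row_eTot i i w').symm

theorem emb_col_swap (w : T k l) :
    rename Prod.swap (emb l colVar w) = emb l (rowVar : Fin n → Fin k → _) w :=
  emb_rename Prod.swap colVar w

theorem emb_row_swap (w' : T n m) :
    rename Prod.swap (emb m rowVar w') = emb m (colVar : Fin k → Fin n → _) w' :=
  emb_rename Prod.swap rowVar w'

namespace Rel

variable {A B : Module.End ℂ (T k l)} {A' B' : Module.End ℂ (T n m)}

theorem symm (h : Rel A A') : Rel A' A := by
  intro w' w hw
  rw [← emb_col_swap, ← emb_row_swap] at hw ⊢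
  have hinj := rename_injective (R := ℂ) (Prod.swap : Fin k × Fin n → _) Prod.swap_injective
  exact congrArg _ (h w w' (hinj hw).symm).symm

theorem one : Rel (1 : Module.End ℂ (T k l)) (1 : Module.End ℂ (T n m)) := fun _ _ h => h

theorem mul (hA : Rel A A') (hB : Rel B B') : Rel (A * B) (A' * B') :=
  fun w w' h => hA _ _ (hB w w' h)

theorem add (hA : Rel A A') (hB : Rel B B') : Rel (A + B) (A' + B') := by
  intro w w' h
  rw [LinearMap.add_apply, LinearMap.add_apply, map_add, map_add, hA w w' h, hB w w' h]

theorem smul (c : ℂ) (hA : Rel A A') : Rel (c • A) (c • A') := by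
  intro w w' h
  rw [LinearMap.smul_apply, LinearMap.smul_apply, map_smul, map_smul, hA w w' h]

theorem sum {ι : Type*} (s : Finset ι) {A : ι → Module.End ℂ (T k l)}
    {A' : ι → Module.End ℂ (T n m)} (h : ∀ i ∈ s, Rel (A i) (A' i)) :
    Rel (∑ i ∈ s, A i) (∑ i ∈ s, A' i) := by
  intro w w' hw
  rw [LinearMap.sum_apply, LinearMap.sum_apply, map_sum, map_sum]
  exact Finset.sum_congr rfl fun i hi => h i hi w w' hw

theorem list_prod {ι : Type*} (L : List ι) {A : ι → Module.End ℂ (T k l)}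
    {A' : ι → Module.End ℂ (T n m)} (h : ∀ i ∈ L, Rel (A i) (A' i)) :
    Rel (L.map A).prod (L.map A').prod := by
  induction L with
  | nil => exact one
  | cons i L ih =>
    rw [List.map_cons, List.map_cons, List.prod_cons, List.prod_cons]
    exact (h i List.mem_cons_self).mul (ih fun j hj => h j (List.mem_cons_of_mem _ hj))

theorem of_op {O O' : Module.End ℂ (MvPolynomial (Fin k × Fin n) ℂ)}
    (hA : ∀ w, emb l colVar (A w) = O (emb l colVar w))
    (hA' : ∀ w', emb m rowVar (A' w') = O' (emb m rowVar w')) (hO : O = O') : Rel A A' := by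
  intro w w' h
  rw [hA, hA', h, hO]

/-- The pairs with a common polynomial form a finite-dimensional space stable under A × A'. An
injective endomorphism of it is onto, so the inverse pair preserves it too. -/
theorem inverse (h : Rel A A') (hA : IsUnit A) (hA' : IsUnit A') :
    Rel (Ring.inverse A) (Ring.inverse A') := by
  let U : Submodule ℂ (T k l × T n m) :=
    LinearMap.ker ((emb l colVar).coprod (-(emb m rowVar)))
  have hU : ∀ x : T k l × T n m, x ∈ U ↔ emb l colVar x.1 = emb m rowVar x.2 := by
    intro x
    simp only [U, LinearMap.mem_ker, LinearMap.coprod_apply, LinearMap.neg_apply]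
    rw [← sub_eq_add_neg, sub_eq_zero]
  have hmaps : ∀ x ∈ U, LinearMap.prodMap A A' x ∈ U := by
    intro x hx
    rw [hU] at hx ⊢
    exact h _ _ hx
  have hAi : ∀ x, Ring.inverse A (A x) = x := fun x => by
    rw [← Module.End.mul_apply, Ring.inverse_mul_cancel _ hA, Module.End.one_apply]
  have hAi' : ∀ x, Ring.inverse A' (A' x) = x := fun x => by
    rw [← Module.End.mul_apply, Ring.inverse_mul_cancel _ hA', Module.End.one_apply]
  have hinj : Function.Injective ((LinearMap.prodMap A A').restrict hmaps) := by
    intro x y hxy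
    have h1 := congrArg (fun z : U => (z : T k l × T n m)) hxy
    simp only [LinearMap.coe_restrict_apply, LinearMap.prodMap_apply, Prod.mk.injEq] at h1
    apply Subtype.ext
    apply Prod.ext
    · rw [← hAi x.1.1, h1.1, hAi]
    · rw [← hAi' x.1.2, h1.2, hAi']
  have hsurj := LinearMap.injective_iff_surjective.mp hinj
  intro w w' hw
  obtain ⟨y, hy⟩ := hsurj ⟨(w, w'), (hU _).mpr hw⟩
  have h1 := congrArg (fun z : U => (z : T k l × T n m)) hy
  simp only [LinearMap.coe_restrict_apply, LinearMap.prodMap_apply, Prod.mk.injEq] at h1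
  rw [← h1.1, ← h1.2, hAi, hAi']
  exact (hU _).mp y.2

end Rel

end Rel

/-! ### The differential operators -/

section Diff

variable {k n : ℕ} {l : Fin n → ℕ} {m : Fin k → ℕ}

/-- Neither derivative meets the inner variable, so both sides are x_s x_u ∂_t ∂_v. -/
theorem xd_exchange {τ : Type*} {s t u v : τ} (htu : t ≠ u) (hvu : v ≠ u) :
    xd s t * xd u v = xd s v * xd u t := by
  refine LinearMap.ext fun f => ?_
  simp only [Module.End.mul_apply, xd_apply, pderiv_mul, pderiv_X_of_ne htu.symm,
    pderiv_X_of_ne hvu.symm, pderiv_comm t v]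
  ring

theorem xd_self_commute {τ : Type*} (s t : τ) : xd s s * xd t t = xd t t * xd s s := by
  classical
  rw [xd_mul_xd]
  by_cases h : s = t
  · subst h; simp
  · simp [h, Ne.symm h]

theorem Rel.eAt_self (i : Fin n) (a : Fin k) :
    Rel (eAt i a a : Module.End ℂ (T k l)) (eAt a i i : Module.End ℂ (T n m)) :=
  Rel.of_op (emb_col_eAt i a a) (emb_row_eAt a i i) rfl

/-- For a ≠ b the factors of E_{ij} E_{ji} can be reordered freely. For a = b the derivative ∂_{aj}
meets x_{aj}, which leaves the extra term x_{ai} ∂_{ai}. -/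
theorem sum_xd_mul_sum_xd {i j : Fin n} (hij : i ≠ j) :
    (∑ a : Fin k, xd (a, i) (a, j)) * (∑ a : Fin k, xd (a, j) (a, i)) =
      ∑ a : Fin k, ∑ b : Fin k, xd (a, i) (b, i) * xd (b, j) (a, j)
        + ∑ a : Fin k, xd (a, i) (a, i) := by
  rw [Finset.sum_mul_sum, ← Finset.sum_add_distrib]
  refine Finset.sum_congr rfl fun a _ => ?_
  have h1 : ∀ b : Fin k, xd (a, i) (a, j) * xd (b, j) (b, i) =
      xd (a, i) (b, i) * xd (b, j) (a, j) + if a = b then xd (a, i) (a, i) else 0 := by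
    intro b
    by_cases hab : a = b
    · subst hab
      rw [xd_mul_xd, xd_mul_xd (a, i) (a, i)]
      simp [hij, hij.symm]
      refine LinearMap.ext fun f => ?_
      simp only [Module.End.mul_apply, LinearMap.add_apply, LinearMap.sub_apply, xd_apply,
        pderiv_mul, pderiv_X_self]
      rw [pderiv_comm (a, i) (a, j),
        pderiv_X_of_ne (show ((a, i) : Fin k × Fin n) ≠ (a, j) by simp [hij])]
      ring
    · rw [if_neg hab, add_zero, xd_exchange]
      · simp [hab]
      · simp [hij]
  rw [Finset.sum_congr rfl fun b _ => h1 b, Finset.sum_add_distrib]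
  simp

theorem Rel.omega {i j : Fin n} (hij : j ≠ i) :
    Rel (Omega i j : Module.End ℂ (T k l))
      (eTot i j * eTot j i - eTot i i : Module.End ℂ (T n m)) := by
  refine Rel.of_op (O := ∑ a : Fin k, ∑ b : Fin k, xd (a, i) (b, i) * xd (b, j) (a, j))
    (O' := (∑ a : Fin k, xd (a, i) (a, j)) * (∑ a : Fin k, xd (a, j) (a, i))
      - ∑ a : Fin k, xd (a, i) (a, i)) ?_ ?_ ?_
  · intro w
    simp only [Omega, LinearMap.sum_apply, map_sum, Module.End.mul_apply, emb_col_eAt]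
  · intro w
    simp only [LinearMap.sub_apply, Module.End.mul_apply, map_sub, emb_row_eTot]
  · rw [sum_xd_mul_sum_xd hij.symm, add_sub_cancel_right]

/-- The algebraic part of `∇_{z_i}`. -/
theorem Rel.rat (i : Fin n) (z : Fin n → ℂ) (lam : Fin k → ℂ) :
    Rel (∑ a, lam a • eAt i a a + ∑ j with j ≠ i, (1 / (z i - z j)) • Omega i j :
        Module.End ℂ (T k l))
      (∑ a, lam a • eAt a i i +
        ∑ j with j ≠ i, (1 / (z i - z j)) • (eTot i j * eTot j i - eTot i i) :
        Module.End ℂ (T n m)) :=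
  (Rel.sum _ fun a _ => (Rel.eAt_self i a).smul _).add
    (Rel.sum _ fun _ hj => (Rel.omega (Finset.mem_filter.mp hj).2).smul _)

theorem sum_mul_sum_self_eq {R : Type*} [Ring R] [Module ℂ R] (f : Fin k → R)
    (hf : ∀ a b, f a * f b = f b * f a) :
    (1 / 2 : ℂ) • ((∑ a, f a) * ∑ a, f a) =
      (1 / 2 : ℂ) • ∑ a, f a * f a + ∑ a, ∑ b with a < b, f a * f b := by
  have h1 : (∑ a, f a) * ∑ a, f a = ∑ a, f a * f a + (2 : ℂ) • ∑ a, ∑ b with a < b, f a * f b := by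
    have h2 : ∀ a, ∑ b, f a * f b =
        f a * f a + ∑ b with a < b, f a * f b + ∑ b with b < a, f b * f a := by
      intro a
      have h3 : (∑ b with b < a, f b * f a) = ∑ b with b < a, f a * f b :=
        Finset.sum_congr rfl fun b _ => hf b a
      rw [h3, Finset.sum_filter, Finset.sum_filter, ← Fintype.sum_ite_eq a (fun b => f a * f b),
        ← Finset.sum_add_distrib, ← Finset.sum_add_distrib]
      refine Finset.sum_congr rfl fun b _ => ?_
      rcases lt_trichotomy a b with h | h | h
      · simp [h, h.ne, h.not_gt]
      · simp [h]
      · simp [h, h.ne', h.not_gt]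
    have h4 : ∑ a, ∑ b with b < a, f b * f a = ∑ a, ∑ b with a < b, f a * f b := by
      simp only [Finset.sum_filter]
      rw [Finset.sum_comm]
    rw [Finset.sum_mul_sum, Finset.sum_congr rfl fun a _ => h2 a, Finset.sum_add_distrib,
      Finset.sum_add_distrib, h4, add_assoc, two_smul]
  rw [h1, smul_add, smul_smul]
  norm_num

theorem sum_smul_sub_mul_eq {R : Type*} [Ring R] [Algebra ℂ R] (c : ℂ) (lam : Fin k → ℂ)
    (f : Fin k → Fin n → R) (i : Fin n) (hf : ∀ a j, f a j * f a i = f a i * f a j) :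
    ∑ a, (lam a • 1 - c • ∑ j, f a j) * f a i =
      ∑ a, lam a • f a i - c • ∑ a, f a i * f a i
        - ∑ j with j ≠ i, c • ∑ a, f a i * f a j := by
  have h : ∀ a, (lam a • 1 - c • ∑ j, f a j) * f a i =
      lam a • f a i - c • (f a i * f a i) - ∑ j with j ≠ i, c • (f a i * f a j) := by
    intro a
    rw [Finset.filter_ne' Finset.univ i, ← Finset.smul_sum, sub_sub, ← smul_add,
      Finset.add_sum_erase _ (fun j => f a i * f a j) (Finset.mem_univ i), sub_mul, smul_mul_assoc,
      one_mul, smul_mul_assoc, Finset.sum_mul, Finset.sum_congr rfl fun j _ => hf a j]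
  rw [Finset.sum_congr rfl fun a _ => h a, Finset.sum_sub_distrib, Finset.sum_sub_distrib,
    Finset.sum_comm]
  simp only [Finset.smul_sum]

/-- The algebraic part of `∇̂_{z_i}`. -/
theorem Rel.trig (i : Fin n) (z : Fin n → ℂ) (hz : ∀ j, j ≠ i → z j ≠ z i ∧ z j ≠ 0)
    (lam : Fin k → ℂ) :
    Rel (∑ a, (lam a • 1 - (1 / 2 : ℂ) • eTot a a) * eAt i a a
          + ∑ j with j ≠ i, rTrig i j (z i / z j) : Module.End ℂ (T k l))
      (-((1 / 2 : ℂ) • eTot i i ^ 2) + ∑ a, lam a • eAt a i i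
        + ∑ j, ∑ a, ∑ b with a < b, eAt a i j * eAt b j i
        + ∑ j with j ≠ i, (z j / (z i - z j)) • (eTot i j * eTot j i - eTot i i) :
        Module.End ℂ (T n m)) := by
  have hsplit : ∀ G : Fin n → Module.End ℂ (MvPolynomial (Fin k × Fin n) ℂ),
      ∑ j, G j = G i + ∑ j with j ≠ i, G j := by
    intro G
    rw [Finset.filter_ne' Finset.univ i, Finset.add_sum_erase _ _ (Finset.mem_univ i)]
  have hr : (∑ j with j ≠ i, rTrig i j (z i / z j) : Module.End ℂ (T k l)) =
      ∑ j with j ≠ i, OmegaPlus i j + ∑ j with j ≠ i, (z j / (z i - z j)) • Omega i j := by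
    rw [← Finset.sum_add_distrib]
    refine Finset.sum_congr rfl fun j hj => ?_
    obtain ⟨h1, h2⟩ := hz j (Finset.mem_filter.mp hj).2
    have h3 : z i - z j ≠ 0 := sub_ne_zero.mpr h1.symm
    -- The pole part of the r-matrix thus has the same coefficient as the dynamical term; only the
    -- Ω_+ part then needs matching.
    have h4 : 1 / (z i / z j - 1) = z j / (z i - z j) := by
      rw [show z i / z j - 1 = (z i - z j) / z j by field_simp]
      rw [one_div_div]
    rw [rTrig, h4, add_comm]
  rw [hr, ← add_assoc]
  refine Rel.add ?_
    (Rel.sum _ fun _ hj => (Rel.omega (Finset.mem_filter.mp hj).2).smul _)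
  refine Rel.of_op
    (O := ∑ a : Fin k, (lam a • 1 - (1 / 2 : ℂ) • ∑ j : Fin n, xd (a, j) (a, j)) * xd (a, i) (a, i)
      + ∑ j : Fin n with j ≠ i, ((1 / 2 : ℂ) • ∑ a : Fin k, xd (a, i) (a, i) * xd (a, j) (a, j)
        + ∑ a : Fin k, ∑ b : Fin k with a < b, xd (a, i) (b, i) * xd (b, j) (a, j)))
    (O' := -((1 / 2 : ℂ) • (∑ a : Fin k, xd (a, i) (a, i)) ^ 2)
      + ∑ a : Fin k, lam a • xd (a, i) (a, i)
      + ∑ j : Fin n, ∑ a : Fin k, ∑ b : Fin k with a < b, xd (a, i) (a, j) * xd (b, j) (b, i))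
    ?_ ?_ ?_
  · intro w
    simp only [OmegaPlus, LinearMap.add_apply, LinearMap.sub_apply, LinearMap.smul_apply,
      LinearMap.sum_apply, map_add, map_sub, map_smul, map_sum, Module.End.mul_apply, emb_col_eAt,
      emb_col_eTot, Module.End.one_apply]
  · intro w
    simp only [LinearMap.add_apply, LinearMap.neg_apply, LinearMap.smul_apply,
      LinearMap.sum_apply, map_add, map_neg, map_smul, map_sum, Module.End.mul_apply, emb_row_eAt,
      emb_row_eTot, pow_two]
  · have h1 : ∑ j : Fin n with j ≠ i,
        ∑ a : Fin k, ∑ b : Fin k with a < b, xd (a, i) (b, i) * xd (b, j) (a, j) =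
        ∑ j : Fin n with j ≠ i,
        ∑ a : Fin k, ∑ b : Fin k with a < b, xd (a, i) (a, j) * xd (b, j) (b, i) := by
      refine Finset.sum_congr rfl fun j hj => Finset.sum_congr rfl fun a _ =>
        Finset.sum_congr rfl fun b hb => ?_
      have hj' := (Finset.mem_filter.mp hj).2
      have hb' := (Finset.mem_filter.mp hb).2
      rw [xd_exchange]
      · simp [hj'.symm]
      · simp [hb'.ne]
    have h2 : ∑ a : Fin k, (lam a • 1 - (1 / 2 : ℂ) • ∑ j : Fin n, xd (a, j) (a, j)) *
        xd (a, i) (a, i) = ∑ a : Fin k, lam a • xd (a, i) (a, i)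
          - (1 / 2 : ℂ) • ∑ a : Fin k, xd (a, i) (a, i) * xd (a, i) (a, i)
          - ∑ j : Fin n with j ≠ i, (1 / 2 : ℂ) • ∑ a : Fin k, xd (a, i) (a, i) * xd (a, j) (a, j) := by
      exact sum_smul_sub_mul_eq _ _ (fun a j => xd (a, j) (a, j)) i fun a j => xd_self_commute _ _
    -- On the gl_n side the mixed terms of the square of E_{ii} cancel the j = i summand; on the
    -- gl_k side the Cartan part of Ω_+ cancels the terms j ≠ i of the total `e_aa`. Both sides keep
    -- -1/2 ∑_a (x_{ai} ∂_{ai})^2.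
    rw [hsplit fun j => ∑ a : Fin k, ∑ b : Fin k with a < b, xd (a, i) (a, j) * xd (b, j) (b, i),
      pow_two, sum_mul_sum_self_eq _ fun a b => xd_self_commute _ _, h2, Finset.sum_add_distrib, h1]
    abel

end Diff

/-! ### Derivatives of vector-valued functions -/

section Deriv

variable {W W' : Type*} [AddCommGroup W] [Module ℂ W] [AddCommGroup W'] [Module ℂ W']

theorem HasVecDerivAt.map {f : ℂ → W} {w : W} {t : ℂ} (h : HasVecDerivAt f w t) (L : W →ₗ[ℂ] W') :
    HasVecDerivAt (fun s => L (f s)) (L w) t := fun ξ => h (ξ ∘ₗ L)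

theorem HasVecDerivAt.unique {f : ℂ → W} {w w' : W} {t : ℂ} (h : HasVecDerivAt f w t)
    (h' : HasVecDerivAt f w' t) : w = w' := by
  rw [← sub_eq_zero, ← Module.forall_dual_apply_eq_zero_iff ℂ]
  intro ξ
  rw [map_sub, (h ξ).unique (h' ξ), sub_self]

theorem HasVecDerivAt.vecDeriv_eq {f : ℂ → W} {w : W} {t : ℂ} (h : HasVecDerivAt f w t) :
    vecDeriv f t = w := by
  have hex : ∃ w, HasVecDerivAt f w t := ⟨w, h⟩
  rw [vecDeriv, dif_pos hex]
  exact hex.choose_spec.unique h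

/-- In finite dimension the vector derivative is assembled from the derivatives of the coordinates.
-/
theorem exists_hasVecDerivAt [Module.Finite ℂ W] {f : ℂ → W} {t : ℂ}
    (h : ∀ ξ : Module.Dual ℂ W, DifferentiableAt ℂ (fun s => ξ (f s)) t) :
    ∃ w, HasVecDerivAt f w t := by
  let b := Module.finBasis ℂ W
  refine ⟨∑ i, deriv (fun s => b.coord i (f s)) t • b i, fun ξ => ?_⟩
  have h1 : (fun s => ξ (f s)) = fun s => ∑ i, b.coord i (f s) * ξ (b i) := by
    funext s
    conv_lhs => rw [← b.sum_repr (f s), map_sum]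
    simp only [map_smul, smul_eq_mul, Module.Basis.coord_apply]
  rw [h1, map_sum]
  apply HasDerivAt.fun_sum
  intro i _
  rw [map_smul, smul_eq_mul]
  exact (h (b.coord i)).hasDerivAt.mul_const _

end Deriv

/-! ### Conjugation by isomorphisms of the weight subspaces -/

section Conj

variable {k n : ℕ} {l : Fin n → ℕ} {m : Fin k → ℕ}

/-- Up to a nonzero factor, `φ` is the identity map of polynomials. -/
def IsScalar (φ : weightSpace k l m ≃ₗ[ℂ] weightSpace n m l) : Prop :=
  ∃ c : ℂ, c ≠ 0 ∧ ∀ w, emb m rowVar (φ w : T n m) = c • emb l colVar (w : T k l)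

/-- Reversing φ exchanges the roles of rows and columns, so the realizations must be transposed by
swapping the indices of the variables. With this every statement about φ has a dual for φ⁻¹. -/
theorem IsScalar.symm {φ : weightSpace k l m ≃ₗ[ℂ] weightSpace n m l} (h : IsScalar φ) :
    IsScalar φ.symm := by
  obtain ⟨c, hc, h⟩ := h
  refine ⟨c⁻¹, inv_ne_zero hc, fun w => ?_⟩
  have h1 := congrArg (rename Prod.swap) (h (φ.symm w))
  rw [LinearEquiv.apply_symm_apply, map_smul, emb_row_swap, emb_col_swap] at h1
  rw [h1, smul_smul, inv_mul_cancel₀ hc, one_smul]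

theorem Rel.exists_apply {φ : weightSpace k l m ≃ₗ[ℂ] weightSpace n m l} (hφ : IsScalar φ)
    {A : Module.End ℂ (T k l)} {A' : Module.End ℂ (T n m)} (h : Rel A A') (w : weightSpace k l m) :
    ∃ w₁ : weightSpace k l m, A w = (w₁ : T k l) ∧ A' (φ w : T n m) = (φ w₁ : T n m) := by
  obtain ⟨c, hc, hφ⟩ := hφ
  have h1 : emb l colVar (c • (w : T k l)) = emb m rowVar (φ w : T n m) := by rw [hφ, map_smul]
  have h2 := h _ _ h1
  have h3 := mem_weightSpace_of_emb_eq h2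
  rw [map_smul, Submodule.smul_mem_iff _ hc] at h3
  refine ⟨⟨A w, h3⟩, rfl, ?_⟩
  apply emb_injective (l := m) rowVar_injective2
  rw [hφ, ← h2, map_smul, map_smul]

/-- This reduces an identity with the dynamical operator on the gl_k side to the corresponding KZ
identity for the exchanged pair. -/
theorem ConjAt.of_symm {φ : weightSpace k l m ≃ₗ[ℂ] weightSpace n m l}
    {F : Fn k l → Fn k l} {G : Fn n m → Fn n m}
    {u : (Fin n → ℂ) → (Fin k → ℂ) → weightSpace k l m} {z : Fin n → ℂ} {lam : Fin k → ℂ}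
    (h : ConjAt φ.symm G F (fun lam z => φ (u z lam)) lam z) : ConjAt φ F G u z lam := by
  obtain ⟨w, h1, h2⟩ := h
  refine ⟨φ.symm w, ?_, ?_⟩
  · simpa only [LinearEquiv.symm_apply_apply] using h2
  · rw [LinearEquiv.apply_symm_apply]
    exact h1

theorem VecDifferentiableAt.swap {φ : weightSpace k l m ≃ₗ[ℂ] weightSpace n m l}
    {u : (Fin n → ℂ) → (Fin k → ℂ) → weightSpace k l m} {z : Fin n → ℂ} {lam : Fin k → ℂ}
    (h : VecDifferentiableAt u z lam) :
    VecDifferentiableAt (fun lam z => φ (u z lam)) lam z := by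
  intro ξ
  have h1 : DifferentiableAt ℂ (fun q : (Fin n → ℂ) × (Fin k → ℂ) =>
      (ξ ∘ₗ φ.toLinearMap) (u q.1 q.2)) (Prod.swap (lam, z)) := h (ξ ∘ₗ φ.toLinearMap)
  exact h1.comp (lam, z)
    (differentiable_snd.prodMk differentiable_fst).differentiableAt

/-- The derivative is formed inside the weight subspace and φ is a constant linear map, so a single
vector `w` serves both sides. -/
theorem exists_dz {φ : weightSpace k l m ≃ₗ[ℂ] weightSpace n m l}
    {u : (Fin n → ℂ) → (Fin k → ℂ) → weightSpace k l m} {z : Fin n → ℂ} {lam : Fin k → ℂ}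
    (h : VecDifferentiableAt u z lam) (i : Fin n) :
    ∃ w : weightSpace k l m, dz i (fun z lam => (u z lam : T k l)) z lam = (w : T k l) ∧
      dlam i (fun lam z => (φ (u z lam) : T n m)) lam z = (φ w : T n m) := by
  obtain ⟨w, hw⟩ := exists_hasVecDerivAt (f := fun s => u (Function.update z i s) lam)
    (t := z i) (fun ξ => by
      have h1 : DifferentiableAt ℂ (fun q : (Fin n → ℂ) × (Fin k → ℂ) => ξ (u q.1 q.2))
          (Function.update z i (z i), lam) := by
        rw [Function.update_eq_self]; exact h ξ
      have h2 : DifferentiableAt ℂ (fun s : ℂ => (Function.update z i s, lam)) (z i) :=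
        (hasDerivAt_update z i (z i)).differentiableAt.prodMk (differentiableAt_const _)
      exact DifferentiableAt.comp (g := fun q : (Fin n → ℂ) × (Fin k → ℂ) => ξ (u q.1 q.2))
        (z i) h1 h2)
  exact ⟨w, (hw.map (weightSpace k l m).subtype).vecDeriv_eq,
    (hw.map ((weightSpace n m l).subtype ∘ₗ φ.toLinearMap)).vecDeriv_eq⟩

theorem conjAt_ratKZ {φ : weightSpace k l m ≃ₗ[ℂ] weightSpace n m l} (hφ : IsScalar φ) (κ : ℂ)
    {u : (Fin n → ℂ) → (Fin k → ℂ) → weightSpace k l m} {z : Fin n → ℂ} {lam : Fin k → ℂ}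
    (h : VecDifferentiableAt u z lam) (i : Fin n) :
    ConjAt φ (ratKZ κ i) (ratDD κ i) u z lam := by
  obtain ⟨w, hw, hw'⟩ := exists_dz (φ := φ) h i
  obtain ⟨w₁, hw₁, hw₁'⟩ := (Rel.rat i z lam).exists_apply hφ (u z lam)
  refine ⟨κ • w - w₁, ?_, ?_⟩
  · rw [ratKZ, hw, Submodule.coe_sub, ← hw₁, Submodule.coe_smul]
    simp only [LinearMap.add_apply, LinearMap.sum_apply, LinearMap.smul_apply]
    abel
  · rw [ratDD, hw', map_sub, map_smul, Submodule.coe_sub, ← hw₁', Submodule.coe_smul]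
    simp only [LinearMap.add_apply, LinearMap.sum_apply, LinearMap.smul_apply]
    abel

theorem conjAt_trigKZ {φ : weightSpace k l m ≃ₗ[ℂ] weightSpace n m l} (hφ : IsScalar φ) (κ : ℂ)
    {u : (Fin n → ℂ) → (Fin k → ℂ) → weightSpace k l m} {z : Fin n → ℂ} {lam : Fin k → ℂ}
    (h : VecDifferentiableAt u z lam) (i : Fin n) (hz : ∀ j, j ≠ i → z j ≠ z i ∧ z j ≠ 0) :
    ConjAt φ (trigKZ κ i) (trigDD κ i) u z lam := by
  obtain ⟨w, hw, hw'⟩ := exists_dz (φ := φ) h i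
  obtain ⟨w₁, hw₁, hw₁'⟩ := (Rel.trig i z hz lam).exists_apply hφ (u z lam)
  refine ⟨(κ * z i) • w - w₁, ?_, ?_⟩
  · rw [trigKZ, hw, Submodule.coe_sub, ← hw₁, Submodule.coe_smul]
    simp only [LinearMap.add_apply, LinearMap.sum_apply]
    abel
  · rw [trigDD, hw', map_sub, map_smul, Submodule.coe_sub, ← hw₁', Submodule.coe_smul]
    simp only [LinearMap.add_apply, LinearMap.sum_apply, LinearMap.smul_apply,
      LinearMap.neg_apply]
    abel

/-- A product of operators at a point, combined with a shift of the arguments. -/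
theorem conjAt_of_rel {φ : weightSpace k l m ≃ₗ[ℂ] weightSpace n m l} (hφ : IsScalar φ)
    {F : Fn k l → Fn k l} {G : Fn n m → Fn n m}
    {u : (Fin n → ℂ) → (Fin k → ℂ) → weightSpace k l m} {z z' : Fin n → ℂ} {lam lam' : Fin k → ℂ}
    {A : Module.End ℂ (T k l)} {A' : Module.End ℂ (T n m)} (h : Rel A A')
    (hF : F (fun z lam => (u z lam : T k l)) z lam = A (u z' lam' : T k l))
    (hG : G (fun lam z => (φ (u z lam) : T n m)) lam z = A' (φ (u z' lam') : T n m)) :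
    ConjAt φ F G u z lam := by
  obtain ⟨w, hw, hw'⟩ := h.exists_apply hφ (u z' lam')
  exact ⟨w, hF.trans hw, hG.trans hw'⟩

end Conj

/-! ### Cyclicity of `V_p ⊗ V_q` over the Yangian -/

section Cyclic

variable {k : ℕ}

/-- The monomial `x^α` as an element of `V_l`, zero if its degree is not `l`. -/
def V.mono (l : ℕ) (α : Fin k →₀ ℕ) : V k l :=
  if h : α.degree = l then V.mon ⟨α, h⟩ else 0

theorem V.mono_of_degree {l : ℕ} (α : {α : Fin k →₀ ℕ // α.degree = l}) :
    V.mono l α.1 = V.mon α := dif_pos α.2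

theorem V.mono_of_ne {l : ℕ} {α : Fin k →₀ ℕ} (h : α.degree ≠ l) : V.mono l α = 0 := dif_neg h

theorem V.toPoly_mono {l : ℕ} {α : Fin k →₀ ℕ} (h : α.degree = l) :
    V.toPoly (V.mono l α) = monomial α 1 := by
  rw [V.mono, dif_pos h]; rfl

theorem degree_sub_add {α : Fin k →₀ ℕ} {a b : Fin k} (h : α b ≠ 0) :
    (α - Finsupp.single b 1 + Finsupp.single a 1).degree = α.degree := by
  have h1 : α - Finsupp.single b 1 + Finsupp.single b 1 = α := by
    apply tsub_add_cancel_of_le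
    rw [Finsupp.single_le_iff]
    omega
  conv_rhs => rw [← h1]
  rw [map_add, map_add, Finsupp.degree_single, Finsupp.degree_single]

/-- No hypothesis is needed: truncated subtraction matters only when the coefficient `α b` vanishes,
and otherwise the degree is unchanged, so the zero convention of `V.mono` is consistent. -/
theorem e_mono {l : ℕ} (a b : Fin k) (α : Fin k →₀ ℕ) :
    e a b (V.mono l α) =
      (α b : ℂ) • V.mono l (α - Finsupp.single b 1 + Finsupp.single a 1) := by
  by_cases hb : α b = 0
  · rw [hb, Nat.cast_zero, zero_smul]
    by_cases h : α.degree = l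
    · apply V.toPoly_injective
      rw [V.toPoly_e, V.toPoly_mono h, xd_monomial, hb]
      simp
    · rw [V.mono_of_ne h, map_zero]
  · by_cases h : α.degree = l
    · apply V.toPoly_injective
      rw [V.toPoly_e, V.toPoly_mono h, xd_monomial, map_smul,
        V.toPoly_mono ((degree_sub_add hb).trans h), smul_monomial, smul_eq_mul, one_mul, mul_one]
    · rw [V.mono_of_ne h, V.mono_of_ne (by rwa [degree_sub_add hb]), map_zero, smul_zero]

/-- The tensor product of the highest weight vectors `x_1^p` and `x_1^q`. -/
def topVec (k p q : ℕ) [NeZero k] : V k p ⊗[ℂ] V k q :=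
  V.mono p (Finsupp.single 0 p) ⊗ₜ V.mono q (Finsupp.single 0 q)

/-- The action of `e_{ab}` on `V_p ⊗ V_q`. -/
def diagE {p q : ℕ} (a b : Fin k) : Module.End ℂ (V k p ⊗[ℂ] V k q) :=
  TensorProduct.map (e a b) LinearMap.id + TensorProduct.map LinearMap.id (e a b)

/-- The action `t e_{ab} ⊗ 1 + ∑_c e_{ac} ⊗ e_{cb}` of a generator of the Yangian. -/
def yangM {p q : ℕ} (t : ℂ) (a b : Fin k) : Module.End ℂ (V k p ⊗[ℂ] V k q) :=
  t • TensorProduct.map (e a b) LinearMap.id + ∑ c, TensorProduct.map (e a c) (e c b)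

/-- The degree of a monomial in the variables other than the first one. -/
def tailDeg [NeZero k] (α : Fin k →₀ ℕ) : ℕ := ∑ c ∈ Finset.univ.erase 0, α c

theorem tailDeg_add [NeZero k] (α β : Fin k →₀ ℕ) :
    tailDeg (α + β) = tailDeg α + tailDeg β := by
  simp [tailDeg, Finset.sum_add_distrib]

theorem tailDeg_single_zero [NeZero k] (r : ℕ) : tailDeg (Finsupp.single (0 : Fin k) r) = 0 := by
  refine Finset.sum_eq_zero fun c hc => ?_
  rw [Finsupp.single_eq_of_ne (Finset.ne_of_mem_erase hc)]

theorem tailDeg_single [NeZero k] {a : Fin k} (ha : a ≠ 0) (r : ℕ) :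
    tailDeg (Finsupp.single a r) = r := by
  rw [tailDeg, Finset.sum_eq_single a]
  · simp
  · intro c _ hc
    rw [Finsupp.single_eq_of_ne hc]
  · simp [ha]

theorem tailDeg_raise [NeZero k] {a : Fin k} (ha : a ≠ 0) {α : Fin k →₀ ℕ} (h : α a ≠ 0) :
    tailDeg (α - Finsupp.single a 1 + Finsupp.single 0 1) + 1 = tailDeg α := by
  have h1 : α - Finsupp.single a 1 + Finsupp.single a 1 = α := by
    apply tsub_add_cancel_of_le
    rw [Finsupp.single_le_iff]
    omega
  conv_rhs => rw [← h1]
  rw [tailDeg_add, tailDeg_add, tailDeg_single_zero, tailDeg_single ha]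

theorem tailDeg_lower [NeZero k] {a : Fin k} (ha : a ≠ 0) {α : Fin k →₀ ℕ} (h : α 0 ≠ 0) :
    tailDeg (α - Finsupp.single 0 1 + Finsupp.single a 1) = tailDeg α + 1 := by
  have h1 : α - Finsupp.single 0 1 + Finsupp.single 0 1 = α := by
    apply tsub_add_cancel_of_le
    rw [Finsupp.single_le_iff]
    omega
  conv_rhs => rw [← h1]
  rw [tailDeg_add, tailDeg_add, tailDeg_single_zero, tailDeg_single ha]

theorem eq_single_of_tailDeg_eq_zero [NeZero k] {α : Fin k →₀ ℕ} (h : tailDeg α = 0) :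
    α = Finsupp.single 0 (α 0) := by
  ext c
  by_cases hc : c = 0
  · subst hc; simp
  · rw [Finsupp.single_eq_of_ne hc]
    exact Finset.sum_eq_zero_iff.mp h c (Finset.mem_erase.mpr ⟨hc, Finset.mem_univ _⟩)

theorem exists_ne_zero_of_tailDeg_ne_zero [NeZero k] {α : Fin k →₀ ℕ} (h : tailDeg α ≠ 0) :
    ∃ a, a ≠ 0 ∧ α a ≠ 0 := by
  obtain ⟨a, ha, h1⟩ := Finset.exists_ne_zero_of_sum_ne_zero h
  exact ⟨a, Finset.ne_of_mem_erase ha, h1⟩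

variable {p q : ℕ}

theorem diagE_mono (a b : Fin k) (α β : Fin k →₀ ℕ) :
    diagE a b (V.mono p α ⊗ₜ[ℂ] V.mono q β) =
      (α b : ℂ) • (V.mono p (α - Finsupp.single b 1 + Finsupp.single a 1) ⊗ₜ[ℂ] V.mono q β)
      + (β b : ℂ) •
        (V.mono p α ⊗ₜ[ℂ] V.mono q (β - Finsupp.single b 1 + Finsupp.single a 1)) := by
  rw [diagE, LinearMap.add_apply, TensorProduct.map_tmul, TensorProduct.map_tmul, e_mono, e_mono,
    LinearMap.id_apply, LinearMap.id_apply, TensorProduct.smul_tmul', TensorProduct.tmul_smul]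

theorem yangM_mono (t : ℂ) (a b : Fin k) (α β : Fin k →₀ ℕ) :
    yangM t a b (V.mono p α ⊗ₜ[ℂ] V.mono q β) =
      (t * α b) • (V.mono p (α - Finsupp.single b 1 + Finsupp.single a 1) ⊗ₜ[ℂ] V.mono q β)
      + ∑ c, ((α c : ℂ) * β b) •
        (V.mono p (α - Finsupp.single c 1 + Finsupp.single a 1) ⊗ₜ[ℂ]
          V.mono q (β - Finsupp.single b 1 + Finsupp.single c 1)) := by
  rw [yangM, LinearMap.add_apply, LinearMap.smul_apply, TensorProduct.map_tmul, e_mono,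
    LinearMap.id_apply, LinearMap.sum_apply, ← TensorProduct.smul_tmul', smul_smul]
  congr 1
  refine Finset.sum_congr rfl fun c _ => ?_
  rw [TensorProduct.map_tmul, e_mono, e_mono, TensorProduct.tmul_smul,
    ← TensorProduct.smul_tmul', smul_smul, mul_comm]

section

variable [NeZero k] {t : ℂ} (ht : ∀ N : ℤ, t ≠ N) {S : Submodule ℂ (V k p ⊗[ℂ] V k q)}
  (hE : ∀ (a b : Fin k), ∀ x ∈ S, diagE a b x ∈ S) (hM : ∀ (a b : Fin k), ∀ x ∈ S, yangM t a b x ∈ S)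
include ht hE hM

/-- Moving one variable of α from a to 0 gives a vector known to lie in `S`. The Yangian generator
(a, 0) returns a multiple of the wanted vector plus terms that the diagonal action of gl_k removes;
the surviving coefficient can vanish only for an integer t. -/
theorem mono_tmul_mem_of_tailDeg_eq_zero {r : ℕ}
    (ih : ∀ α β : Fin k →₀ ℕ, tailDeg α + tailDeg β = r → V.mono p α ⊗ₜ[ℂ] V.mono q β ∈ S)
    (α β : Fin k →₀ ℕ) (hα : tailDeg α = r + 1) (hβ : tailDeg β = 0) :
    V.mono p α ⊗ₜ[ℂ] V.mono q β ∈ S := by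
  obtain ⟨a, ha, haα⟩ := exists_ne_zero_of_tailDeg_ne_zero (α := α) (by omega)
  set α' := α - Finsupp.single a 1 + Finsupp.single 0 1 with hα'
  have hα'r : tailDeg α' = r := by
    have h : tailDeg α' + 1 = tailDeg α := tailDeg_raise ha haα
    omega
  have hα'0 : α' 0 = α 0 + 1 := by simp [hα', ha]
  have hback : α' - Finsupp.single 0 1 + Finsupp.single a 1 = α := by
    ext b
    by_cases h1 : b = 0
    · subst h1; simp [hα', ha]
    · by_cases h2 : b = a
      · subst h2; simp [hα']; omega
      · simp [hα', h2]
  set v := V.mono p α ⊗ₜ[ℂ] V.mono q β with hv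
  let y : Fin k → V k p ⊗[ℂ] V k q := fun c =>
    V.mono p (α' - Finsupp.single c 1 + Finsupp.single a 1) ⊗ₜ[ℂ]
      V.mono q (β - Finsupp.single 0 1 + Finsupp.single c 1)
  -- This is `α' c` times the diagonal generator (c, 0) applied to a vector with one variable c of α
  -- replaced by the variable 0; it trades `y c` for `v` modulo `S`.
  have hy : ∀ c ∈ Finset.univ.erase (0 : Fin k),
      ((α' c : ℂ) * β 0) • y c + ((α' c : ℂ) * (α 0 + 1)) • v ∈ S := by
    intro c hc
    have hc0 := Finset.ne_of_mem_erase hc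
    by_cases hαc : α' c = 0
    · simp [hαc]
    · have hαc' : α c ≠ 0 := by
        intro h
        apply hαc
        simp [hα', hc0, h]
      have h1 : α' - Finsupp.single c 1 + Finsupp.single a 1 =
          α - Finsupp.single c 1 + Finsupp.single 0 1 := by
        ext b
        have h2 : α' b = α b - Finsupp.single a 1 b + Finsupp.single 0 1 b := by simp [hα']
        simp only [Finsupp.add_apply, Finsupp.tsub_apply, h2, Finsupp.single_apply]
        simp only [hα', Finsupp.add_apply, Finsupp.tsub_apply, Finsupp.single_apply] at hαc
        split_ifs at hαc ⊢ <;> subst_vars <;> omega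
      have h3 := hE c 0 _ (ih (α - Finsupp.single c 1 + Finsupp.single 0 1) β (by
        have := tailDeg_raise hc0 hαc'; omega))
      rw [diagE_mono] at h3
      have h4 : α - Finsupp.single c 1 + Finsupp.single 0 1 - Finsupp.single 0 1 +
          Finsupp.single c 1 = α := by
        ext b
        simp only [Finsupp.add_apply, Finsupp.tsub_apply, Finsupp.single_apply]
        split_ifs <;> subst_vars <;> omega
      have h5 : (α - Finsupp.single c 1 + Finsupp.single 0 1 : Fin k →₀ ℕ) 0 = α 0 + 1 := by
        simp [hc0]
      rw [h4, h5, ← h1] at h3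
      have h6 := S.smul_mem (α' c : ℂ) h3
      rw [smul_add, smul_smul, smul_smul, add_comm] at h6
      push_cast at h6
      exact h6
  have hm := hM a 0 _ (ih α' β (by omega))
  rw [yangM_mono, hback, hα'0, ← Finset.add_sum_erase _ _ (Finset.mem_univ (0 : Fin k)), hback,
    hα'0] at hm
  have h0 : ((((α 0 + 1 : ℕ) : ℂ)) * β 0) • (V.mono p α ⊗ₜ[ℂ]
      V.mono q (β - Finsupp.single 0 1 + Finsupp.single 0 1)) =
      (((α 0 : ℂ) + 1) * β 0) • v := by
    by_cases hb : β 0 = 0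
    · simp [hb]
    · rw [tsub_add_cancel_of_le (by rw [Finsupp.single_le_iff]; omega)]
      push_cast
      rfl
  rw [h0] at hm
  have hs := S.sum_mem hy
  rw [Finset.sum_add_distrib, ← Finset.sum_smul, ← Finset.sum_mul] at hs
  -- The corrections add up to the tail degree of α', whence the shift by r in the final
  -- coefficient.
  have hr : ∑ c ∈ Finset.univ.erase (0 : Fin k), (α' c : ℂ) = r := by
    rw [← hα'r, tailDeg]; push_cast; rfl
  rw [hr] at hs
  have hd := S.sub_mem hm hs
  have hfin : (((α 0 : ℂ) + 1) * (t + β 0 - r)) • v ∈ S := by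
    convert hd using 1
    push_cast
    module
  refine (S.smul_mem_iff (mul_ne_zero ?_ ?_)).mp hfin
  · exact_mod_cast Nat.succ_ne_zero (α 0)
  · intro h
    apply ht (r - β 0)
    push_cast
    linear_combination h

/-- The outer induction is on the total tail degree, the inner one on that of β. The diagonal
generator (a, 0) creates the last variable a of β, at the price of a term where a is created in the
first factor, and that term has smaller tail degree in the second. -/
theorem mono_tmul_mem (h0 : topVec k p q ∈ S) (α β : Fin k →₀ ℕ) :
    V.mono p α ⊗ₜ[ℂ] V.mono q β ∈ S := by
  suffices h : ∀ r (α β : Fin k →₀ ℕ), tailDeg α + tailDeg β = r →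
      V.mono p α ⊗ₜ[ℂ] V.mono q β ∈ S from h _ α β rfl
  intro r
  induction r with
  | zero =>
    intro α β h
    by_cases hp : α.degree = p
    · by_cases hq : β.degree = q
      · have h1 := eq_single_of_tailDeg_eq_zero (α := α) (by omega)
        have h2 := eq_single_of_tailDeg_eq_zero (α := β) (by omega)
        rw [h1, Finsupp.degree_single] at hp
        rw [h2, Finsupp.degree_single] at hq
        rw [h1, h2, hp, hq]
        exact h0
      · rw [V.mono_of_ne hq, TensorProduct.tmul_zero]; exact S.zero_mem
    · rw [V.mono_of_ne hp, TensorProduct.zero_tmul]; exact S.zero_mem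
  | succ r ih =>
    suffices h : ∀ s (α β : Fin k →₀ ℕ), tailDeg β = s → tailDeg α + tailDeg β = r + 1 →
        V.mono p α ⊗ₜ[ℂ] V.mono q β ∈ S from fun α β => h _ α β rfl
    intro s
    induction s with
    | zero =>
      intro α β h1 h2
      exact mono_tmul_mem_of_tailDeg_eq_zero ht hE hM ih α β (by omega) h1
    | succ s ihs =>
      intro α β h1 h2
      obtain ⟨a, ha, haβ⟩ := exists_ne_zero_of_tailDeg_ne_zero (α := β) (by omega)
      set β' := β - Finsupp.single a 1 + Finsupp.single 0 1 with hβ'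
      have h3 : tailDeg β' + 1 = tailDeg β := tailDeg_raise ha haβ
      have h4 := hE a 0 _ (ih α β' (by omega))
      have h5 : β' 0 = β 0 + 1 := by simp [hβ', ha]
      have hback : β' - Finsupp.single 0 1 + Finsupp.single a 1 = β := by
        ext b
        by_cases h1 : b = 0
        · subst h1; simp [hβ', ha]
        · by_cases h2 : b = a
          · subst h2; simp [hβ']; omega
          · simp [hβ', h2]
      rw [diagE_mono, hback, h5] at h4
      have h6 : (α 0 : ℂ) • (V.mono p (α - Finsupp.single 0 1 + Finsupp.single a 1) ⊗ₜ[ℂ]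
          V.mono q β') ∈ S := by
        by_cases hα : α 0 = 0
        · simp [hα]
        · refine S.smul_mem _ (ihs _ _ (by omega) ?_)
          rw [tailDeg_lower ha hα]
          omega
      refine (S.smul_mem_iff ?_).mp ((S.add_mem_iff_right h6).mp h4)
      exact_mod_cast Nat.succ_ne_zero (β 0)

/-- `x_1^p ⊗ x_1^q` generates `V_p ⊗ V_q` under the operators `e_{ab} ⊗ 1 + 1 ⊗ e_{ab}` and
`t e_{ab} ⊗ 1 + ∑_c e_{ac} ⊗ e_{cb}`, for `t ∉ ℤ`. -/
theorem eq_top_of_topVec_mem (h0 : topVec k p q ∈ S) : S = ⊤ := by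
  rw [eq_top_iff, ← ((V.basis k p).tensorProduct (V.basis k q)).span_eq, Submodule.span_le]
  rintro _ ⟨⟨α, β⟩, rfl⟩
  rw [Module.Basis.tensorProduct_apply, V.basis_apply, V.basis_apply, ← V.mono_of_degree,
    ← V.mono_of_degree]
  exact mono_tmul_mem ht hE hM h0 α.1 β.1

end

end Cyclic

/-! ### The series `∑ c_s F^s E^s` as an intertwiner -/

section Abstract

variable {W : Type*} [AddCommGroup W] [Module ℂ W]

theorem pow_apply_weight {E H : Module.End ℂ W} {c : ℂ} (hHE : H * E = E * H + c • E) {f : W} {h : ℂ}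
    (hf : H f = h • f) (s : ℕ) : H ((E ^ s) f) = (h + s * c) • (E ^ s) f := by
  induction s with
  | zero => simp [hf]
  | succ s ih =>
    have h1 := LinearMap.congr_fun hHE ((E ^ s) f)
    simp only [LinearMap.add_apply, LinearMap.smul_apply, Module.End.mul_apply, ih, map_smul] at h1
    rw [pow_succ', Module.End.mul_apply, h1]
    push_cast
    module

theorem pow_apply_comm_weight {E F H : Module.End ℂ W} (hEF : E * F = F * E + H)
    (hHE : H * E = E * H + (2 : ℂ) • E) {f : W} {h : ℂ} (hf : H f = h • f) (s : ℕ) :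
    (E ^ (s + 1)) (F f) = F ((E ^ (s + 1)) f) + ((s + 1) * (h + s)) • (E ^ s) f := by
  have hEF' : ∀ x, E (F x) = F (E x) + H x := fun x => LinearMap.congr_fun hEF x
  induction s with
  | zero => simp [hEF', hf]
  | succ s ih =>
    rw [pow_succ', Module.End.mul_apply, ih, map_add, hEF', pow_apply_weight hHE hf, map_smul,
      ← Module.End.mul_apply E (E ^ s), ← pow_succ', ← Module.End.mul_apply E (E ^ (s + 1)),
      ← pow_succ']
    push_cast
    module

theorem pow_mul_of_comm {E A X : Module.End ℂ W} {c : ℂ} (hEA : E * A = A * E + c • X)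
    (hXE : X * E = E * X) (s : ℕ) (f : W) :
    (E ^ (s + 1)) (A f) = A ((E ^ (s + 1)) f) + ((s + 1) * c) • X ((E ^ s) f) := by
  have hEA' : ∀ x, E (A x) = A (E x) + c • X x := fun x => LinearMap.congr_fun hEA x
  have hXE' : ∀ x, X (E x) = E (X x) := fun x => LinearMap.congr_fun hXE x
  induction s with
  | zero => simp [hEA']
  | succ s ih =>
    rw [pow_succ', Module.End.mul_apply, ih, map_add, hEA', map_smul, ← hXE',
      ← Module.End.mul_apply E (E ^ s), ← pow_succ', ← Module.End.mul_apply E (E ^ (s + 1)),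
      ← pow_succ']
    push_cast
    module

theorem pow_apply_comm {E X : Module.End ℂ W} (hXE : X * E = E * X) (s : ℕ) (f : W) :
    (E ^ s) (X f) = X ((E ^ s) f) :=
  (LinearMap.congr_fun ((Commute.pow_right (show Commute X E from hXE) s).eq) f).symm

/-- The intertwining property of `∑ c_s F^s E^s`. -/
theorem sum_pow_intertwines {E F H A X Y : Module.End ℂ W}
    (hEF : E * F = F * E + H) (hHE : H * E = E * H + (2 : ℂ) • E)
    (hHF : H * F = F * H - (2 : ℂ) • F) (hHY : H * Y = Y * H - (2 : ℂ) • Y)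
    (hEA : E * A = A * E - X) (hFA : F * A = A * F + Y) (hXE : X * E = E * X) (hYF : Y * F = F * Y)
    (hXY : X * F - E * Y = F * X - Y * E) {t h : ℂ} {f : W} (hf : H f = h • f) (c : ℕ → ℂ)
    (hc : ∀ s : ℕ, c s = (s + 1) * (t - h - (s + 1)) * c (s + 1)) {q : ℕ}
    (hE : (E ^ (q + 1)) f = 0) (hX : X ((E ^ q) f) = 0) :
    ∑ s ∈ Finset.range (q + 1), c s • (F ^ s) ((E ^ s) ((t - 1) • A f + X (F f))) =
      (t - 1) • A (∑ s ∈ Finset.range (q + 1), c s • (F ^ s) ((E ^ s) f))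
        + E (Y (∑ s ∈ Finset.range (q + 1), c s • (F ^ s) ((E ^ s) f))) := by
  -- The telescoping quantity: the s-th term of the difference of the two sides will be c_s V_s -
  -- c_{s-1} V_{s-1}.
  let V : ℕ → W := fun s => (F ^ s) (F (X ((E ^ s) f)) - Y (E ((E ^ s) f)))
  have hXY' : ∀ x, X (F x) - E (Y x) = F (X x) - Y (E x) := fun x => LinearMap.congr_fun hXY x
  have hHF' : (-H) * F = F * (-H) + (2 : ℂ) • F := by
    rw [neg_mul, hHF, mul_neg]; abel
  have hFE : F * E = E * F + -H := by rw [hEF]; abel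
  -- Moving the powers of E and F past A, and E^{s+1} past F and F^{s+1} past E, produces lower
  -- terms. They all carry the factor (s+1)(t - h - (s+1)), up to sign, which `hc` converts into
  -- c_s.
  have key : ∀ s : ℕ, c (s + 1) • ((F ^ (s + 1)) ((E ^ (s + 1)) ((t - 1) • A f + X (F f)))
      - (t - 1) • A ((F ^ (s + 1)) ((E ^ (s + 1)) f)) - E (Y ((F ^ (s + 1)) ((E ^ (s + 1)) f)))) =
      c (s + 1) • V (s + 1) - c s • V s := by
    intro s
    have hg : (-H) (Y ((E ^ (s + 1)) f)) = (-(h + 2 * s)) • Y ((E ^ (s + 1)) f) := by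
      have h1 := LinearMap.congr_fun hHY ((E ^ (s + 1)) f)
      simp only [LinearMap.sub_apply, LinearMap.smul_apply, Module.End.mul_apply,
        pow_apply_weight hHE hf, map_smul] at h1
      rw [LinearMap.neg_apply, h1]
      push_cast
      module
    have e1 := pow_mul_of_comm (c := -1) (by rw [hEA]; module) hXE s f
    have e2 : (E ^ (s + 1)) (X (F f)) = X ((E ^ (s + 1)) (F f)) := pow_apply_comm hXE _ _
    have e3 := pow_apply_comm_weight hEF hHE hf s
    have e4 := pow_mul_of_comm (c := 1) (by rw [hFA]; module) hYF s ((E ^ (s + 1)) f)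
    have e5 : (F ^ (s + 1)) (Y ((E ^ (s + 1)) f)) = Y ((F ^ (s + 1)) ((E ^ (s + 1)) f)) :=
      pow_apply_comm hYF _ _
    have e6 := pow_apply_comm_weight hFE hHF' hg s
    have e7 : (F ^ s) (Y ((E ^ (s + 1)) f)) = Y ((F ^ s) ((E ^ (s + 1)) f)) :=
      pow_apply_comm hYF _ _
    have e8 : E ((E ^ s) f) = (E ^ (s + 1)) f := by rw [pow_succ', Module.End.mul_apply]
    have e9 : ∀ x, (F ^ s) (F x) = (F ^ (s + 1)) x := fun x => by
      rw [pow_succ, Module.End.mul_apply]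
    simp only [V]
    rw [← hXY' ((E ^ (s + 1)) f), hc s, e8, map_sub (F ^ s), e9, e7, ← e5]
    simp only [map_add, map_sub, map_smul, e1, e2, e3]
    rw [e5] at e6
    rw [e7] at e6
    rw [← sub_eq_iff_eq_add] at e4
    rw [← e4, e5]
    rw [← sub_eq_iff_eq_add] at e6
    rw [← e6]
    module
  have hsum : ∀ q : ℕ, ∑ s ∈ Finset.range (q + 1), c s • ((F ^ s) ((E ^ s) ((t - 1) • A f + X (F f)))
      - (t - 1) • A ((F ^ s) ((E ^ s) f)) - E (Y ((F ^ s) ((E ^ s) f)))) = c q • V q := by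
    intro q
    induction q with
    | zero =>
      simp only [zero_add, Finset.sum_range_one, pow_zero, Module.End.one_apply, V]
      rw [← hXY']
      module
    | succ q ih => rw [Finset.sum_range_succ, ih, key]; abel
  -- Only the boundary term c_q V_q is left, and the two vanishing hypotheses kill its two halves.
  have hV : V q = 0 := by
    simp only [V]
    rw [hX, ← Module.End.mul_apply E, ← pow_succ', hE]
    simp
  have hs := hsum q
  rw [hV, smul_zero] at hs
  simp only [smul_sub, Finset.sum_sub_distrib] at hs
  simp only [map_sum, map_smul, Finset.smul_sum]
  rw [sub_sub, sub_eq_zero] at hs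
  rw [hs]
  congr 1
  exact Finset.sum_congr rfl fun s _ => smul_comm _ _ _

end Abstract

/-! ### The series B_{ij}(t) on polynomials and its intertwining relations. -/

section Bpoly

variable {k n : ℕ}

/-- The operator `∑_a x_{ai} ∂_{aj}`. -/
def colE (i j : Fin n) : Module.End ℂ (MvPolynomial (Fin k × Fin n) ℂ) := ∑ a, xd (a, i) (a, j)

theorem colE_mul_xd (i j i' j' : Fin n) (a b : Fin k) :
    colE i j * xd (a, i') (b, j') = xd (a, i') (b, j') * colE i j
      + (if j = i' then xd (a, i) (b, j') else 0) - (if j' = i then xd (a, i') (b, j) else 0) := by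
  rw [colE, Finset.sum_mul, Finset.mul_sum, Finset.sum_congr rfl fun c _ => xd_mul_xd _ _ _ _,
    Finset.sum_sub_distrib, Finset.sum_add_distrib]
  congr 1
  · congr 1
    by_cases h : j = i' <;> simp [h]
  · by_cases h : j' = i <;> simp [h]

theorem colE_mul_colE (i j i' j' : Fin n) :
    (colE i j * colE i' j' : Module.End ℂ (MvPolynomial (Fin k × Fin n) ℂ)) =
      colE i' j' * colE i j
      + (if j = i' then colE i j' else 0) - (if j' = i then colE i' j else 0) := by
  rw [colE.eq_def i' j', Finset.mul_sum, Finset.sum_mul,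
    Finset.sum_congr rfl fun c _ => colE_mul_xd _ _ _ _ _ _, Finset.sum_sub_distrib,
    Finset.sum_add_distrib]
  congr 1
  · congr 1
    by_cases h : j = i' <;> simp [h, colE]
  · by_cases h : j' = i <;> simp [h, colE]

/-- Degrees in a column are nonnegative, so -1 is not an eigenvalue. This is what truncates the
series at s = q. -/
theorem eq_zero_of_colE_eq_neg {j : Fin n} {f : MvPolynomial (Fin k × Fin n) ℂ}
    (h : colE j j f = (-1 : ℂ) • f) : f = 0 := by
  ext d
  have h1 := congrArg (coeff d) h
  rw [colE, LinearMap.sum_apply, coeff_sum, coeff_smul, smul_eq_mul] at h1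
  simp only [coeff_xd_self] at h1
  rw [← Finset.sum_mul] at h1
  have h2 : (((∑ a, d (a, j) : ℕ) : ℂ) + 1) * coeff d f = 0 := by
    push_cast
    linear_combination h1
  rw [coeff_zero]
  refine (mul_eq_zero.mp h2).resolve_left ?_
  exact_mod_cast Nat.succ_ne_zero (∑ a, d (a, j))

/-- The coefficients `∏_{r=1}^s 1/(r(t - p + q - r))`. -/
def bcoeff (t p q : ℂ) (s : ℕ) : ℂ :=
  ∏ r ∈ Finset.range s, (((r + 1 : ℕ) : ℂ) * (t - ((r + 1 : ℕ) : ℂ) - p + q))⁻¹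

/-- This is the recursion required by the telescoping argument, with h = p - q; it can be divided
out because no denominator vanishes for t ∉ ℤ. -/
theorem bcoeff_eq {t : ℂ} (ht : ∀ N : ℤ, t ≠ N) (p q s : ℕ) :
    bcoeff t p q s = (s + 1) * (t - (p - q) - (s + 1)) * bcoeff t p q (s + 1) := by
  rw [bcoeff, bcoeff, Finset.prod_range_succ]
  have h1 : (s : ℂ) + 1 ≠ 0 := by exact_mod_cast Nat.succ_ne_zero s
  have h2 : t - ((s : ℂ) + 1) - p + q ≠ 0 := by
    intro h
    apply ht (s + 1 + p - q)
    push_cast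
    linear_combination h
  push_cast
  generalize ∏ x ∈ Finset.range s, (((x : ℂ) + 1) * (t - ((x : ℂ) + 1) - p + q))⁻¹ = P
  field_simp
  ring

/-- The operator by which `B_{ij}(t)` acts on polynomials of degrees `p`, `q` in the variables of
the columns `i`, `j`. -/
def Bpoly (i j : Fin n) (t : ℂ) (p q : ℕ) : Module.End ℂ (MvPolynomial (Fin k × Fin n) ℂ) :=
  ∑ s ∈ Finset.range (q + 1), bcoeff t p q s • (colE j i ^ s * colE i j ^ s)

theorem Bpoly_apply (i j : Fin n) (t : ℂ) (p q : ℕ) (f : MvPolynomial (Fin k × Fin n) ℂ) :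
    Bpoly i j t p q f =
      ∑ s ∈ Finset.range (q + 1), bcoeff t p q s • (colE j i ^ s) ((colE i j ^ s) f) := by
  simp only [Bpoly, LinearMap.sum_apply, LinearMap.smul_apply, Module.End.mul_apply]

theorem Bpoly_commute {i j : Fin n} {t : ℂ} {p q : ℕ}
    {O : Module.End ℂ (MvPolynomial (Fin k × Fin n) ℂ)} (h1 : Commute O (colE i j))
    (h2 : Commute O (colE j i)) : Commute O (Bpoly i j t p q) :=
  Commute.sum_right _ _ _ fun s _ => ((h2.pow_right s).mul_right (h1.pow_right s)).smul_right _

/-- The image of `t e_{ab} ⊗ 1 + ∑_c e_{ac} ⊗ e_{cb}`. -/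
def Mop (i j : Fin n) (t : ℂ) (a b : Fin k) : Module.End ℂ (MvPolynomial (Fin k × Fin n) ℂ) :=
  (t - 1) • xd (a, i) (b, i) + xd (a, i) (b, j) * colE j i

/-- The image of `t e_{ab} ⊗ 1 + ∑_c e_{cb} ⊗ e_{ac}`. -/
def Mop' (i j : Fin n) (t : ℂ) (a b : Fin k) : Module.End ℂ (MvPolynomial (Fin k × Fin n) ℂ) :=
  (t - 1) • xd (a, i) (b, i) + colE i j * xd (a, j) (b, i)

/-- The diagonal action of `e_{ab}` on the columns `i`, `j`. -/
def Dop (i j : Fin n) (a b : Fin k) : Module.End ℂ (MvPolynomial (Fin k × Fin n) ℂ) :=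
  xd (a, i) (b, i) + xd (a, j) (b, j)

/-- Replacing (i, j, t) by (j, i, -t) exchanges the two Yangian actions up to a multiple of the
diagonal action. This symmetry makes unitarity provable by cyclicity. -/
theorem Mop'_eq (i j : Fin n) (t : ℂ) (a b : Fin k) :
    Mop' i j t a b = Mop j i (-t) a b + t • Dop i j a b := by
  rw [Mop', Mop, Dop, colE_mul_xd]
  simp only [if_true]
  module

theorem Mop_eq (i j : Fin n) (t : ℂ) (a b : Fin k) :
    Mop i j t a b = Mop' j i (-t) a b + t • Dop i j a b := by
  rw [Mop', Mop, Dop, colE_mul_xd]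
  simp only [if_true]
  module

theorem Dop_commute_colE {i j : Fin n} (hij : i ≠ j) (a b : Fin k) :
    Commute (Dop i j a b) (colE i j) := by
  rw [Commute, SemiconjBy, Dop, mul_add, colE_mul_xd, colE_mul_xd]
  simp only [if_true, hij.symm, if_false]
  rw [add_mul]
  abel

theorem Dop_comm (i j : Fin n) (a b : Fin k) : Dop i j a b = Dop j i a b := add_comm _ _

theorem Dop_commute_Bpoly {i j : Fin n} (hij : i ≠ j) (t : ℂ) (p q : ℕ) (a b : Fin k) :
    Commute (Dop i j a b) (Bpoly i j t p q) := by
  refine Bpoly_commute (Dop_commute_colE hij a b) ?_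
  rw [Dop_comm]
  exact Dop_commute_colE hij.symm a b

/-- `f` has degrees `p`, `q` in the variables of the columns `i`, `j`. -/
def HasBidegree (i j : Fin n) (p q : ℕ) (f : MvPolynomial (Fin k × Fin n) ℂ) : Prop :=
  colE i i f = (p : ℂ) • f ∧ colE j j f = (q : ℂ) • f

theorem colE_weight {i j : Fin n} (hij : i ≠ j) :
    (colE j j * colE i j : Module.End ℂ (MvPolynomial (Fin k × Fin n) ℂ)) =
      colE i j * colE j j + (-1 : ℂ) • colE i j := by
  rw [colE_mul_colE]
  simp only [if_true, hij.symm, if_false]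
  module

theorem HasBidegree.pow_eq_zero {i j : Fin n} (hij : i ≠ j) {p q : ℕ}
    {f : MvPolynomial (Fin k × Fin n) ℂ} (hf : HasBidegree i j p q f) {s : ℕ} (hs : q < s) :
    (colE i j ^ s) f = 0 := by
  obtain ⟨r, rfl⟩ := Nat.exists_eq_add_of_lt hs
  have h : (colE i j ^ (q + 1)) f = 0 := by
    apply eq_zero_of_colE_eq_neg (j := j)
    rw [pow_apply_weight (colE_weight hij) hf.2]
    congr 1
    push_cast
    ring
  rw [show q + r + 1 = r + (q + 1) by ring, pow_add, Module.End.mul_apply, h, map_zero]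

theorem HasBidegree.xd_pow_eq_zero {i j : Fin n} (hij : i ≠ j) {p q : ℕ}
    {f : MvPolynomial (Fin k × Fin n) ℂ} (hf : HasBidegree i j p q f) (a b : Fin k) :
    xd (a, i) (b, j) ((colE i j ^ q) f) = 0 := by
  apply eq_zero_of_colE_eq_neg (j := j)
  have h := LinearMap.congr_fun (colE_mul_xd j j i j a b) ((colE i j ^ q) f)
  simp only [if_true, hij.symm, if_false, Module.End.mul_apply, LinearMap.sub_apply,
    add_zero, pow_apply_weight (colE_weight hij) hf.2, map_smul] at h
  rw [h]
  module

/-- The triple E_{ij}, E_{ji}, E_{ii} - E_{jj} is an sl_2-triple, and x_{ai} ∂_{bi} moves under it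
within the span of the operators x_{a·} ∂_{b·}. The abstract intertwining identity applies, its
boundary terms having degree -1 in column j. -/
theorem Bpoly_Mop {i j : Fin n} (hij : i ≠ j) {t : ℂ} (ht : ∀ N : ℤ, t ≠ N) {p q : ℕ}
    {f : MvPolynomial (Fin k × Fin n) ℂ} (hf : HasBidegree i j p q f) (a b : Fin k) :
    Bpoly i j t p q (Mop i j t a b f) = Mop' i j t a b (Bpoly i j t p q f) := by
  have h := sum_pow_intertwines (E := colE i j) (F := colE j i) (H := colE i i - colE j j)
    (A := xd (a, i) (b, i)) (X := xd (a, i) (b, j)) (Y := xd (a, j) (b, i)) (f := f)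
    (t := t) (h := (p : ℂ) - q) (q := q) (c := bcoeff t p q) ?_ ?_ ?_ ?_ ?_ ?_ ?_ ?_ ?_ ?_
    (bcoeff_eq ht p q) (hf.pow_eq_zero hij (Nat.lt_succ_self q)) (hf.xd_pow_eq_zero hij a b)
  · rw [Bpoly_apply, Bpoly_apply]
    exact h
  · rw [colE_mul_colE]; simp only [if_true]; abel
  · rw [sub_mul, mul_sub, colE_mul_colE i i, colE_mul_colE j j]
    simp only [if_true, hij.symm, if_false]
    module
  · rw [sub_mul, mul_sub, colE_mul_colE i i, colE_mul_colE j j]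
    simp only [if_true, hij, if_false]
    module
  · rw [sub_mul, mul_sub, colE_mul_xd i i, colE_mul_xd j j]
    simp only [if_true, hij, if_false]
    module
  · rw [colE_mul_xd]; simp only [if_true, hij.symm, if_false]; abel
  · rw [colE_mul_xd]; simp only [if_true, hij, if_false]; abel
  · rw [colE_mul_xd]; simp only [hij.symm, if_false]; abel
  · rw [colE_mul_xd]; simp only [hij, if_false]; abel
  · rw [colE_mul_xd, colE_mul_xd]; simp only [if_true]; abel
  · rw [LinearMap.sub_apply, hf.1, hf.2]; module

theorem HasBidegree.Bpoly {i j : Fin n} (hij : i ≠ j) {p q : ℕ} (t : ℂ) (p' q' : ℕ)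
    {f : MvPolynomial (Fin k × Fin n) ℂ} (hf : HasBidegree i j p q f) :
    HasBidegree i j p q (Bpoly i j t p' q' f) := by
  have hcomm : ∀ s : ℕ, Commute (colE i i : Module.End ℂ (MvPolynomial (Fin k × Fin n) ℂ))
      (colE j i ^ s * colE i j ^ s) ∧
      Commute (colE j j : Module.End ℂ (MvPolynomial (Fin k × Fin n) ℂ))
      (colE j i ^ s * colE i j ^ s) := by
    intro s
    -- Each factor E raises the eigenvalue of O by c and each factor F lowers it by c, so F^s E^s
    -- has weight zero.
    have key : ∀ (O : Module.End ℂ (MvPolynomial (Fin k × Fin n) ℂ)) (c : ℂ),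
        O * colE i j = colE i j * O + c • colE i j →
        O * colE j i = colE j i * O + (-c) • colE j i →
        Commute O (colE j i ^ s * colE i j ^ s) := by
      intro O c h1 h2
      have hp : ∀ (G : Module.End ℂ (MvPolynomial (Fin k × Fin n) ℂ)) (c : ℂ),
          O * G = G * O + c • G → ∀ s : ℕ, O * G ^ s = G ^ s * O + (s * c) • G ^ s := by
        intro G c h s
        induction s with
        | zero => simp
        | succ s ih =>
          rw [pow_succ, ← mul_assoc, ih, add_mul, mul_assoc, h, mul_add, ← mul_assoc,
            mul_smul_comm, smul_mul_assoc, ← pow_succ]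
          push_cast
          module
      rw [Commute, SemiconjBy, ← mul_assoc, hp _ _ h2, add_mul, mul_assoc, hp _ _ h1, mul_add,
        mul_smul_comm, smul_mul_assoc, mul_assoc]
      module
    constructor
    · apply key _ 1 <;> rw [colE_mul_colE] <;> simp only [if_true, hij, hij.symm, if_false] <;>
        module
    · apply key _ (-1) <;> rw [colE_mul_colE] <;> simp only [if_true, hij, hij.symm, if_false] <;>
        module
  constructor
  · have h : Commute (colE i i) (GLDuality.Bpoly (k := k) i j t p' q') :=
      Commute.sum_right _ _ _ fun s _ => (hcomm s).1.smul_right _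
    have h1 := LinearMap.congr_fun h.eq f
    rwa [Module.End.mul_apply, Module.End.mul_apply, hf.1, map_smul] at h1
  · have h : Commute (colE j j) (GLDuality.Bpoly (k := k) i j t p' q') :=
      Commute.sum_right _ _ _ fun s _ => (hcomm s).2.smul_right _
    have h1 := LinearMap.congr_fun h.eq f
    rwa [Module.End.mul_apply, Module.End.mul_apply, hf.2, map_smul] at h1

end Bpoly

/-! ### The value on the highest weight vector -/

/-- A form of the Chu–Vandermonde identity. Pascal's rule splits the sum for q + 1 into the sum for
q and, after extracting the factor b/(c - 1), the sum for q with (b, c) replaced by (b + 1, c - 1).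
-/
theorem sum_choose_prod_div (q : ℕ) (b c : ℂ) (hc : ∀ r : ℕ, c - (r + 1) ≠ 0) :
    ∑ s ∈ Finset.range (q + 1), (q.choose s : ℂ) *
        ∏ r ∈ Finset.range s, (b + r) / (c - (r + 1)) =
      ∏ r ∈ Finset.range q, (c + b - (r + 1)) / (c - (r + 1)) := by
  induction q generalizing b c with
  | zero => simp
  | succ q ih =>
    have hc' : ∀ r : ℕ, c - 1 - (r + 1) ≠ 0 := by
      intro r h
      apply hc (r + 1)
      push_cast
      linear_combination h
    have hG : ∀ s, ∏ r ∈ Finset.range (s + 1), (b + r) / (c - (r + 1)) =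
        b / (c - 1) * ∏ r ∈ Finset.range s, (b + 1 + r) / (c - 1 - (r + 1)) := by
      intro s
      rw [Finset.prod_range_succ', mul_comm]
      congr 1
      · simp
      · refine Finset.prod_congr rfl fun r _ => ?_
        push_cast
        congr 1 <;> ring
    have h1 : ∑ s ∈ Finset.range (q + 1 + 1), ((q + 1).choose s : ℂ) *
        ∏ r ∈ Finset.range s, (b + r) / (c - (r + 1)) =
        ∑ s ∈ Finset.range (q + 1), (q.choose s : ℂ) *
          ∏ r ∈ Finset.range s, (b + r) / (c - (r + 1)) +
        b / (c - 1) * ∑ s ∈ Finset.range (q + 1), (q.choose s : ℂ) *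
          ∏ r ∈ Finset.range s, (b + 1 + r) / (c - 1 - (r + 1)) := by
      have h2 : ∑ s ∈ Finset.range (q + 1), (q.choose s : ℂ) *
          ∏ r ∈ Finset.range s, (b + r) / (c - (r + 1)) =
          ∑ s ∈ Finset.range (q + 1 + 1), (q.choose s : ℂ) *
          ∏ r ∈ Finset.range s, (b + r) / (c - (r + 1)) := by
        rw [Finset.sum_range_succ _ (q + 1), Nat.choose_succ_self]
        simp
      rw [h2, Finset.sum_range_succ', Finset.sum_range_succ' _ (q + 1), Finset.mul_sum]
      simp only [Nat.choose_succ_succ, hG, Nat.cast_add, add_mul, Finset.sum_add_distrib,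
        Nat.choose_zero_right]
      rw [Finset.sum_congr rfl fun x _ => mul_left_comm ((q.choose x : ℂ)) (b / (c - 1)) _]
      ring
    rw [h1, ih b c hc, ih (b + 1) (c - 1) hc']
    have h3 : ∀ r : ℕ, c - 1 + (b + 1) - ((r : ℂ) + 1) = c + b - (r + 1) := fun r => by ring
    simp only [h3, Finset.prod_div_distrib]
    have h4 : (c - 1) * ∏ r ∈ Finset.range q, (c - 1 - ((r : ℂ) + 1)) =
        (∏ r ∈ Finset.range q, (c - ((r : ℂ) + 1))) * (c - (q + 1)) := by
      rw [← Finset.prod_range_succ (fun r : ℕ => c - ((r : ℂ) + 1)), Finset.prod_range_succ',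
        mul_comm]
      congr 1
      · refine Finset.prod_congr rfl fun r _ => ?_
        push_cast
        ring
      · simp
    rw [Finset.prod_range_succ, Finset.prod_range_succ (fun r : ℕ => c - ((r : ℂ) + 1))]
    have h5 : ∏ r ∈ Finset.range q, (c - ((r : ℂ) + 1)) ≠ 0 :=
      Finset.prod_ne_zero_iff.mpr fun r _ => hc r
    have h6 : ∏ r ∈ Finset.range q, (c - 1 - ((r : ℂ) + 1)) ≠ 0 :=
      Finset.prod_ne_zero_iff.mpr fun r _ => hc' r
    have h7 : c - 1 ≠ 0 := by simpa using hc 0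
    have h8 := hc q
    rw [div_mul_div_comm, h4, div_add_div _ _ h5 (mul_ne_zero h5 h8), div_eq_div_iff
      (mul_ne_zero h5 (mul_ne_zero h5 h8)) (mul_ne_zero h5 h8)]
    ring

theorem Gamma_add_nat {x : ℂ} (hx : ∀ N : ℤ, x ≠ N) (q : ℕ) :
    Complex.Gamma (x + q) = (∏ r ∈ Finset.range q, (x + q - (r + 1))) * Complex.Gamma x := by
  induction q with
  | zero => simp
  | succ q ih =>
    have h1 : x + q ≠ 0 := by
      intro h
      apply hx (-q)
      push_cast
      linear_combination h
    rw [Finset.prod_range_succ', Nat.cast_succ, ← add_assoc, Complex.Gamma_add_one _ h1, ih]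
    have h2 : ∀ r : ℕ, x + q + 1 - (((r + 1 : ℕ) : ℂ) + 1) = x + q - (r + 1) := by
      intro r; push_cast; ring
    simp only [h2]
    push_cast
    ring

theorem Gamma_ne_zero_of_ne_int {x : ℂ} (hx : ∀ N : ℤ, x ≠ N) : Complex.Gamma x ≠ 0 :=
  Complex.Gamma_ne_zero fun r h => hx (-r) (by rw [h]; push_cast; rfl)

/-- The eigenvalue of `C_{ab}(t)` on vectors with `e_{aa} = p`, `e_{bb} = q`. -/
def cfactor (t p q : ℂ) : ℂ :=
  Complex.Gamma (t + 1) * Complex.Gamma (t - p + q) /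
    (Complex.Gamma (t - p) * Complex.Gamma (t + q + 1))

theorem add_int_ne_int {t : ℂ} (ht : ∀ N : ℤ, t ≠ N) (M : ℤ) : ∀ N : ℤ, t + M ≠ N := by
  intro N h
  apply ht (N - M)
  push_cast
  linear_combination h

theorem cfactor_ne_zero {t : ℂ} (ht : ∀ N : ℤ, t ≠ N) (p q : ℕ) : cfactor t p q ≠ 0 := by
  have h1 := Gamma_ne_zero_of_ne_int (add_int_ne_int ht 1)
  have h2 := Gamma_ne_zero_of_ne_int (add_int_ne_int ht (-p + q))
  have h3 := Gamma_ne_zero_of_ne_int (add_int_ne_int ht (-p))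
  have h4 := Gamma_ne_zero_of_ne_int (add_int_ne_int ht (q + 1))
  push_cast at h1 h2 h3 h4
  rw [← add_assoc] at h2 h4
  rw [← sub_eq_add_neg] at h2 h3
  exact div_ne_zero (mul_ne_zero h1 h2) (mul_ne_zero h3 h4)

/-- Both Gamma quotients are finite products since their arguments differ by q. The product on the
left is the value of B_{ij}(t) on the highest weight vector, so this fixes the normalization of R.
-/
theorem cfactor_mul_prod {t : ℂ} (ht : ∀ N : ℤ, t ≠ N) (p q : ℕ) :
    cfactor t p q * ∏ r ∈ Finset.range q, (t + q - r) / (t - p + q - (r + 1)) = 1 := by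
  have h1 : ∀ N : ℤ, t + 1 ≠ N := by exact_mod_cast add_int_ne_int ht 1
  have h2 : ∀ N : ℤ, t - p ≠ N := by
    have := add_int_ne_int ht (-p)
    push_cast at this
    rwa [← sub_eq_add_neg] at this
  have h3 := Gamma_add_nat h1 q
  have h4 := Gamma_add_nat h2 q
  have h5 := Gamma_ne_zero_of_ne_int h1
  have h6 := Gamma_ne_zero_of_ne_int h2
  have h7 : Complex.Gamma (t + 1 + q) ≠ 0 := by
    have := Gamma_ne_zero_of_ne_int (add_int_ne_int h1 q)
    exact_mod_cast this
  have h8 : Complex.Gamma (t - p + q) ≠ 0 := by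
    have := Gamma_ne_zero_of_ne_int (add_int_ne_int h2 q)
    exact_mod_cast this
  have h9 : ∀ r : ℕ, t + 1 + q - ((r : ℂ) + 1) = t + q - r := fun r => by ring
  simp only [h9] at h3
  have h10 : ∏ r ∈ Finset.range q, (t - p + q - ((r : ℂ) + 1)) ≠ 0 := by
    intro h; rw [h, zero_mul] at h4; exact h8 h4
  rw [cfactor, show t + q + 1 = t + 1 + q by ring, Finset.prod_div_distrib]
  rw [div_mul_div_comm, div_eq_one_iff_eq (mul_ne_zero (mul_ne_zero h6 h7) h10), h3, h4]
  ring

/-! ### The vector x_{1i}^p x_{1j}^q and its eigenvalue. -/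

section TopVec

variable {k n : ℕ}

/-- `g` does not contain the variables of the columns `i`, `j`. -/
def FreeOf (i j : Fin n) (g : MvPolynomial (Fin k × Fin n) ℂ) : Prop :=
  ∀ a, pderiv (a, i) g = 0 ∧ pderiv (a, j) g = 0

theorem colE_mul (i j : Fin n) (f g : MvPolynomial (Fin k × Fin n) ℂ) :
    colE i j (f * g) = colE i j f * g + f * colE i j g := by
  simp only [colE, LinearMap.sum_apply, xd_mul, Finset.sum_add_distrib, Finset.sum_mul,
    Finset.mul_sum]

theorem FreeOf.colE_eq_zero {i j : Fin n} {g : MvPolynomial (Fin k × Fin n) ℂ}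
    (hg : FreeOf i j g) : colE i j g = 0 := by
  rw [colE, LinearMap.sum_apply]
  refine Finset.sum_eq_zero fun a _ => ?_
  rw [xd_apply, (hg a).2, mul_zero]

theorem FreeOf.symm {i j : Fin n} {g : MvPolynomial (Fin k × Fin n) ℂ}
    (hg : FreeOf i j g) : FreeOf j i g := fun a => ⟨(hg a).2, (hg a).1⟩

variable [NeZero k]

/-- `x_{1i}^p x_{1j}^q g`. -/
def topPoly (i j : Fin n) (g : MvPolynomial (Fin k × Fin n) ℂ) (p q : ℕ) :
    MvPolynomial (Fin k × Fin n) ℂ := X (0, i) ^ p * X (0, j) ^ q * g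

theorem topPoly_symm (i j : Fin n) (g : MvPolynomial (Fin k × Fin n) ℂ) (p q : ℕ) :
    topPoly i j g p q = topPoly j i g q p := by
  rw [topPoly, topPoly, mul_comm (X (0, i) ^ p)]

theorem colE_topPoly {i j : Fin n} (hij : i ≠ j) {g : MvPolynomial (Fin k × Fin n) ℂ}
    (hg : FreeOf i j g) (p q : ℕ) :
    colE i j (topPoly i j g p q) = (q : ℂ) • topPoly i j g (p + 1) (q - 1) := by
  have h1 : colE i j (X ((0 : Fin k), i) ^ p) = 0 := by
    rw [colE, LinearMap.sum_apply]
    refine Finset.sum_eq_zero fun a _ => ?_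
    rw [xd_apply, pderiv_pow, pderiv_X_of_ne (by simp [hij]), mul_zero, mul_zero]
  have h2 : colE i j (X ((0 : Fin k), j) ^ q) =
      (q : ℂ) • (X (0, i) * X ((0 : Fin k), j) ^ (q - 1)) := by
    rw [colE, LinearMap.sum_apply, Finset.sum_eq_single 0]
    · rw [xd_apply, pderiv_pow, pderiv_X_self, smul_eq_C_mul]
      simp only [map_natCast]
      ring
    · intro a _ ha
      rw [xd_apply, pderiv_pow, pderiv_X_of_ne (by simp [ha.symm]), mul_zero, mul_zero]
    · simp
  rw [topPoly, colE_mul, colE_mul, h1, h2, hg.colE_eq_zero, topPoly, smul_eq_C_mul,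
    smul_eq_C_mul]
  ring

theorem colE_pow_topPoly {i j : Fin n} (hij : i ≠ j) {g : MvPolynomial (Fin k × Fin n) ℂ}
    (hg : FreeOf i j g) (p q s : ℕ) :
    (colE i j ^ s) (topPoly i j g p q) =
      (q.descFactorial s : ℂ) • topPoly i j g (p + s) (q - s) := by
  induction s with
  | zero => simp
  | succ s ih =>
    rw [pow_succ', Module.End.mul_apply, ih, map_smul, colE_topPoly hij hg, smul_smul,
      Nat.descFactorial_succ, Nat.cast_mul, mul_comm, Nat.sub_sub, add_assoc]

/-- E^s carries s variables from column j to column i and F^s carries them back, so each term of the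
series multiplies the vector by a scalar. The sum is the Chu–Vandermonde sum with b = p + 1 and c =
t - p + q. -/
theorem Bpoly_topPoly {i j : Fin n} (hij : i ≠ j) {t : ℂ} (ht : ∀ N : ℤ, t ≠ N)
    {g : MvPolynomial (Fin k × Fin n) ℂ} (hg : FreeOf i j g) (p q : ℕ) :
    cfactor t p q • Bpoly i j t p q (topPoly i j g p q) = topPoly i j g p q := by
  have hterm : ∀ s ∈ Finset.range (q + 1),
      bcoeff t p q s • (colE j i ^ s) ((colE i j ^ s) (topPoly i j g p q)) =
      ((q.choose s : ℂ) * ∏ r ∈ Finset.range s, ((p + 1 : ℂ) + r) / (t - p + q - (r + 1))) •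
        topPoly i j g p q := by
    intro s hs
    have hsq : s ≤ q := Nat.lt_succ_iff.mp (Finset.mem_range.mp hs)
    rw [colE_pow_topPoly hij hg, map_smul, topPoly_symm, colE_pow_topPoly hij.symm hg.symm,
      topPoly_symm j i, Nat.sub_add_cancel hsq, Nat.add_sub_cancel, smul_smul, smul_smul]
    congr 1
    have h1 : ((p + s).descFactorial s : ℂ) = ∏ r ∈ Finset.range s, ((p + 1 : ℂ) + r) := by
      rw [Nat.add_descFactorial_eq_ascFactorial, Nat.ascFactorial_eq_prod_range]
      push_cast
      rfl
    have h2 : (q.descFactorial s : ℂ) = s.factorial * q.choose s := by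
      exact_mod_cast Nat.descFactorial_eq_factorial_mul_choose q s
    have h3 : bcoeff t p q s * s.factorial =
        ∏ r ∈ Finset.range s, (t - p + q - ((r : ℂ) + 1))⁻¹ := by
      rw [bcoeff, ← Finset.prod_range_add_one_eq_factorial, Nat.cast_prod,
        ← Finset.prod_mul_distrib]
      refine Finset.prod_congr rfl fun r _ => ?_
      have : (((r + 1 : ℕ)) : ℂ) ≠ 0 := Nat.cast_ne_zero.mpr (Nat.succ_ne_zero r)
      rw [mul_inv, mul_comm, ← mul_assoc, mul_inv_cancel₀ this, one_mul]
      push_cast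
      congr 1
      ring
    rw [h1, h2, Finset.prod_div_distrib, div_eq_mul_inv, ← Finset.prod_inv_distrib, ← h3]
    ring
  have hc : ∀ r : ℕ, t - p + q - (r + 1) ≠ 0 := by
    intro r h
    apply ht (p - q + (r + 1))
    push_cast
    linear_combination h
  rw [Bpoly_apply, Finset.sum_congr rfl hterm, ← Finset.sum_smul, sum_choose_prod_div q _ _ hc,
    smul_smul]
  have h4 : ∀ r : ℕ, t - p + q + (p + 1) - ((r : ℂ) + 1) = t + q - r := fun r => by ring
  simp only [h4]
  rw [cfactor_mul_prod ht, one_smul]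

end TopVec

/-! ### The rational `R`-matrix -/

section PairEmb

variable {k n : ℕ} {p q : ℕ}

/-- The realization of `V_p ⊗ V_q` by multiples of `g`, using the variables of the columns
`i`, `j`. -/
def pairEmb (i j : Fin n) (g : MvPolynomial (Fin k × Fin n) ℂ) :
    V k p ⊗[ℂ] V k q →ₗ[ℂ] MvPolynomial (Fin k × Fin n) ℂ :=
  LinearMap.mulRight ℂ g ∘ₗ TensorProduct.lift
    ((LinearMap.mul ℂ (MvPolynomial (Fin k × Fin n) ℂ)).compl₁₂ (embV (colVar i))
      (embV (colVar j)))

theorem pairEmb_tmul (i j : Fin n) (g : MvPolynomial (Fin k × Fin n) ℂ) (v : V k p) (w : V k q) :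
    pairEmb i j g (v ⊗ₜ[ℂ] w) = embV (colVar i) v * embV (colVar j) w * g := rfl

theorem xd_embV_eq_zero {i j : Fin n} (hij : i ≠ j) (s : Fin k × Fin n) (b : Fin k) (v : V k p) :
    xd s (b, j) (embV (colVar i) v) = 0 := by
  rw [xd_apply, pderiv_embV_eq_zero (fun a h => hij (Prod.ext_iff.mp h).2), mul_zero]

theorem xd_embV_self (i : Fin n) (a b : Fin k) (v : V k p) :
    xd (a, i) (b, i) (embV (colVar i) v) = embV (colVar i) (e a b v) :=
  (embV_e (colVar_injective2.right i) a b v).symm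

variable {i j : Fin n} {g : MvPolynomial (Fin k × Fin n) ℂ}

theorem pairEmb_left (hij : i ≠ j) (hg : FreeOf i j g) (a b : Fin k) (x : V k p ⊗[ℂ] V k q) :
    pairEmb i j g (TensorProduct.map (e a b) LinearMap.id x) =
      xd (a, i) (b, i) (pairEmb i j g x) := by
  induction x with
  | zero => simp
  | add x y hx hy => simp only [map_add, hx, hy]
  | tmul v w =>
    rw [TensorProduct.map_tmul, pairEmb_tmul, pairEmb_tmul, xd_mul, xd_mul,
      xd_embV_eq_zero hij.symm, xd_embV_self, xd_apply _ _ g, (hg b).1, LinearMap.id_apply]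
    ring

theorem pairEmb_right (hij : i ≠ j) (hg : FreeOf i j g) (a b : Fin k) (x : V k p ⊗[ℂ] V k q) :
    pairEmb i j g (TensorProduct.map LinearMap.id (e a b) x) =
      xd (a, j) (b, j) (pairEmb i j g x) := by
  induction x with
  | zero => simp
  | add x y hx hy => simp only [map_add, hx, hy]
  | tmul v w =>
    rw [TensorProduct.map_tmul, pairEmb_tmul, pairEmb_tmul, xd_mul, xd_mul,
      xd_embV_eq_zero hij, xd_embV_self, xd_apply _ _ g, (hg b).2, LinearMap.id_apply]
    ring

theorem pairEmb_map (hij : i ≠ j) (hg : FreeOf i j g) (a b c d : Fin k) (x : V k p ⊗[ℂ] V k q) :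
    pairEmb i j g (TensorProduct.map (e a b) (e c d) x) =
      xd (a, i) (b, i) (xd (c, j) (d, j) (pairEmb i j g x)) := by
  rw [← pairEmb_right hij hg, ← pairEmb_left hij hg]
  congr 1
  induction x with
  | zero => simp
  | add x y hx hy => simp only [map_add, hx, hy]
  | tmul v w => simp only [TensorProduct.map_tmul, LinearMap.id_apply]

/-- The action `t e_{ab} ⊗ 1 + ∑_c e_{cb} ⊗ e_{ac}` of a generator of the Yangian. -/
def yangM' (t : ℂ) (a b : Fin k) : Module.End ℂ (V k p ⊗[ℂ] V k q) :=
  t • TensorProduct.map (e a b) LinearMap.id + ∑ c, TensorProduct.map (e c b) (e a c)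

theorem xd_mul_xd_exchange {τ : Type*} [DecidableEq τ] {s t u v : τ} (htu : t ≠ u) :
    xd s t * xd u v = xd s v * xd u t - if v = u then xd s t else 0 := by
  refine LinearMap.ext fun f => ?_
  by_cases h : v = u
  · subst h
    simp only [Module.End.mul_apply, LinearMap.sub_apply, xd_apply, pderiv_mul, if_true,
      pderiv_X_of_ne htu.symm, pderiv_X_self, pderiv_comm t v]
    ring
  · rw [if_neg h, sub_zero, xd_exchange htu h]

/-- Reordering pulls x_{ai} ∂_{bj} out of the sum and leaves E_{ji}. The contraction costs one copy
of x_{ai} ∂_{bi}, which is the shift from t to t - 1. -/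
theorem Mop_eq_sum (hij : i ≠ j) (t : ℂ) (a b : Fin k) :
    Mop i j t a b = t • xd (a, i) (b, i) + ∑ c, xd (a, i) (c, i) * xd (c, j) (b, j) := by
  have h : ∀ c : Fin k, xd (a, i) (c, i) * xd (c, j) (b, j) =
      xd (a, i) (b, j) * xd (c, j) (c, i) - if b = c then xd (a, i) (c, i) else 0 := by
    intro c
    rw [xd_mul_xd_exchange (by simp [hij])]
    simp
  rw [Finset.sum_congr rfl fun c _ => h c, Finset.sum_sub_distrib, Mop, colE, Finset.mul_sum]
  simp only [Finset.sum_ite_eq, Finset.mem_univ, if_true]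
  module

theorem Mop'_eq_sum (hij : i ≠ j) (t : ℂ) (a b : Fin k) :
    Mop' i j t a b = t • xd (a, i) (b, i) + ∑ c, xd (c, i) (b, i) * xd (a, j) (c, j) := by
  have h : ∀ c : Fin k, xd (c, i) (b, i) * xd (a, j) (c, j) =
      xd (a, j) (b, i) * xd (c, i) (c, j) - if b = c then xd (a, j) (c, j) else 0 := by
    intro c
    rw [xd_mul_xd, xd_mul_xd_exchange (by simp [hij.symm])]
    simp [hij, hij.symm]
  rw [Finset.sum_congr rfl fun c _ => h c, Finset.sum_sub_distrib, Mop', colE_mul_xd, colE,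
    Finset.mul_sum]
  simp only [Finset.sum_ite_eq, Finset.mem_univ, if_true]
  module

theorem pairEmb_diagE (hij : i ≠ j) (hg : FreeOf i j g) (a b : Fin k) (x : V k p ⊗[ℂ] V k q) :
    pairEmb i j g (diagE a b x) = Dop i j a b (pairEmb i j g x) := by
  rw [diagE, LinearMap.add_apply, map_add, pairEmb_left hij hg, pairEmb_right hij hg]
  rfl

theorem pairEmb_yangM (hij : i ≠ j) (hg : FreeOf i j g) (t : ℂ) (a b : Fin k)
    (x : V k p ⊗[ℂ] V k q) :
    pairEmb i j g (yangM t a b x) = Mop i j t a b (pairEmb i j g x) := by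
  simp only [yangM, LinearMap.add_apply, LinearMap.smul_apply, LinearMap.sum_apply, map_add,
    map_smul, map_sum, pairEmb_left hij hg, pairEmb_map hij hg, Mop_eq_sum hij,
    Module.End.mul_apply]

theorem pairEmb_yangM' (hij : i ≠ j) (hg : FreeOf i j g) (t : ℂ) (a b : Fin k)
    (x : V k p ⊗[ℂ] V k q) :
    pairEmb i j g (yangM' t a b x) = Mop' i j t a b (pairEmb i j g x) := by
  simp only [yangM', LinearMap.add_apply, LinearMap.smul_apply, LinearMap.sum_apply, map_add,
    map_smul, map_sum, pairEmb_left hij hg, pairEmb_map hij hg, Mop'_eq_sum hij,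
    Module.End.mul_apply]

theorem V.sum_e_self {l : ℕ} (v : V k l) : ∑ a, e a a v = (l : ℂ) • v := by
  suffices h : (∑ a, e a a : Module.End ℂ (V k l)) = (l : ℂ) • LinearMap.id by
    have := LinearMap.congr_fun h v
    rw [LinearMap.sum_apply] at this
    exact this
  apply (V.basis k l).ext
  intro α
  rw [LinearMap.sum_apply, V.basis_apply, LinearMap.smul_apply, LinearMap.id_apply]
  simp only [V.e_self_mon]
  rw [← Finset.sum_smul]
  congr 1
  exact_mod_cast (Finsupp.degree_eq_sum α.1).symm.trans α.2

theorem hasBidegree_pairEmb (hij : i ≠ j) (hg : FreeOf i j g) (x : V k p ⊗[ℂ] V k q) :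
    HasBidegree i j p q (pairEmb i j g x) := by
  have h1 : ∑ a, TensorProduct.map (e a a) LinearMap.id x = (p : ℂ) • x := by
    induction x with
    | zero => simp
    | add x y hx hy => simp only [map_add, Finset.sum_add_distrib, hx, hy, smul_add]
    | tmul v w =>
      simp only [TensorProduct.map_tmul, LinearMap.id_apply]
      rw [← TensorProduct.sum_tmul, V.sum_e_self, TensorProduct.smul_tmul']
  have h2 : ∑ a, TensorProduct.map LinearMap.id (e a a) x = (q : ℂ) • x := by
    clear h1
    induction x with
    | zero => simp
    | add x y hx hy => simp only [map_add, Finset.sum_add_distrib, hx, hy, smul_add]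
    | tmul v w =>
      simp only [TensorProduct.map_tmul, LinearMap.id_apply]
      rw [← TensorProduct.tmul_sum, V.sum_e_self, TensorProduct.tmul_smul]
  constructor
  · rw [← map_smul, ← h1, map_sum, colE, LinearMap.sum_apply]
    exact Finset.sum_congr rfl fun a _ => (pairEmb_left hij hg a a x).symm
  · rw [← map_smul, ← h2, map_sum, colE, LinearMap.sum_apply]
    exact Finset.sum_congr rfl fun a _ => (pairEmb_right hij hg a a x).symm

theorem freeOf_one : FreeOf i j (1 : MvPolynomial (Fin k × Fin n) ℂ) :=
  fun _ => ⟨pderiv_one, pderiv_one⟩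

theorem pairEmb_one_injective (hij : i ≠ j) :
    Function.Injective (pairEmb i j 1 : V k p ⊗[ℂ] V k q →ₗ[ℂ] _) := by
  refine injective_of_basis_monomial ((V.basis k p).tensorProduct (V.basis k q)) _
    (fun x => x.1.1.mapDomain (colVar i) + x.2.1.mapDomain (colVar j)) ?_ ?_
  · have hi := colVar_injective2.right i (α := Fin n) (β := Fin k)
    have hj := colVar_injective2.right j (α := Fin n) (β := Fin k)
    have hne : ∀ (i j : Fin n), i ≠ j → ∀ (α : Fin k →₀ ℕ) (a : Fin k),
        α.mapDomain (colVar i) (colVar j a) = 0 := by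
      intro i j hij α a
      apply Finsupp.mapDomain_of_notMem_range
      rintro ⟨b, hb⟩
      exact hij (colVar_injective2 hb).1
    rintro ⟨α, β⟩ ⟨α', β'⟩ h
    refine Prod.ext (Subtype.ext (Finsupp.ext fun a => ?_)) (Subtype.ext (Finsupp.ext fun a => ?_))
    · have := DFunLike.congr_fun h (colVar i a)
      simpa only [Finsupp.add_apply, Finsupp.mapDomain_apply hi, hne j i hij.symm, add_zero]
        using this
    · have := DFunLike.congr_fun h (colVar j a)
      simpa only [Finsupp.add_apply, Finsupp.mapDomain_apply hj, hne i j hij, zero_add]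
        using this
  · rintro ⟨α, β⟩
    rw [Module.Basis.tensorProduct_apply, V.basis_apply, V.basis_apply, pairEmb_tmul, embV_mon,
      embV_mon, mul_one, monomial_mul, one_mul]

/-- The operator by which the `R`-matrix acts on polynomials. -/
def Rpoly (i j : Fin n) (t : ℂ) (p q : ℕ) : Module.End ℂ (MvPolynomial (Fin k × Fin n) ℂ) :=
  cfactor t p q • Bpoly i j t p q

theorem Rpoly_Mop (hij : i ≠ j) {t : ℂ} (ht : ∀ N : ℤ, t ≠ N)
    {f : MvPolynomial (Fin k × Fin n) ℂ} (hf : HasBidegree i j p q f) (a b : Fin k) :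
    Rpoly i j t p q (Mop i j t a b f) = Mop' i j t a b (Rpoly i j t p q f) := by
  rw [Rpoly, LinearMap.smul_apply, LinearMap.smul_apply, Bpoly_Mop hij ht hf, map_smul]

theorem Rpoly_Dop (hij : i ≠ j) (t : ℂ) (f : MvPolynomial (Fin k × Fin n) ℂ) (a b : Fin k) :
    Rpoly i j t p q (Dop i j a b f) = Dop i j a b (Rpoly i j t p q f) :=
  (LinearMap.congr_fun ((Dop_commute_Bpoly hij t p q a b).smul_right (cfactor t p q)).eq f).symm

theorem HasBidegree.Rpoly (hij : i ≠ j) (t : ℂ) {f : MvPolynomial (Fin k × Fin n) ℂ}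
    (hf : HasBidegree i j p q f) : HasBidegree i j p q (Rpoly i j t p q f) := by
  have h := hf.Bpoly hij t p q
  constructor
  · rw [GLDuality.Rpoly, LinearMap.smul_apply, map_smul, h.1, smul_comm]
  · rw [GLDuality.Rpoly, LinearMap.smul_apply, map_smul, h.2, smul_comm]

theorem HasBidegree.symm {f : MvPolynomial (Fin k × Fin n) ℂ}
    (hf : HasBidegree i j p q f) : HasBidegree j i q p f := ⟨hf.2, hf.1⟩

variable [NeZero k]

theorem embV_mono_single (i : Fin n) (p : ℕ) :
    embV (colVar i) (V.mono p (Finsupp.single (0 : Fin k) p)) = X (0, i) ^ p := by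
  rw [embV_apply, V.toPoly_mono (by rw [Finsupp.degree_single]), rename_monomial,
    Finsupp.mapDomain_single, X_pow_eq_monomial]
  rfl

theorem pairEmb_topVec : pairEmb i j g (topVec k p q) = topPoly i j g p q := by
  rw [topVec, pairEmb_tmul, embV_mono_single, embV_mono_single, topPoly]

theorem Rpoly_topPoly (hij : i ≠ j) {t : ℂ} (ht : ∀ N : ℤ, t ≠ N) (hg : FreeOf i j g) :
    Rpoly i j t p q (topPoly i j g p q) = topPoly i j g p q :=
  Bpoly_topPoly hij ht hg p q

/-- Unitarity of the `R`-matrix. -/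
theorem Rpoly_Rpoly (hij : i ≠ j) {t : ℂ} (ht : ∀ N : ℤ, t ≠ N) (hg : FreeOf i j g)
    (x : V k p ⊗[ℂ] V k q) :
    Rpoly j i (-t) q p (Rpoly i j t p q (pairEmb i j g x)) = pairEmb i j g x := by
  have ht' : ∀ N : ℤ, -t ≠ N := by
    intro N h
    apply ht (-N)
    push_cast
    rw [← h, neg_neg]
  let S : Submodule ℂ (V k p ⊗[ℂ] V k q) := LinearMap.eqLocus
    ((Rpoly j i (-t) q p * Rpoly i j t p q) ∘ₗ pairEmb i j g) (pairEmb i j g)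
  suffices h : S = ⊤ by
    have hx : x ∈ S := h ▸ Submodule.mem_top
    exact hx
  apply eq_top_of_topVec_mem ht
  · intro a b x hx
    have hx' : Rpoly j i (-t) q p (Rpoly i j t p q (pairEmb i j g x)) = pairEmb i j g x := hx
    change Rpoly j i (-t) q p (Rpoly i j t p q (pairEmb i j g (diagE a b x))) = _
    rw [pairEmb_diagE hij hg, Rpoly_Dop hij, Dop_comm, Rpoly_Dop hij.symm, hx']
  · intro a b x hx
    have hx' : Rpoly j i (-t) q p (Rpoly i j t p q (pairEmb i j g x)) = pairEmb i j g x := hx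
    change Rpoly j i (-t) q p (Rpoly i j t p q (pairEmb i j g (yangM t a b x))) = _
    have hf := hasBidegree_pairEmb hij hg x
    -- After the first R-matrix the target action for (i, j, t) is rewritten as the source action
    -- for (j, i, -t) plus a diagonal term, so the second R-matrix can be moved through as well.
    rw [pairEmb_yangM hij hg, Rpoly_Mop hij ht hf, Mop'_eq, LinearMap.add_apply,
      LinearMap.smul_apply, map_add, map_smul, Rpoly_Mop hij.symm ht' (hf.Rpoly hij t).symm,
      Dop_comm, Rpoly_Dop hij.symm, hx', Mop_eq, Dop_comm i j]
    rfl
  · change Rpoly j i (-t) q p (Rpoly i j t p q (pairEmb i j g (topVec k p q))) = _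
    rw [pairEmb_topVec, Rpoly_topPoly hij ht hg, topPoly_symm, Rpoly_topPoly hij.symm ht' hg.symm]

theorem V.isHighestWeightVector_mono (l : ℕ) :
    IsHighestWeightVector (V.mono l (Finsupp.single (0 : Fin k) l)) := by
  refine ⟨?_, ?_, ?_⟩
  · intro h
    have h1 := congrArg V.toPoly h
    rw [V.toPoly_mono (Finsupp.degree_single _ _), map_zero, monomial_eq_zero] at h1
    exact one_ne_zero h1
  · intro a b hab
    have hb : b ≠ 0 := fun h => by
      subst h
      exact absurd hab (Fin.not_lt_zero a)
    rw [e_mono, Finsupp.single_eq_of_ne hb, Nat.cast_zero, zero_smul]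
  · intro a
    rw [e_mono]
    by_cases ha : a = 0
    · subst ha
      by_cases hl : l = 0
      · simp [hl]
      · rw [tsub_add_cancel_of_le (by rw [Finsupp.single_le_iff]; simp; omega)]
        simp
    · rw [Finsupp.single_eq_of_ne ha, if_neg (by rwa [Fin.val_eq_zero_iff])]
      simp

/-- The weight (l, 0, …, 0) leaves room for the single monomial x_1^l. -/
theorem V.eq_smul_of_isHighestWeightVector {l : ℕ} {v : V k l} (hv : IsHighestWeightVector v) :
    ∃ c : ℂ, c ≠ 0 ∧ v = c • V.mono l (Finsupp.single (0 : Fin k) l) := by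
  have h : v = coeff (Finsupp.single (0 : Fin k) l) (V.toPoly v) •
      V.mono l (Finsupp.single (0 : Fin k) l) := by
    apply V.toPoly_injective
    rw [map_smul, V.toPoly_mono (Finsupp.degree_single _ _), smul_monomial, smul_eq_mul, mul_one]
    ext d
    rw [coeff_monomial]
    split_ifs with hd
    · rw [hd]
    · by_contra hne
      apply hd
      ext a
      have h1 := congrArg (coeff d) (congrArg V.toPoly (hv.2.2 a))
      rw [V.toPoly_e, coeff_xd_self, map_smul, coeff_smul, smul_eq_mul] at h1
      have h2 := mul_right_cancel₀ hne h1
      by_cases ha : a = 0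
      · subst ha
        simp only [Fin.val_zero, if_true, Nat.cast_inj] at h2
        simp [h2]
      · rw [if_neg (by rwa [Fin.val_eq_zero_iff])] at h2
        rw [Finsupp.single_eq_of_ne ha]
        exact_mod_cast h2.symm
  refine ⟨_, ?_, h⟩
  intro h0
  rw [h0, zero_smul] at h
  exact hv.1 h

/-- Both sides intertwine the same generators and agree on the cyclic vector. This gives the
uniqueness of the R-matrix and, for general `g`, its action inside a longer tensor product. -/
theorem IsRMatrix.pairEmb_apply {t : ℂ} {R : Module.End ℂ (V k p ⊗[ℂ] V k q)} (hR : IsRMatrix t R)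
    (hij : i ≠ j) (ht : ∀ N : ℤ, t ≠ N) (hg : FreeOf i j g) (x : V k p ⊗[ℂ] V k q) :
    pairEmb i j g (R x) = Rpoly i j t p q (pairEmb i j g x) := by
  obtain ⟨h1, h2, h3⟩ := hR
  let S : Submodule ℂ (V k p ⊗[ℂ] V k q) := LinearMap.eqLocus
    (pairEmb i j g ∘ₗ R) (Rpoly i j t p q ∘ₗ pairEmb i j g)
  suffices h : S = ⊤ by
    have hx : x ∈ S := h ▸ Submodule.mem_top
    exact hx
  apply eq_top_of_topVec_mem ht
  · intro a b x hx
    have hx' : pairEmb i j g (R x) = Rpoly i j t p q (pairEmb i j g x) := hx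
    have hc : R (diagE a b x) = diagE a b (R x) := LinearMap.congr_fun (h1 a b) x
    change pairEmb i j g (R (diagE a b x)) = Rpoly i j t p q (pairEmb i j g (diagE a b x))
    rw [hc, pairEmb_diagE hij hg, hx', pairEmb_diagE hij hg, Rpoly_Dop hij]
  · intro a b x hx
    have hx' : pairEmb i j g (R x) = Rpoly i j t p q (pairEmb i j g x) := hx
    have hc : R (yangM t a b x) = yangM' t a b (R x) := LinearMap.congr_fun (h2 a b) x
    change pairEmb i j g (R (yangM t a b x)) = Rpoly i j t p q (pairEmb i j g (yangM t a b x))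
    rw [hc, pairEmb_yangM' hij hg, hx', pairEmb_yangM hij hg,
      Rpoly_Mop hij ht (hasBidegree_pairEmb hij hg x)]
  · change pairEmb i j g (R (topVec k p q)) = Rpoly i j t p q (pairEmb i j g (topVec k p q))
    have hc : R (topVec k p q) = topVec k p q :=
      h3 _ _ (V.isHighestWeightVector_mono p) (V.isHighestWeightVector_mono q)
    rw [hc, pairEmb_topVec, Rpoly_topPoly hij ht hg]

/-- The vectors whose image stays in the range form a subspace stable under the generators and
containing the cyclic vector; hence the polynomial operator descends to V_p ⊗ V_q. -/
theorem exists_pairEmb_eq_Rpoly (hij : i ≠ j) {t : ℂ} (ht : ∀ N : ℤ, t ≠ N)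
    (x : V k p ⊗[ℂ] V k q) :
    ∃ y : V k p ⊗[ℂ] V k q, pairEmb i j 1 y = Rpoly i j t p q (pairEmb i j 1 x) := by
  let S : Submodule ℂ (V k p ⊗[ℂ] V k q) := (LinearMap.range (pairEmb (p := p) (q := q) i j 1)).comap
    (Rpoly i j t p q ∘ₗ pairEmb i j 1)
  suffices h : S = ⊤ by
    have hx : x ∈ S := h ▸ Submodule.mem_top
    exact hx
  apply eq_top_of_topVec_mem ht
  · rintro a b x ⟨y, hy⟩
    refine ⟨diagE a b y, ?_⟩
    rw [LinearMap.comp_apply] at hy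
    rw [LinearMap.comp_apply, pairEmb_diagE hij freeOf_one, hy, pairEmb_diagE hij freeOf_one,
      Rpoly_Dop hij]
  · rintro a b x ⟨y, hy⟩
    refine ⟨yangM' t a b y, ?_⟩
    rw [LinearMap.comp_apply] at hy
    rw [LinearMap.comp_apply, pairEmb_yangM' hij freeOf_one, hy, pairEmb_yangM hij freeOf_one,
      Rpoly_Mop hij ht (hasBidegree_pairEmb hij freeOf_one x)]
  · refine ⟨topVec k p q, ?_⟩
    rw [LinearMap.comp_apply, pairEmb_topVec, Rpoly_topPoly hij ht freeOf_one]

/-- Two columns and g = 1 suffice to transport `Rpoly` to V_p ⊗ V_q. Thus for t ∉ ℤ `rMatrix` is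
never its default value 0. -/
theorem existsUnique_isRMatrix {t : ℂ} (ht : ∀ N : ℤ, t ≠ N) :
    ∃! R : Module.End ℂ (V k p ⊗[ℂ] V k q), IsRMatrix t R := by
  have hij : (0 : Fin 2) ≠ 1 := by decide
  have hinj := pairEmb_one_injective (k := k) (p := p) (q := q) hij
  let L := pairEmb (k := k) (p := p) (q := q) (0 : Fin 2) 1 1
  let R : Module.End ℂ (V k p ⊗[ℂ] V k q) :=
    (LinearEquiv.ofInjective L hinj).symm.toLinearMap ∘ₗ
      LinearMap.codRestrict (LinearMap.range L) (Rpoly 0 1 t p q ∘ₗ L)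
        fun x => exists_pairEmb_eq_Rpoly hij ht x
  have hR : ∀ x, L (R x) = Rpoly 0 1 t p q (L x) := by
    intro x
    have := congrArg Subtype.val (LinearEquiv.apply_symm_apply (LinearEquiv.ofInjective L hinj)
      (LinearMap.codRestrict (LinearMap.range L) (Rpoly 0 1 t p q ∘ₗ L)
        (fun x => exists_pairEmb_eq_Rpoly hij ht x) x))
    exact this
  refine ⟨R, ⟨?_, ?_, ?_⟩, ?_⟩
  · intro a b
    refine LinearMap.ext fun x => hinj ?_
    change L (R (diagE a b x)) = L (diagE a b (R x))
    rw [hR, pairEmb_diagE hij freeOf_one, Rpoly_Dop hij, ← hR, pairEmb_diagE hij freeOf_one]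
  · intro a b
    refine LinearMap.ext fun x => hinj ?_
    change L (R (yangM t a b x)) = L (yangM' t a b (R x))
    rw [hR, pairEmb_yangM hij freeOf_one,
      Rpoly_Mop hij ht (hasBidegree_pairEmb hij freeOf_one x), ← hR,
      pairEmb_yangM' hij freeOf_one]
  · intro v w hv hw
    obtain ⟨c, -, rfl⟩ := V.eq_smul_of_isHighestWeightVector hv
    obtain ⟨d, -, rfl⟩ := V.eq_smul_of_isHighestWeightVector hw
    have h : R (topVec k p q) = topVec k p q := by
      apply hinj
      change L (R (topVec k p q)) = L (topVec k p q)
      rw [hR, pairEmb_topVec, Rpoly_topPoly hij ht freeOf_one]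
    rw [TensorProduct.tmul_smul, ← TensorProduct.smul_tmul', map_smul, map_smul]
    congr 2
  · intro R' hR'
    refine LinearMap.ext fun x => hinj ?_
    exact (hR'.pairEmb_apply hij ht freeOf_one x).trans (hR x).symm

theorem isRMatrix_rMatrix {t : ℂ} (ht : ∀ N : ℤ, t ≠ N) (p q : ℕ) :
    IsRMatrix t (rMatrix k p q t) := by
  have h := existsUnique_isRMatrix (k := k) (p := p) (q := q) ht
  rw [rMatrix, dif_pos h]
  exact h.choose_spec.1

end PairEmb

/-! ### The R-matrix inside a longer tensor product. -/

section Rop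

variable {k n : ℕ} {l : Fin n → ℕ} {i j : Fin n}

/-- The product of the factors other than the `i`-th and the `j`-th one. -/
def restPoly (i j : Fin n) (w : ∀ i, V k (l i)) : MvPolynomial (Fin k × Fin n) ℂ :=
  ∏ c ∈ (Finset.univ.erase i).erase j, embV (colVar c) (w c)

theorem freeOf_restPoly (i j : Fin n) (w : ∀ i, V k (l i)) : FreeOf i j (restPoly i j w) := by
  refine fun a => ⟨pderiv_prod_eq_zero _ _ fun c hc => ?_, pderiv_prod_eq_zero _ _ fun c hc => ?_⟩
  · exact pderiv_embV_eq_zero (fun b h => Finset.ne_of_mem_erase (Finset.mem_of_mem_erase hc)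
      (Prod.ext_iff.mp h).2) _
  · exact pderiv_embV_eq_zero (fun b h => Finset.ne_of_mem_erase hc (Prod.ext_iff.mp h).2) _

theorem emb_tprod_eq_pairEmb (hij : i ≠ j) (w : ∀ i, V k (l i)) :
    emb l colVar (PiTensorProduct.tprod ℂ w) =
      pairEmb i j (restPoly i j w) (w i ⊗ₜ[ℂ] w j) := by
  rw [emb_tprod, pairEmb_tmul, ← Finset.mul_prod_erase _ _ (Finset.mem_univ i),
    ← Finset.mul_prod_erase _ _ (Finset.mem_erase.mpr ⟨hij.symm, Finset.mem_univ j⟩), restPoly,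
    mul_assoc]

theorem emb_twoSlot (hij : i ≠ j) (A : Module.End ℂ (V k (l i) ⊗[ℂ] V k (l j)))
    (w : ∀ i, V k (l i)) :
    emb l colVar (twoSlot i j A (PiTensorProduct.tprod ℂ w)) =
      pairEmb i j (restPoly i j w) (A (w i ⊗ₜ[ℂ] w j)) := by
  -- By linearity it is enough to treat operators f ⊗ g; in finite dimension these span all
  -- endomorphisms of V ⊗ W.
  obtain ⟨B, rfl⟩ := (homTensorHomEquiv ℂ (V k (l i)) (V k (l j)) (V k (l i))
    (V k (l j))).surjective A
  rw [twoSlot, LinearEquiv.symm_apply_apply]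
  induction B with
  | zero => simp
  | add x y hx hy => simp only [map_add, LinearMap.add_apply, hx, hy]
  | tmul f g =>
    rw [homTensorHomEquiv_apply, TensorProduct.homTensorHomMap_apply, TensorProduct.lift.tmul,
      TensorProduct.map_tmul, LinearMap.compl₁₂_apply, LinearMap.mul_apply', Module.End.mul_apply,
      slot_tprod, slot_tprod, emb_tprod_eq_pairEmb hij, Function.update_self,
      Function.update_of_ne hij, Function.update_of_ne hij.symm, Function.update_self]
    congr 2
    refine Finset.prod_congr rfl fun c hc => ?_
    rw [Function.update_of_ne (Finset.ne_of_mem_erase (Finset.mem_of_mem_erase hc)),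
      Function.update_of_ne (Finset.ne_of_mem_erase hc)]

variable [NeZero k]

theorem emb_Rop (hij : i ≠ j) {t : ℂ} (ht : ∀ N : ℤ, t ≠ N) (w : T k l) :
    emb l colVar (Rop i j t w) = Rpoly i j t (l i) (l j) (emb l colVar w) := by
  suffices h : emb l colVar ∘ₗ Rop i j t = Rpoly i j t (l i) (l j) ∘ₗ emb l colVar from
    LinearMap.congr_fun h w
  apply T.ext_tprod
  intro w
  rw [LinearMap.comp_apply, LinearMap.comp_apply, Rop, emb_twoSlot hij, emb_tprod_eq_pairEmb hij,
    (isRMatrix_rMatrix ht _ _).pairEmb_apply hij ht (freeOf_restPoly i j w)]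

theorem Rpoly_Rpoly_emb (hij : i ≠ j) {t : ℂ} (ht : ∀ N : ℤ, t ≠ N) (w : T k l) :
    Rpoly j i (-t) (l j) (l i) (Rpoly i j t (l i) (l j) (emb l colVar w)) = emb l colVar w := by
  suffices h : (Rpoly j i (-t) (l j) (l i) * Rpoly i j t (l i) (l j)) ∘ₗ emb l colVar =
    emb l colVar from LinearMap.congr_fun h w
  apply T.ext_tprod
  intro w
  rw [LinearMap.comp_apply, emb_tprod_eq_pairEmb hij]
  exact Rpoly_Rpoly hij ht (freeOf_restPoly i j w) _

theorem neg_ne_int {t : ℂ} (ht : ∀ N : ℤ, t ≠ N) : ∀ N : ℤ, -t ≠ N := by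
  intro N h
  apply ht (-N)
  push_cast
  rw [← h, neg_neg]

theorem Rop_mul_Rop (hij : i ≠ j) {t : ℂ} (ht : ∀ N : ℤ, t ≠ N) :
    (Rop j i (-t) * Rop i j t : Module.End ℂ (T k l)) = 1 := by
  refine LinearMap.ext fun w => emb_injective (l := l) colVar_injective2 ?_
  rw [Module.End.mul_apply, emb_Rop hij.symm (neg_ne_int ht), emb_Rop hij ht,
    Rpoly_Rpoly_emb hij ht, Module.End.one_apply]

theorem isUnit_Rop (hij : i ≠ j) {t : ℂ} (ht : ∀ N : ℤ, t ≠ N) :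
    IsUnit (Rop i j t : Module.End ℂ (T k l)) := by
  have h := Rop_mul_Rop (l := l) (k := k) hij.symm (neg_ne_int ht)
  rw [neg_neg] at h
  exact ⟨⟨Rop i j t, Rop j i (-t), h, Rop_mul_Rop hij ht⟩, rfl⟩

end Rop

/-! ### Functions of diagonalizable operators -/

theorem repr_apply_of_eigen {κ W : Type*} [AddCommGroup W] [Module ℂ W] (b : Module.Basis κ ℂ W)
    {A : Module.End ℂ W} {μ : κ → ℂ} (h : ∀ x, A (b x) = μ x • b x) (w : W) (x : κ) :
    b.repr (A w) x = μ x * b.repr w x := by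
  classical
  have h1 : b.coord x ∘ₗ A = μ x • b.coord x := by
    apply b.ext
    intro y
    rw [LinearMap.comp_apply, h, map_smul, LinearMap.smul_apply, Module.Basis.coord_apply,
      Module.Basis.repr_self, Finsupp.single_apply, smul_eq_mul, smul_eq_mul]
    split_ifs with hxy
    · rw [hxy]
    · simp
  exact LinearMap.congr_fun h1 w

/-- An eigenbasis provides the unique operator, so the default value 0 is not used. On a joint
eigenvector `w` it acts by f(ν), because every basis vector occurring in `w` has the eigenvalues of
`w`. -/
theorem diagFun_apply {ι κ W : Type*} [AddCommGroup W] [Module ℂ W] (A : ι → Module.End ℂ W)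
    (f : (ι → ℂ) → ℂ) (b : Module.Basis κ ℂ W) (μ : κ → ι → ℂ)
    (h : ∀ x j, A j (b x) = μ x j • b x) {ν : ι → ℂ} {w : W} (hw : ∀ j, A j w = ν j • w) :
    diagFun A f w = f ν • w := by
  have hex : ∃! B : Module.End ℂ W, ∀ (μ : ι → ℂ) (w : W), (∀ j, A j w = μ j • w) →
      B w = f μ • w := by
    refine ⟨b.constr ℂ fun x => f (μ x) • b x, ?_, ?_⟩
    · intro ν w hw
      apply b.repr.injective
      ext x
      have h2 := repr_apply_of_eigen b (A := b.constr ℂ fun x => f (μ x) • b x)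
        (fun x => b.constr_basis ℂ _ x) w x
      rw [h2, map_smul, Finsupp.smul_apply, smul_eq_mul]
      by_cases h0 : b.repr w x = 0
      · rw [h0, mul_zero, mul_zero]
      · congr 2
        funext j
        have h3 := repr_apply_of_eigen b (fun x => h x j) w x
        rw [hw, map_smul, Finsupp.smul_apply, smul_eq_mul] at h3
        exact (mul_right_cancel₀ h0 h3).symm
    · intro B hB
      apply b.ext
      intro x
      rw [hB (μ x) (b x) (h x), Module.Basis.constr_basis]
  rw [diagFun, dif_pos hex]
  exact hex.choose_spec.1 ν w hw

theorem isUnit_of_range {W : Type*} [AddCommGroup W] [Module ℂ W] [Module.Finite ℂ W] {κ : Type*}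
    (b : Module.Basis κ ℂ W) {A : Module.End ℂ W} (h : ∀ x, ∃ w, A w = b x) : IsUnit A := by
  rw [LinearMap.isUnit_iff_range_eq_top, eq_top_iff, ← b.span_eq, Submodule.span_le]
  rintro _ ⟨x, rfl⟩
  exact h x

theorem inverse_apply_of_eigen {W : Type*} [AddCommGroup W] [Module ℂ W] {A : Module.End ℂ W}
    (hA : IsUnit A) {c : ℂ} (hc : c ≠ 0) {w : W} (h : A w = c • w) :
    Ring.inverse A w = c⁻¹ • w := by
  have h1 : Ring.inverse A (A w) = w := by
    rw [← Module.End.mul_apply, Ring.inverse_mul_cancel _ hA, Module.End.one_apply]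
  rw [h, map_smul] at h1
  rw [← h1, smul_smul, inv_mul_cancel₀ hc, one_smul, h1]

theorem list_prod_smul {ι W : Type*} [AddCommGroup W] [Module ℂ W] (L : List ι) (c : ι → ℂ)
    (A : ι → Module.End ℂ W) :
    (L.map fun j => c j • A j).prod = (L.map c).prod • (L.map A).prod := by
  induction L with
  | nil => simp
  | cons j L ih => simp only [List.map_cons, List.prod_cons, ih, smul_mul_smul_comm]

theorem inverse_smul {W : Type*} [AddCommGroup W] [Module ℂ W] {A : Module.End ℂ W}
    (hA : IsUnit A) {c : ℂ} (hc : c ≠ 0) : Ring.inverse (c • A) = c⁻¹ • Ring.inverse A := by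
  have h : (c • A) * (c⁻¹ • Ring.inverse A) = 1 := by
    rw [smul_mul_smul_comm, mul_inv_cancel₀ hc, one_smul, Ring.mul_inverse_cancel _ hA]
  have h' : (c⁻¹ • Ring.inverse A) * (c • A) = 1 := by
    rw [smul_mul_smul_comm, inv_mul_cancel₀ hc, one_smul, Ring.inverse_mul_cancel _ hA]
  exact Ring.inverse_unit ⟨c • A, c⁻¹ • Ring.inverse A, h, h'⟩

/-! ### The factors c^{-e_aa} on polynomials. -/

section Pow

variable {k n : ℕ} {l : Fin n → ℕ} {m : Fin k → ℕ}

theorem powNegE_mon {l : ℕ} (a : Fin k) (c : ℂ) (α : {α : Fin k →₀ ℕ // α.degree = l}) :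
    powNegE a c (V.mon α) = (c ^ (-(α.1 a : ℂ))) • V.mon α := by
  refine diagFun_apply _ (fun μ => c ^ (-μ ())) (V.basis k l) (fun α _ => (α.1 a : ℂ)) ?_
    (ν := fun _ => (α.1 a : ℂ)) fun _ => V.e_self_mon a α
  intro x _
  rw [V.basis_apply, V.e_self_mon]

/-- The operator multiplying the monomials `x^d` by `f d`. -/
def diagP {τ : Type*} (f : (τ →₀ ℕ) → ℂ) : Module.End ℂ (MvPolynomial τ ℂ) :=
  (basisMonomials τ ℂ).constr ℂ fun d => f d • monomial d 1

theorem diagP_monomial {τ : Type*} (f : (τ →₀ ℕ) → ℂ) (d : τ →₀ ℕ) :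
    diagP f (monomial d 1) = f d • monomial d 1 := by
  have h := (basisMonomials τ ℂ).constr_basis ℂ (fun d => f d • (monomial d (1 : ℂ))) d
  rwa [coe_basisMonomials] at h

theorem emb_slot_powNegE {τ : Type*} {σ : Fin n → Fin k → τ} (hσ : Function.Injective2 σ)
    (i : Fin n) (a : Fin k) (c : ℂ) (w : T k l) :
    emb l σ (slot i (powNegE a c) w) = diagP (fun d => c ^ (-(d (σ i a) : ℂ))) (emb l σ w) := by
  suffices h : emb l σ ∘ₗ slot i (powNegE a c) =
      diagP (fun d => c ^ (-(d (σ i a) : ℂ))) ∘ₗ emb l σ from LinearMap.congr_fun h w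
  apply (basisT k l).ext
  intro α
  rw [LinearMap.comp_apply, LinearMap.comp_apply, emb_basisT, diagP_monomial, expo_apply hσ,
    basisT_apply, slot_tprod, powNegE_mon, MultilinearMap.map_update_smul, map_smul,
    Function.update_eq_self, ← basisT_apply, emb_basisT]

theorem Rel.powNegE (i : Fin n) (a : Fin k) (c : ℂ) :
    Rel (slot i (powNegE a c) : Module.End ℂ (T k l))
      (slot a (GLDuality.powNegE i c) : Module.End ℂ (T n m)) :=
  Rel.of_op (emb_slot_powNegE colVar_injective2 i a c) (emb_slot_powNegE rowVar_injective2 a i c)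
    rfl

end Pow

/-! ### The operators `B_{ij}(t)` and `C_{ij}(t)` -/

section BC

variable {k n : ℕ} {l : Fin n → ℕ} {m : Fin k → ℕ}

theorem eTot_basisT (i : Fin n) (α : Idx n m) :
    eTot i i (basisT n m α) = ((∑ a, (α a).1 i : ℕ) : ℂ) • basisT n m α := by
  rw [eTot, LinearMap.sum_apply, Nat.cast_sum, Finset.sum_smul]
  refine Finset.sum_congr rfl fun a _ => ?_
  rw [basisT_apply, eAt, slot_tprod, V.e_self_mon, MultilinearMap.map_update_smul,
    Function.update_eq_self]

theorem emb_eTot_pow (i j : Fin n) (s : ℕ) (w : T n m) :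
    emb m rowVar ((eTot i j ^ s) w) = (colE i j ^ s) (emb m rowVar w) := by
  induction s with
  | zero => simp
  | succ s ih =>
    rw [pow_succ', Module.End.mul_apply, emb_row_eTot, ih, pow_succ', Module.End.mul_apply]
    rfl

theorem hasBidegree_emb {i j : Fin n} {p q : ℕ} {w : T n m} (hp : eTot i i w = (p : ℂ) • w)
    (hq : eTot j j w = (q : ℂ) • w) : HasBidegree i j p q (emb m rowVar w) := by
  constructor
  · rw [← map_smul, ← hp, emb_row_eTot]; rfl
  · rw [← map_smul, ← hq, emb_row_eTot]; rfl

/-- Each application lowers the degree in column j by one, and this degree never exceeds the total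
degree. Nilpotency makes the `finsum` in `Bop` a genuine finite sum. -/
theorem eTot_pow_eq_zero {i j : Fin n} (hij : i ≠ j) {s : ℕ} (hs : ∑ a, m a < s) :
    (eTot i j ^ s : Module.End ℂ (T n m)) = 0 := by
  apply (basisT n m).ext
  intro α
  apply emb_injective (l := m) rowVar_injective2
  rw [emb_eTot_pow, LinearMap.zero_apply, map_zero]
  refine (hasBidegree_emb (eTot_basisT i α) (eTot_basisT j α)).pow_eq_zero hij
    (lt_of_le_of_lt (Finset.sum_le_sum fun a _ => ?_) hs)
  exact (Finsupp.le_degree j (α a).1).trans_eq (α a).2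

theorem sub_ne_int {t : ℂ} (ht : ∀ N : ℤ, t ≠ N) (p q r : ℕ) : t - r - p + q ≠ 0 := by
  intro h
  apply ht (r + p - q)
  push_cast
  linear_combination h

/-- All eigenvalues are nonzero since t ∉ ℤ, so `Ring.inverse` in `Bop` is the true inverse. -/
theorem isUnit_shift {i j : Fin n} {t : ℂ} (ht : ∀ N : ℤ, t ≠ N) (r : ℕ) :
    IsUnit (((r + 1 : ℕ) : ℂ) •
      ((t - ((r + 1 : ℕ) : ℂ)) • 1 - eTot i i + eTot j j : Module.End ℂ (T n m))) := by
  refine isUnit_of_range (basisT n m) fun α => ?_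
  have hc : ((r + 1 : ℕ) : ℂ) * (t - ((r + 1 : ℕ) : ℂ) - (∑ a, (α a).1 i : ℕ)
      + (∑ a, (α a).1 j : ℕ)) ≠ 0 :=
    mul_ne_zero (Nat.cast_ne_zero.mpr (Nat.succ_ne_zero r)) (sub_ne_int ht _ _ _)
  refine ⟨(((r + 1 : ℕ) : ℂ) * (t - ((r + 1 : ℕ) : ℂ) - (∑ a, (α a).1 i : ℕ)
      + (∑ a, (α a).1 j : ℕ)))⁻¹ • basisT n m α, ?_⟩
  rw [map_smul, LinearMap.smul_apply, LinearMap.add_apply, LinearMap.sub_apply,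
    LinearMap.smul_apply, Module.End.one_apply, eTot_basisT, eTot_basisT, ← sub_smul, ← add_smul,
    smul_smul, smul_smul, mul_assoc, inv_mul_cancel₀ hc, one_smul]

theorem prod_inverse_apply {i j : Fin n} {t : ℂ} (ht : ∀ N : ℤ, t ≠ N) {p q : ℕ} {w : T n m}
    (hp : eTot i i w = (p : ℂ) • w) (hq : eTot j j w = (q : ℂ) • w) (s : ℕ) :
    ((List.range s).map fun r => Ring.inverse (((r + 1 : ℕ) : ℂ) •
      ((t - ((r + 1 : ℕ) : ℂ)) • 1 - eTot i i + eTot j j : Module.End ℂ (T n m)))).prod w =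
      bcoeff t p q s • w := by
  induction s with
  | zero => simp [bcoeff]
  | succ s ih =>
    rw [List.range_succ, List.map_append, List.prod_append, List.map_singleton,
      List.prod_singleton, Module.End.mul_apply,
      inverse_apply_of_eigen (isUnit_shift ht s)
        (mul_ne_zero (Nat.cast_ne_zero.mpr (Nat.succ_ne_zero s)) (sub_ne_int ht p q (s + 1))),
      map_smul, ih, smul_smul, bcoeff, bcoeff, Finset.prod_range_succ, mul_comm]
    rw [LinearMap.smul_apply, LinearMap.add_apply, LinearMap.sub_apply,
      LinearMap.smul_apply, Module.End.one_apply, hp, hq, ← sub_smul, ← add_smul, smul_smul]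

theorem emb_Bop {i j : Fin n} (hij : i ≠ j) {t : ℂ} (ht : ∀ N : ℤ, t ≠ N) {p q : ℕ} {w : T n m}
    (hp : eTot i i w = (p : ℂ) • w) (hq : eTot j j w = (q : ℂ) • w) :
    emb m rowVar (Bop i j t w) = Bpoly i j t p q (emb m rowVar w) := by
  set S := ∑ a, m a
  -- The bound S + q is generous: it covers the support, and after the index shift it contains all s
  -- ≤ q, beyond which the terms vanish on `w`.
  rw [Bop, finsum_eq_sum_of_support_subset (s := Finset.range (S + q))]
  · have hterm : ∀ s, emb m rowVar ((eTot j i ^ s * eTot i j ^ s *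
        ((List.range s).map fun r => Ring.inverse (((r + 1 : ℕ) : ℂ) •
          ((t - ((r + 1 : ℕ) : ℂ)) • 1 - eTot i i + eTot j j : Module.End ℂ (T n m)))).prod :
            Module.End ℂ (T n m)) w) =
        bcoeff t p q s • (colE j i ^ s) ((colE i j ^ s) (emb m rowVar w)) := by
      intro s
      rw [Module.End.mul_apply, prod_inverse_apply ht hp hq, map_smul, map_smul,
        Module.End.mul_apply, emb_eTot_pow, emb_eTot_pow]
    rw [LinearMap.add_apply, Module.End.one_apply, LinearMap.sum_apply, map_add, map_sum,
      Finset.sum_congr rfl fun s _ => hterm (s + 1), Bpoly_apply]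
    have h0 : emb m rowVar w =
        bcoeff t p q 0 • (colE j i ^ 0) ((colE i j ^ 0) (emb m rowVar w)) := by
      simp [bcoeff]
    conv_lhs => rw [h0, add_comm]
    simp only [pow_zero, Module.End.one_apply]
    have h1 := Finset.sum_range_succ'
      (fun s => bcoeff t p q s • (colE j i ^ s) ((colE i j ^ s) (emb m rowVar w))) (S + q)
    simp only [pow_zero, Module.End.one_apply] at h1
    have hb : bcoeff t p q 0 = 1 := by simp [bcoeff]
    rw [hb] at h1
    simp only [hb, one_smul] at h1 ⊢
    rw [← h1]
    symm
    apply Finset.sum_subset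
    · intro s hs
      rw [Finset.mem_range] at hs ⊢
      omega
    · intro s _ hs
      rw [Finset.mem_range] at hs
      rw [(hasBidegree_emb hp hq).pow_eq_zero hij (by omega), map_zero, smul_zero]
  · intro s hs
    rw [Finset.coe_range, Set.mem_Iio]
    by_contra hlt
    apply hs
    change eTot j i ^ (s + 1) * eTot i j ^ (s + 1) * _ = 0
    rw [eTot_pow_eq_zero hij (by omega), mul_zero, zero_mul]

/-- Both operators are realized by the same series in E_{ij} and E_{ji}: for R by cyclicity, for B
by evaluating its denominators on a vector with weights `l i`, `l j`. -/
theorem Rel.Rop_Bop [NeZero k] {i j : Fin n} (hij : i ≠ j) {t : ℂ} (ht : ∀ N : ℤ, t ≠ N) :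
    Rel ((cfactor t (l i) (l j))⁻¹ • Rop i j t : Module.End ℂ (T k l))
      (Bop i j t : Module.End ℂ (T n m)) := by
  intro w w' h
  have hw := mem_weightSpace.mp (mem_weightSpace_of_emb_eq' h)
  rw [emb_Bop hij ht (hw i) (hw j), LinearMap.smul_apply, map_smul, emb_Rop hij ht, Rpoly,
    LinearMap.smul_apply, smul_smul, inv_mul_cancel₀ (cfactor_ne_zero ht _ _), one_smul, h]

theorem basisT_mem_weightSpace (α : Idx n m) :
    basisT n m α ∈ weightSpace n m fun i => ∑ a, (α a).1 i :=
  mem_weightSpace.mpr fun i => eTot_basisT i α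

/-- A basis tensor of weight `l'` also lies in the gl_k realization with column degrees `l'`, where
R is invertible. There B_{ij}(t) B_{ji}(-t) is a nonzero scalar; the scalar and `l'` depend on the
basis tensor. -/
theorem isUnit_Bop [NeZero k] {i j : Fin n} (hij : i ≠ j) {t : ℂ} (ht : ∀ N : ℤ, t ≠ N) :
    IsUnit (Bop i j t : Module.End ℂ (T n m)) := by
  refine isUnit_of_range (basisT n m) fun α => ?_
  set l' : Fin n → ℕ := fun i => ∑ a, (α a).1 i
  obtain ⟨w, hw⟩ := exists_emb_eq_of_mem_weightSpace' (basisT_mem_weightSpace α)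
  have h1 := Rel.Rop_Bop (l := l') (m := m) hij.symm (neg_ne_int ht) _ _ hw
  have h2 := Rel.Rop_Bop (l := l') (m := m) hij ht _ _ h1
  set c := (cfactor t (l' i) (l' j))⁻¹ * (cfactor (-t) (l' j) (l' i))⁻¹ with hc
  have hc0 : c ≠ 0 := mul_ne_zero (inv_ne_zero (cfactor_ne_zero ht _ _))
    (inv_ne_zero (cfactor_ne_zero (neg_ne_int ht) _ _))
  refine ⟨c⁻¹ • Bop j i (-t) (basisT n m α), emb_injective (l := m) rowVar_injective2 ?_⟩
  have h3 := Rop_mul_Rop (k := k) (l := l') hij.symm (neg_ne_int ht)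
  rw [neg_neg] at h3
  have h4 : Rop i j t (Rop j i (-t) w) = w := LinearMap.congr_fun h3 w
  rw [LinearMap.smul_apply, LinearMap.smul_apply, map_smul (Rop i j t), h4, smul_smul, ← hc,
    map_smul, hw] at h2
  rw [map_smul, map_smul, ← h2, smul_smul, inv_mul_cancel₀ hc0, one_smul]

theorem Cop_apply (i j : Fin n) (t : ℂ) {w : T n m} {ν : Fin n → ℂ}
    (hw : ∀ i, eTot i i w = ν i • w) : Cop i j t w = cfactor t (ν i) (ν j) • w :=
  diagFun_apply (fun c : Fin n => eTot c c) _ (basisT n m)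
    (fun α i => ((∑ a, (α a).1 i : ℕ) : ℂ)) (fun α i => eTot_basisT i α) hw

theorem isUnit_Cop (i j : Fin n) {t : ℂ} (ht : ∀ N : ℤ, t ≠ N) :
    IsUnit (Cop i j t : Module.End ℂ (T n m)) := by
  refine isUnit_of_range (basisT n m) fun α => ?_
  have h := Cop_apply i j t fun i => eTot_basisT i α
  refine ⟨(cfactor t (∑ a, (α a).1 i : ℕ) (∑ a, (α a).1 j : ℕ))⁻¹ • basisT n m α, ?_⟩
  rw [map_smul, h, smul_smul, inv_mul_cancel₀ (cfactor_ne_zero ht _ _), one_smul]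

theorem Rel.Cop (i j : Fin n) (t : ℂ) :
    Rel (cfactor t (l i) (l j) • (1 : Module.End ℂ (T k l)))
      (Cop i j t : Module.End ℂ (T n m)) := by
  intro w w' h
  have hw := mem_weightSpace.mp (mem_weightSpace_of_emb_eq' h)
  rw [Cop_apply i j t (ν := fun i => (l i : ℂ)) hw, LinearMap.smul_apply, Module.End.one_apply,
    map_smul, map_smul, h]

theorem Rel.inverse_Cop (i j : Fin n) {t : ℂ} (ht : ∀ N : ℤ, t ≠ N) :
    Rel ((cfactor t (l i) (l j))⁻¹ • (1 : Module.End ℂ (T k l)))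
      (Ring.inverse (GLDuality.Cop i j t) : Module.End ℂ (T n m)) := by
  have hc := cfactor_ne_zero ht (l i) (l j)
  have h := (Rel.Cop (l := l) (m := m) i j t).inverse (IsUnit.smul (Units.mk0 _ hc) isUnit_one)
    (isUnit_Cop i j ht)
  rwa [inverse_smul isUnit_one hc, Ring.inverse_one] at h

end BC

/-! ### The difference operators -/

section Difference

variable {k n : ℕ} [NeZero k] {l : Fin n → ℕ} {m : Fin k → ℕ}

theorem Rel.Kop (κ : ℂ) (i : Fin n) {z : Fin n → ℂ} (lam : Fin k → ℂ)
    (h1 : ∀ j, i < j → ∀ N : ℤ, z i - z j ≠ N) (h2 : ∀ j, j < i → ∀ N : ℤ, z j - z i - κ ≠ N) :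
    Rel (Kop κ i z lam : Module.End ℂ (T k l))
      (Nop κ i z * Xop κ i lam z : Module.End ℂ (T n m)) := by
  set L₁ := (List.finRange n).filter (fun j => i < j)
  set L₂ := (List.finRange n).filter (fun j => j < i)
  have hL₁ : ∀ j ∈ L₁, i < j := fun j hj => by simpa [L₁] using hj
  have hL₂ : ∀ j ∈ L₂, j < i := fun j hj => by simpa [L₂] using hj
  -- On common polynomials C acts by scalars. N contributes the product of all `c₂` and `c₁`, while
  -- X is K divided by it: the factors with j > i occur inverted, those with j < i directly.
  let c₁ : Fin n → ℂ := fun j => (cfactor (z i - z j) (l i) (l j))⁻¹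
  let c₂ : Fin n → ℂ := fun j => cfactor (z j - z i - κ) (l j) (l i)
  have hc₁ : (L₁.map c₁).prod ≠ 0 := by
    rw [Ne, List.prod_eq_zero_iff, List.mem_map]
    rintro ⟨j, hj, h⟩
    exact inv_ne_zero (cfactor_ne_zero (h1 j (hL₁ j hj)) _ _) h
  have hc₂ : (L₂.map c₂).prod ≠ 0 := by
    rw [Ne, List.prod_eq_zero_iff, List.mem_map]
    rintro ⟨j, hj, h⟩
    exact cfactor_ne_zero (h2 j (hL₂ j hj)) _ _ h
  have hN : Rel (((L₂.map c₂).prod * (L₁.map c₁).prod) • (1 : Module.End ℂ (T k l)))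
      (Nop κ i z : Module.End ℂ (T n m)) := by
    have e1 := Rel.list_prod (m := m) L₂ (A := fun j => c₂ j • (1 : Module.End ℂ (T k l)))
      fun j _ => Rel.Cop j i (z j - z i - κ)
    have e2 := Rel.list_prod (m := m) L₁ (A := fun j => c₁ j • (1 : Module.End ℂ (T k l)))
      fun j hj => Rel.inverse_Cop i j (h1 j (hL₁ j hj))
    have e3 := e1.mul e2
    rw [list_prod_smul, list_prod_smul, smul_mul_smul_comm] at e3
    simp only [List.map_const', List.prod_replicate, one_pow, mul_one] at e3
    exact e3
  have hX : Rel (((L₂.map c₂).prod * (L₁.map c₁).prod)⁻¹ • GLDuality.Kop κ i z lam :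
      Module.End ℂ (T k l)) (Xop κ i lam z : Module.End ℂ (T n m)) := by
    have e1 := Rel.list_prod (k := k) (l := l) (m := m) L₁.reverse fun j hj =>
      Rel.Rop_Bop (hL₁ j (List.mem_reverse.mp hj)).ne (h1 j (hL₁ j (List.mem_reverse.mp hj)))
    have e2 := Rel.list_prod (k := k) (l := l) (m := m) L₂ fun j hj =>
      Rel.Rop_Bop (hL₂ j hj).ne (h2 j (hL₂ j hj))
    have e3 := Rel.list_prod (l := l) (m := m) (List.finRange k) fun a _ =>
      Rel.powNegE i a (lam a)
    have u1 : IsUnit (L₁.reverse.map fun j =>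
        (Rop i j (z i - z j) : Module.End ℂ (T k l))).prod := by
      refine List.prod_isUnit fun A hA => ?_
      obtain ⟨j, hj, rfl⟩ := List.mem_map.mp hA
      have hj' := List.mem_reverse.mp hj
      exact isUnit_Rop (hL₁ j hj').ne (h1 j (hL₁ j hj'))
    have u2 : IsUnit (L₁.reverse.map fun j =>
        (Bop i j (z i - z j) : Module.End ℂ (T n m))).prod := by
      refine List.prod_isUnit fun A hA => ?_
      obtain ⟨j, hj, rfl⟩ := List.mem_map.mp hA
      have hj' := List.mem_reverse.mp hj
      exact isUnit_Bop (k := k) (hL₁ j hj').ne (h1 j (hL₁ j hj'))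
    rw [list_prod_smul] at e1 e2
    have hr : (L₁.reverse.map c₁).prod = (L₁.map c₁).prod := by
      rw [List.map_reverse, List.prod_reverse]
    have hi : (L₂.map fun j => (cfactor (z j - z i - κ) (l j) (l i))⁻¹).prod =
        (L₂.map c₂).prod⁻¹ := by
      change _ = invMonoidWithZeroHom (L₂.map c₂).prod
      rw [map_list_prod, List.map_map]
      rfl
    change Rel ((L₁.reverse.map c₁).prod • _) _ at e1
    rw [hr] at e1
    rw [hi] at e2
    have e4 := ((e1.inverse (IsUnit.smul (Units.mk0 _ hc₁) u1) u2).mul e3).mul e2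
    rw [inverse_smul u1 hc₁, smul_mul_assoc, smul_mul_smul_comm, ← mul_inv_rev] at e4
    exact e4
  have h := hN.mul hX
  rwa [smul_mul_smul_comm, one_mul, mul_inv_cancel₀ (mul_ne_zero hc₂ hc₁), one_smul] at h

theorem conjAt_qKZ {φ : weightSpace k l m ≃ₗ[ℂ] weightSpace n m l} (hφ : IsScalar φ) (κ : ℂ)
    (u : (Fin n → ℂ) → (Fin k → ℂ) → weightSpace k l m) {z : Fin n → ℂ} (lam : Fin k → ℂ)
    (i : Fin n) (h1 : ∀ j, i < j → ∀ N : ℤ, z i - z j ≠ N)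
    (h2 : ∀ j, j < i → ∀ N : ℤ, z j - z i - κ ≠ N) :
    ConjAt φ (qKZ κ i) (normQDD κ i) u z lam :=
  conjAt_of_rel hφ (Rel.Kop κ i lam h1 h2) (z' := Function.update z i (z i + κ)) (lam' := lam)
    rfl rfl

end Difference

/-! ### The vectors `v_d` -/

section Basis

variable {k : ℕ}

variable [NeZero k]

theorem e_pow_mono {l : ℕ} {a : Fin k} (ha : a ≠ 0) (s : ℕ) (β : Fin k →₀ ℕ) :
    (e a 0 ^ s : Module.End ℂ (V k l)) (V.mono l β) = ((β 0).descFactorial s : ℂ) •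
      V.mono l (β - Finsupp.single 0 s + Finsupp.single a s) := by
  induction s with
  | zero => simp
  | succ s ih =>
    rw [pow_succ', Module.End.mul_apply, ih, map_smul, e_mono, smul_smul,
      Nat.descFactorial_succ, Nat.cast_mul, mul_comm ((β 0 - s : ℕ) : ℂ)]
    have h : (β - Finsupp.single 0 s + Finsupp.single a s : Fin k →₀ ℕ) 0 = β 0 - s := by
      simp [ha]
    rw [h]
    congr 2
    ext b
    by_cases h1 : b = 0
    · subst h1
      simp [ha]
      omega
    · by_cases h2 : b = a
      · subst h2
        simp [h1]
        omega
      · simp [h1, h2]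

theorem list_prod_e_pow_mono {l : ℕ} (d : Fin k → ℕ) (L : List (Fin k)) (hL : ∀ a ∈ L, a ≠ 0)
    (β : Fin k →₀ ℕ) :
    (L.map fun a => ((d a).factorial : ℂ)⁻¹ • (e a 0 : Module.End ℂ (V k l)) ^ d a).prod
        (V.mono l β) =
      (((β 0).descFactorial (L.map d).sum : ℂ) * (L.map fun a => ((d a).factorial : ℂ)⁻¹).prod) •
        V.mono l (β - Finsupp.single 0 (L.map d).sum
          + (L.map fun a => Finsupp.single a (d a)).sum) := by
  induction L with
  | nil => simp
  | cons a L ih =>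
    have ha : a ≠ 0 := hL a List.mem_cons_self
    have hL' : ∀ b ∈ L, b ≠ 0 := fun b hb => hL b (List.mem_cons_of_mem _ hb)
    have hzero : ∀ L : List (Fin k), (∀ b ∈ L, b ≠ 0) →
        (L.map fun a => Finsupp.single a (d a)).sum 0 = 0 := by
      intro L hL
      induction L with
      | nil => simp
      | cons b L ih =>
        rw [List.map_cons, List.sum_cons, Finsupp.add_apply,
          ih fun c hc => hL c (List.mem_cons_of_mem _ hc),
          Finsupp.single_eq_of_ne (hL b List.mem_cons_self).symm]
    simp only [List.map_cons, List.prod_cons, List.sum_cons]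
    rw [Module.End.mul_apply, ih hL', map_smul, LinearMap.smul_apply, e_pow_mono ha]
    set S := (L.map d).sum
    set γ := (L.map fun a => Finsupp.single a (d a)).sum with hγ
    have hγ0 : γ 0 = 0 := hzero L hL'
    have h0 : (β - Finsupp.single 0 S + γ : Fin k →₀ ℕ) 0 = β 0 - S := by simp [hγ0]
    have hd := Nat.descFactorial_mul_descFactorial (n := β 0) (Nat.le_add_left S (d a))
    rw [Nat.add_sub_cancel] at hd
    rw [h0, smul_smul, smul_smul, ← hd]
    congr 1
    · push_cast
      ring
    · congr 1
      ext b
      by_cases h1 : b = 0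
      · subst h1
        simp [hγ0, ha]
        omega
      · by_cases h2 : b = a
        · subst h2
          simp [h1]
          omega
        · simp [h1, h2]

/-- The falling factorial from the powers of `e a 0` is l!/d_0!. It supplies the missing factor
1/d_0!, so the coefficient treats all indices alike; this is the purpose of the divided powers. -/
theorem list_prod_e_pow_top {l : ℕ} (d : Fin k → ℕ) (hd : ∑ a, d a = l) :
    (((List.finRange k).filter (fun a => a ≠ 0)).map fun a =>
      ((d a).factorial : ℂ)⁻¹ • (e a 0 : Module.End ℂ (V k l)) ^ d a).prod
        (V.mono l (Finsupp.single 0 l)) =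
      ((l.factorial : ℂ) * ∏ a, ((d a).factorial : ℂ)⁻¹) •
        V.mono l (Finsupp.equivFunOnFinite.symm d) := by
  set L := (List.finRange k).filter (fun a => a ≠ 0) with hLdef
  have hL : ∀ a ∈ L, a ≠ 0 := fun a ha => by simpa [L] using ha
  have hnd : L.Nodup := (List.nodup_finRange k).filter _
  have hfs : L.toFinset = Finset.univ.erase 0 := by
    ext a; simp [L]
  rw [list_prod_e_pow_mono d L hL, ← List.sum_toFinset _ hnd, ← List.sum_toFinset _ hnd,
    ← List.prod_toFinset _ hnd, hfs, Finsupp.single_eq_same]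
  have hsum : d 0 + ∑ a ∈ Finset.univ.erase 0, d a = l := by
    rw [Finset.add_sum_erase _ _ (Finset.mem_univ _), hd]
  congr 1
  · rw [← Finset.mul_prod_erase _ _ (Finset.mem_univ (0 : Fin k)), ← mul_assoc]
    congr 1
    have h1 := Nat.factorial_mul_descFactorial
      (show ∑ a ∈ Finset.univ.erase 0, d a ≤ l by omega)
    rw [show l - ∑ a ∈ Finset.univ.erase 0, d a = d 0 by omega] at h1
    rw [← h1]
    have h2 : ((d 0).factorial : ℂ) ≠ 0 := Nat.cast_ne_zero.mpr (Nat.factorial_ne_zero _)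
    push_cast
    field_simp
  · congr 1
    ext b
    rw [Finsupp.add_apply, Finsupp.tsub_apply, Finsupp.finsetSum_apply,
      Finsupp.equivFunOnFinite_symm_apply_apply]
    by_cases h1 : b = 0
    · subst h1
      have hz : ∑ c ∈ Finset.univ.erase (0 : Fin k), Finsupp.single c (d c) 0 = 0 :=
        Finset.sum_eq_zero fun c hc =>
          Finsupp.single_eq_of_ne (Finset.ne_of_mem_erase hc).symm
      rw [hz, Finsupp.single_eq_same, Finsupp.single_eq_same]
      change l - ∑ a ∈ Finset.univ.erase 0, d a + 0 = d 0
      omega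
    · rw [Finsupp.single_eq_of_ne h1, Finsupp.single_eq_of_ne h1, Finset.sum_eq_single b]
      · simp
      · intro c _ hc
        rw [Finsupp.single_eq_of_ne hc.symm]
      · simp [h1]

variable {n : ℕ} {l : Fin n → ℕ}

/-- The index of the basis vector given by a matrix with column sums `l_i`. -/
def idxOf (d : Fin k → Fin n → ℕ) (hd : ∀ i, ∑ a, d a i = l i) : Idx k l := fun i =>
  ⟨Finsupp.equivFunOnFinite.symm fun a => d a i, by
    rw [Finsupp.degree_eq_sum]
    exact hd i⟩

/-- The only part of the coefficient depending on d is ∏ 1/d_{ai}!, which is invariant under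
transposing d. Therefore φ can be a constant multiple of the identity of polynomials. -/
theorem vVec_eq (v : ∀ i, V k (l i)) (c : Fin n → ℂ)
    (hv : ∀ i, v i = c i • V.mono (l i) (Finsupp.single 0 (l i)))
    (d : Fin k → Fin n → ℕ) (hd : ∀ i, ∑ a, d a i = l i) :
    vVec v d = ((∏ i, c i * (l i).factorial) * ∏ i, ∏ a, ((d a i).factorial : ℂ)⁻¹) •
      basisT k l (idxOf d hd) := by
  rw [vVec, basisT_apply, ← Finset.prod_mul_distrib, ← MultilinearMap.map_smul_univ]
  congr 1
  funext i
  rw [hv i, map_smul, list_prod_e_pow_top _ (hd i), smul_smul, mul_assoc]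
  congr 1
  exact V.mono_of_degree (idxOf d hd i)

end Basis

/-! ### The duality isomorphism -/

section Main

variable {k n : ℕ} {l : Fin n → ℕ} {m : Fin k → ℕ}

theorem exists_isScalar {c : ℂ} (hc : c ≠ 0) :
    ∃ φ : weightSpace k l m ≃ₗ[ℂ] weightSpace n m l,
      ∀ w, emb m rowVar (φ w : T n m) = c • emb l colVar (w : T k l) := by
  let L := emb l colVar ∘ₗ (weightSpace k l m).subtype
  let L' := emb m rowVar ∘ₗ (weightSpace n m l).subtype
  have hL : Function.Injective L :=
    (emb_injective (l := l) colVar_injective2).comp Subtype.val_injective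
  have hL' : Function.Injective L' :=
    (emb_injective (l := m) rowVar_injective2).comp Subtype.val_injective
  have hr : LinearMap.range L = LinearMap.range L' := by
    apply le_antisymm
    · rintro _ ⟨w, rfl⟩
      obtain ⟨w', hw'⟩ := exists_emb_eq_of_mem_weightSpace w.2
      exact ⟨⟨w', mem_weightSpace_of_emb_eq' hw'.symm⟩, hw'⟩
    · rintro _ ⟨w', rfl⟩
      obtain ⟨w, hw⟩ := exists_emb_eq_of_mem_weightSpace' w'.2
      exact ⟨⟨w, mem_weightSpace_of_emb_eq hw⟩, hw⟩
  let φ₀ := (LinearEquiv.ofInjective L hL).trans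
    ((LinearEquiv.ofEq _ _ hr).trans (LinearEquiv.ofInjective L' hL').symm)
  have hφ₀ : ∀ w, L' (φ₀ w) = L w := by
    intro w
    have := congrArg Subtype.val (LinearEquiv.apply_symm_apply (LinearEquiv.ofInjective L' hL')
      (LinearEquiv.ofEq _ _ hr (LinearEquiv.ofInjective L hL w)))
    exact this
  refine ⟨φ₀.trans (LinearEquiv.smulOfNeZero ℂ _ c hc), fun w => ?_⟩
  have h := hφ₀ w
  rw [LinearEquiv.trans_apply, LinearEquiv.smulOfNeZero_apply, Submodule.coe_smul, map_smul]
  exact congrArg (c • ·) h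

theorem expo_idxOf (d : Fin k → Fin n → ℕ) (h1 : ∀ i, ∑ a, d a i = l i)
    (h2 : ∀ a, ∑ i, d a i = m a) :
    expo colVar (idxOf d h1) = expo rowVar (idxOf (fun i a => d a i) h2) := by
  ext ⟨a, i⟩
  exact (expo_apply colVar_injective2 (idxOf d h1) i a).trans
    (expo_apply rowVar_injective2 (idxOf (fun i a => d a i) h2) a i).symm

variable [NeZero k] [NeZero n]

theorem exists_sendsBasis {v : ∀ i, V k (l i)} (hv : ∀ i, IsHighestWeightVector (v i))
    {v' : ∀ a, V n (m a)} (hv' : ∀ a, IsHighestWeightVector (v' a)) :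
    ∃ φ : weightSpace k l m ≃ₗ[ℂ] weightSpace n m l, SendsBasis v v' φ ∧ IsScalar φ := by
  choose c hc0 hc using fun i => V.eq_smul_of_isHighestWeightVector (hv i)
  choose c' hc'0 hc' using fun a => V.eq_smul_of_isHighestWeightVector (hv' a)
  set γ := ∏ i, c i * (l i).factorial with hγ
  set γ' := ∏ a, c' a * (m a).factorial with hγ'
  have hγ0 : γ ≠ 0 := Finset.prod_ne_zero_iff.mpr fun i _ =>
    mul_ne_zero (hc0 i) (Nat.cast_ne_zero.mpr (Nat.factorial_ne_zero _))
  have hγ'0 : γ' ≠ 0 := Finset.prod_ne_zero_iff.mpr fun a _ =>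
    mul_ne_zero (hc'0 a) (Nat.cast_ne_zero.mpr (Nat.factorial_ne_zero _))
  -- The ratio of the d-independent constants of v_d on the two sides is the scalar by which φ must
  -- multiply polynomials.
  have hq : γ' / γ ≠ 0 := div_ne_zero hγ'0 hγ0
  obtain ⟨φ, hφ⟩ := exists_isScalar (l := l) (m := m) hq
  refine ⟨φ, fun d hd => ?_, _, hq, hφ⟩
  have h1 : (γ' / γ) • emb l colVar (vVec v d) =
      emb m rowVar (vVec v' fun i a => d a i) := by
    rw [vVec_eq v c hc d hd.1, vVec_eq v' c' hc' (fun i a => d a i) hd.2, map_smul, map_smul,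
      emb_basisT, emb_basisT, expo_idxOf d hd.1 hd.2, smul_smul, ← mul_assoc, ← hγ,
      div_mul_cancel₀ _ hγ0, Finset.prod_comm]
  have h2 : vVec v d ∈ weightSpace k l m := by
    rw [← map_smul] at h1
    have h3 := mem_weightSpace_of_emb_eq h1
    rwa [Submodule.smul_mem_iff _ hq] at h3
  refine ⟨h2, emb_injective (l := m) rowVar_injective2 ?_⟩
  rw [hφ, h1]

/-- The vectors v_d are nonzero multiples of the basis tensors of weight m, and these span the
weight subspace. -/
theorem SendsBasis.unique {v : ∀ i, V k (l i)} (hv : ∀ i, IsHighestWeightVector (v i))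
    {v' : ∀ a, V n (m a)} {φ ψ : weightSpace k l m ≃ₗ[ℂ] weightSpace n m l}
    (hφ : SendsBasis v v' φ) (hψ : SendsBasis v v' ψ) : ψ = φ := by
  choose c hc0 hc using fun i => V.eq_smul_of_isHighestWeightVector (hv i)
  let K : Submodule ℂ (T k l) :=
    (LinearMap.eqLocus ψ.toLinearMap φ.toLinearMap).map (weightSpace k l m).subtype
  suffices hK : ∀ w ∈ weightSpace k l m, w ∈ K by
    refine LinearEquiv.ext fun w => ?_
    obtain ⟨w₁, h1, h2⟩ := hK w w.2
    rw [← Subtype.ext (a1 := w₁) (a2 := w) h2]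
    exact h1
  intro w hw
  rw [← (basisT k l).linearCombination_repr w, Finsupp.linearCombination_apply]
  refine K.sum_mem fun α hα => K.smul_mem _ ?_
  let d : Fin k → Fin n → ℕ := fun a i => (α i).1 a
  have hd1 : ∀ i, ∑ a, d a i = l i := fun i =>
    (Finsupp.degree_eq_sum (α i).1).symm.trans (α i).2
  -- A basis tensor occurring in a weight vector has the same weight, so its exponents form an
  -- admissible matrix.
  have hd2 : ∀ a, ∑ i, d a i = m a := by
    intro a
    have h := repr_apply_of_eigen (basisT k l) (eTot_basisT a) w α
    rw [mem_weightSpace.mp hw a, map_smul, Finsupp.smul_apply, smul_eq_mul] at h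
    have := mul_right_cancel₀ (Finsupp.mem_support_iff.mp hα) h
    exact_mod_cast this.symm
  have hαd : idxOf d hd1 = α := by
    funext i
    ext a
    rfl
  obtain ⟨h1, h2⟩ := hφ d ⟨hd1, hd2⟩
  obtain ⟨_, h3⟩ := hψ d ⟨hd1, hd2⟩
  have h4 : vVec v d ∈ K := ⟨⟨vVec v d, h1⟩, Subtype.ext (h3.trans h2.symm), rfl⟩
  rw [vVec_eq v c hc d hd1, hαd, Submodule.smul_mem_iff] at h4
  · exact h4
  · refine mul_ne_zero (Finset.prod_ne_zero_iff.mpr fun i _ =>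
      mul_ne_zero (hc0 i) (Nat.cast_ne_zero.mpr (Nat.factorial_ne_zero _)))
      (Finset.prod_ne_zero_iff.mpr fun i _ => Finset.prod_ne_zero_iff.mpr fun a _ =>
      inv_ne_zero (Nat.cast_ne_zero.mpr (Nat.factorial_ne_zero _)))

end Main

end GLDuality

end

/-! ### The duality theorem. -/

open GLDuality
theorem mainTheorem4 (k n : ℕ) [NeZero k] [NeZero n] (κ : ℂ) (hκ : κ ≠ 0)
    (l : Fin n → ℕ) (m : Fin k → ℕ) (hlm : ∑ i, l i = ∑ a, m a)
    (v : ∀ i, V k (l i)) (hv : ∀ i, IsHighestWeightVector (v i))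
    (v' : ∀ a, V n (m a)) (hv' : ∀ a, IsHighestWeightVector (v' a)) :
    ∃ φ : weightSpace k l m ≃ₗ[ℂ] weightSpace n m l,
      SendsBasis v v' φ ∧
      (∀ ψ : weightSpace k l m ≃ₗ[ℂ] weightSpace n m l, SendsBasis v v' ψ → ψ = φ) ∧
      ∀ (u : (Fin n → ℂ) → (Fin k → ℂ) → weightSpace k l m) (z : Fin n → ℂ) (lam : Fin k → ℂ),
        (VecDifferentiableAt u z lam →
          (∀ i, (∀ j, j ≠ i → z j ≠ z i) → ConjAt φ (ratKZ κ i) (ratDD κ i) u z lam) ∧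
          (∀ a, (∀ b, b ≠ a → lam b ≠ lam a) → ConjAt φ (ratDD κ a) (ratKZ κ a) u z lam) ∧
          (∀ i, (∀ j, j ≠ i → z j ≠ z i ∧ z j ≠ 0) →
            ConjAt φ (trigKZ κ i) (trigDD κ i) u z lam) ∧
          (∀ a, (∀ b, b ≠ a → lam b ≠ lam a ∧ lam b ≠ 0) →
            ConjAt φ (trigDD κ a) (trigKZ κ a) u z lam)) ∧
        ((∀ b, lam b ≠ 0) → ∀ i : Fin n,
          (∀ j, i < j → ∀ N : ℤ, z i - z j ≠ N) →
          (∀ j, j < i → ∀ N : ℤ, z j - z i - κ ≠ N) →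
            ConjAt φ (qKZ κ i) (normQDD κ i) u z lam) ∧
        ((∀ j, z j ≠ 0) → ∀ a : Fin k,
          (∀ b, a < b → ∀ N : ℤ, lam a - lam b ≠ N) →
          (∀ b, b < a → ∀ N : ℤ, lam b - lam a - κ ≠ N) →
            ConjAt φ (normQDD κ a) (qKZ κ a) u z lam) := by
  obtain ⟨φ, hφ, hs⟩ := exists_sendsBasis hv hv'
  refine ⟨φ, hφ, fun ψ hψ => hφ.unique hv hψ, fun u z lam => ⟨fun hu => ⟨?_, ?_, ?_, ?_⟩, ?_, ?_⟩⟩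
  · exact fun i _ => conjAt_ratKZ hs κ hu i
  -- The dual identity: the KZ statement for gl_n applied to φ⁻¹ and the function φ u, with the two
  -- groups of variables exchanged.
  · exact fun a _ => (conjAt_ratKZ hs.symm κ hu.swap a).of_symm
  · exact fun i hz => conjAt_trigKZ hs κ hu i hz
  · exact fun a hz => (conjAt_trigKZ hs.symm κ hu.swap a hz).of_symm
  · exact fun _ i h1 h2 => conjAt_qKZ hs κ u lam i h1 h2
  · exact fun _ a h1 h2 => (conjAt_qKZ hs.symm κ (fun lam z => φ (u z lam)) z a h1 h2).of_symm
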